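/- Let $\mathbb{F}$ be a finite field with $k$ elements and let $\mathbb{F}((X^{-1}))$ be the field of formal Laurent series in $X^{-1}$ over $\mathbb{F}$, with the absolute value $|f| = k^{N}$, where $X^N$ is the highest power of $X$ occurring in $f \neq 0$, and $|0| = 0$. For vectors and matrices over this field write $|\cdot|_\infty$ for the maximum of the absolute values of the entries, and for $\mathbf{v} \in \mathbb{F}((X^{-1}))^n$ let $\|\mathbf{v}\|$ be the distance in $|\cdot|_\infty$ from $\mathbf{v}$ to the nearest point of $\mathbb{F}[X]^n$. Let $m, n \geq 1$, let $S \subseteq \mathbb{F}[X]^m$ be infinite, and let $$v(S) = \inf\Big\{ v \in \mathbb{R} : \sum_{\mathbf{q} \in S,\ \mathbf{q} \neq 0} |\mathbf{q}|_\infty^{-v} < \infty \Big\}.$$ Let $\psi : \mathbb{F}[X]^m \to \{k^r : r \in \mathbb{Z}\}$ be such that $\psi(\mathbf{q})$ depends only on $|\mathbf{q}|_\infty$ and is decreasing (not necessarily strictly) as a function of $|\mathbf{q}|_\infty$, and suppose that the limit $$\lambda(\psi) = \lim_{|\mathbf{q}|_\infty \to \infty,\ \mathbf{q} \in S} \frac{-\log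 \psi(\mathbf{q})}{\log |\mathbf{q}|_\infty}$$ exists (as a real number). Let $\mathcal{W}_S(m,n;\psi)$ be the set of all $m \times n$ matrices $A$ over $\mathbb{F}((X^{-1}))$ such that $\|\mathbf{q}A\| < \psi(\mathbf{q})$ for infinitely many $\mathbf{q} \in S$. 1. If $n\lambda(\psi) < v(S)$, then $\mathcal{W}_S(m,n;\psi)$ has full measure with respect to the Haar measure on the space of $m \times n$ matrices over $\mathbb{F}((X^{-1}))$, that is, its complement has Haar measure $0$. 2. If $n\lambda(\psi) \geq v(S)$, then the Hausdorff dimension of $\mathcal{W}_S(m,n;\psi)$, with respect to the metric given by $|\cdot|_\infty$, is $$n(m-1) + \frac{n + v(S)}{1 + \lambda(\psi)}.$$ -/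

import Mathlib

open Filter Topology MeasureTheory
open scoped Polynomial

/-- The field `𝔽((X⁻¹))` of formal Laurent series in `X⁻¹`. An element is a formal Laurent series
`∑ i ≥ N, a i * T ^ i` in a variable `T`, where `T` stands for `X⁻¹`.
(This is a type synonym, because `LaurentSeries` carries its own uniform structure.) -/
def LaurentInf (F : Type*) [Field F] : Type _ := LaurentSeries F

namespace LaurentInf

variable {F : Type*} [Field F]

noncomputable instance : Field (LaurentInf F) := inferInstanceAs (Field (LaurentSeries F))

noncomputable instance : Algebra F (LaurentInf F) := inferInstanceAs (Algebra F (LaurentSeries F))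

/-- The Laurent series with coefficients `a i`, seen as an element of `𝔽((X⁻¹))`. -/
def ofSeries (f : LaurentSeries F) : LaurentInf F := f

/-- The coefficient of `X⁻ⁱ`. -/
def coeff (f : LaurentInf F) (i : ℤ) : F := HahnSeries.coeff (show LaurentSeries F from f) i

/-- The least `i` such that the coefficient of `X⁻ⁱ` is nonzero (for `f ≠ 0`). -/
noncomputable def ord (f : LaurentInf F) : ℤ := HahnSeries.order (show LaurentSeries F from f)

variable (F) in
/-- The element `X` of `𝔽((X⁻¹))`. -/
noncomputable def X : LaurentInf F := ofSeries (HahnSeries.single (-1 : ℤ) (1 : F))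

/-- The embedding of `𝔽[X]` into `𝔽((X⁻¹))` that sends the polynomial variable to `X`. -/
noncomputable def ofPoly (p : F[X]) : LaurentInf F := Polynomial.aeval (X F) p

variable (F) in
theorem one_lt_card [Finite F] : (1 : ℝ) < Nat.card F := by
  exact_mod_cast Finite.one_lt_card

open Classical in
variable (F) in
/-- The absolute value on `𝔽((X⁻¹))`: `|f| = k ^ N`, where `k` is the number of elements of `𝔽`
and `X ^ N` is the highest power of `X` that occurs in `f` (so `N = -ord f`), and `|0| = 0`. -/
noncomputable def absVal [Finite F] : AbsoluteValue (LaurentInf F) ℝ where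
  toFun f := if f = 0 then 0 else (Nat.card F : ℝ) ^ (-ord f)
  map_mul' f g := by
    have hk : (Nat.card F : ℝ) ≠ 0 := (zero_lt_one.trans (one_lt_card F)).ne'
    by_cases hf : f = 0
    · simp [hf]
    by_cases hg : g = 0
    · simp [hg]
    have h : ord (f * g) = ord f + ord g :=
      HahnSeries.order_mul (show (show LaurentSeries F from f) ≠ 0 from hf)
        (show (show LaurentSeries F from g) ≠ 0 from hg)
    simp only [hf, hg, mul_eq_zero, or_self, if_false, h, neg_add, zpow_add₀ hk]
  nonneg' f := by
    show (0 : ℝ) ≤ if f = 0 then 0 else (Nat.card F : ℝ) ^ (-ord f)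
    split_ifs <;> positivity
  eq_zero' f := by
    have hk : (Nat.card F : ℝ) ≠ 0 := (zero_lt_one.trans (one_lt_card F)).ne'
    show (if f = 0 then 0 else (Nat.card F : ℝ) ^ (-ord f)) = 0 ↔ f = 0
    split_ifs with h
    · simp [h]
    · simp [h, zpow_ne_zero _ hk]
  add_le' f g := by
    have hk := one_lt_card F
    have hk0 : (0 : ℝ) < Nat.card F := zero_lt_one.trans hk
    show (if f + g = 0 then (0 : ℝ) else (Nat.card F : ℝ) ^ (-ord (f + g))) ≤
      (if f = 0 then 0 else (Nat.card F : ℝ) ^ (-ord f)) +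
        (if g = 0 then 0 else (Nat.card F : ℝ) ^ (-ord g))
    by_cases hfg : f + g = 0
    · rw [if_pos hfg]
      have h1 : (0 : ℝ) ≤ if f = 0 then 0 else (Nat.card F : ℝ) ^ (-ord f) := by
        split_ifs <;> positivity
      have h2 : (0 : ℝ) ≤ if g = 0 then 0 else (Nat.card F : ℝ) ^ (-ord g) := by
        split_ifs <;> positivity
      exact add_nonneg h1 h2
    by_cases hf : f = 0
    · simp [hf]
    by_cases hg : g = 0
    · simp [hg]
    simp only [hf, hg, hfg, if_false]
    have h : min (ord f) (ord g) ≤ ord (f + g) :=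
      HahnSeries.min_order_le_order_add
        (x := (show LaurentSeries F from f)) (y := (show LaurentSeries F from g)) hfg
    rcases min_le_iff.1 h with h | h
    · exact (zpow_le_zpow_right₀ hk.le (neg_le_neg h)).trans
        (le_add_of_nonneg_right (zpow_pos hk0 _).le)
    · exact (zpow_le_zpow_right₀ hk.le (neg_le_neg h)).trans
        (le_add_of_nonneg_left (zpow_pos hk0 _).le)

/-- `𝔽((X⁻¹))` as a normed field, with the metric `|f - g|`. -/
noncomputable instance [Finite F] : NormedField (LaurentInf F) := (absVal F).toNormedField

theorem norm_of_ne_zero [Finite F] {f : LaurentInf F} (hf : f ≠ 0) :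
    ‖f‖ = (Nat.card F : ℝ) ^ (-ord f) := if_neg hf

/-- The power series `∑ i ≥ 0, a i * X⁻ⁱ`. -/
noncomputable def ofSeq (a : ℕ → F) : LaurentInf F :=
  ofSeries (HahnSeries.ofPowerSeries ℤ F (PowerSeries.mk a))

theorem norm_le_iff [Finite F] (f : LaurentInf F) (N : ℤ) :
    ‖f‖ ≤ (Nat.card F : ℝ) ^ (-N) ↔ ∀ i < N, coeff f i = 0 := by
  have hk := one_lt_card F
  by_cases hf : f = 0
  · subst hf
    simp only [norm_zero]
    exact ⟨fun _ i _ => HahnSeries.coeff_zero, fun _ => by positivity⟩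
  rw [norm_of_ne_zero hf, zpow_le_zpow_iff_right₀ hk, neg_le_neg_iff]
  constructor
  · intro h i hi
    exact HahnSeries.coeff_eq_zero_of_lt_order (lt_of_lt_of_le hi h)
  · intro h
    by_contra! hlt
    exact hf (HahnSeries.coeff_order_eq_zero.1 (h _ hlt))

theorem coeff_ofSeq_nat (a : ℕ → F) (i : ℕ) : coeff (ofSeq a) i = a i := by
  unfold coeff ofSeq ofSeries
  exact (HahnSeries.ofPowerSeries_apply_coeff _ i).trans (PowerSeries.coeff_mk _ _)

theorem coeff_ofSeq_neg (a : ℕ → F) {i : ℤ} (hi : i < 0) : coeff (ofSeq a) i = 0 := by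
  unfold coeff ofSeq ofSeries
  refine HahnSeries.embDomain_of_notMem_range ?_
  rintro ⟨j, rfl⟩
  have : (0 : ℤ) ≤ j := Int.natCast_nonneg j
  exact absurd hi (not_lt.2 this)

/-- `𝔽((X⁻¹))` is locally compact, so that it and the spaces of matrices over it have Haar
measures. -/
instance [Finite F] : LocallyCompactSpace (LaurentInf F) := by
  have hk := one_lt_card F
  let _ : TopologicalSpace F := ⊥
  have _ : DiscreteTopology F := ⟨rfl⟩
  have hcont : Continuous (ofSeq : (ℕ → F) → LaurentInf F) := by
    rw [continuous_iff_continuousAt]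
    intro a
    rw [ContinuousAt, Metric.tendsto_nhds]
    intro ε hε
    obtain ⟨N, hN⟩ := exists_pow_lt_of_lt_one hε (inv_lt_one_of_one_lt₀ hk)
    have hopen : ∀ᶠ b in 𝓝 a, ∀ i ∈ Finset.range N, b i = a i := by
      rw [Filter.eventually_all_finset]
      intro i _
      have := (continuous_apply (A := fun _ : ℕ => F) i).continuousAt (x := a)
      exact this.eventually (p := fun y => y = a i) (by rw [nhds_discrete]; exact rfl)
    filter_upwards [hopen] with b hb
    rw [dist_eq_norm]
    refine lt_of_le_of_lt ((norm_le_iff _ (N : ℤ)).2 ?_) (by simpa using hN)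
    intro i hi
    have hsub : coeff (ofSeq b - ofSeq a) i = coeff (ofSeq b) i - coeff (ofSeq a) i := rfl
    rw [hsub]
    rcases lt_or_ge i 0 with h | h
    · rw [coeff_ofSeq_neg _ h, coeff_ofSeq_neg _ h, sub_zero]
    · lift i to ℕ using h
      rw [coeff_ofSeq_nat, coeff_ofSeq_nat, hb i (by simpa using hi), sub_self]
  have hball : Metric.closedBall (0 : LaurentInf F) 1 ⊆ Set.range ofSeq := by
    intro f hf
    have hf' : ∀ i < 0, coeff f i = 0 :=
      (norm_le_iff f 0).1 (by simpa using hf)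
    refine ⟨fun i => coeff f i, HahnSeries.ext (funext fun i => ?_)⟩
    show coeff (ofSeq _) i = coeff f i
    rcases lt_or_ge i 0 with h | h
    · rw [coeff_ofSeq_neg _ h, hf' i h]
    · lift i to ℕ using h
      rw [coeff_ofSeq_nat]
  have hcomp : IsCompact (Set.range (ofSeq : (ℕ → F) → LaurentInf F)) := isCompact_range hcont
  exact hcomp.locallyCompactSpace_of_mem_nhds_of_addGroup
    (mem_of_superset (Metric.closedBall_mem_nhds 0 one_pos) hball)

/-- A vector of polynomials as a vector over `𝔽((X⁻¹))`. -/
noncomputable def vec {m : ℕ} (q : Fin m → F[X]) : Fin m → LaurentInf F := fun i => ofPoly (q i)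

/-- `|q|_∞ = max |qᵢ|` for a vector `q` of polynomials. -/
noncomputable def infAbs [Finite F] {m : ℕ} (q : Fin m → F[X]) : ℝ := ‖vec q‖

/-- The distance from `v ∈ 𝔽((X⁻¹))ⁿ` to the nearest point of `𝔽[X]ⁿ` in the maximum norm. -/
noncomputable def distNearest [Finite F] {n : ℕ} (v : Fin n → LaurentInf F) : ℝ :=
  Metric.infDist v (Set.range (vec : (Fin n → F[X]) → Fin n → LaurentInf F))

/-- The set `W_S(m, n; ψ)` of all `m × n` matrices `A` over `𝔽((X⁻¹))` such that
`‖q A‖ < ψ q` for infinitely many `q ∈ S`. -/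
def approxSet [Finite F] {m : ℕ} (n : ℕ) (S : Set (Fin m → F[X])) (ψ : (Fin m → F[X]) → ℝ) :
    Set (Matrix (Fin m) (Fin n) (LaurentInf F)) :=
  {A | {q | q ∈ S ∧ distNearest (Matrix.vecMul (vec q) A) < ψ q}.Infinite}

/-- The exponent of convergence
`v(S) = inf {v ∈ ℝ : ∑_{q ∈ S, q ≠ 0} |q|_∞ ^ (-v) < ∞}` of an infinite set `S`. -/
noncomputable def convExponent [Finite F] {m : ℕ} (S : Set (Fin m → F[X])) : ℝ :=
  sInf {v : ℝ | Summable fun q : ↥(S \ {0}) => infAbs q.1 ^ (-v)}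

/-- `ψ` has order `l` at infinity along `S`:
`-log ψ(q) / log |q|_∞ → l` as `|q|_∞ → ∞` with `q ∈ S`. -/
def HasOrderAtInfinity [Finite F] {m : ℕ} (S : Set (Fin m → F[X])) (ψ : (Fin m → F[X]) → ℝ)
    (l : ℝ) : Prop :=
  Tendsto (fun q => -Real.log (ψ q) / Real.log (infAbs q)) (comap infAbs atTop ⊓ 𝓟 S) (𝓝 l)

end LaurentInf

-- Matrices carry the metric of the maximum norm of their entries.
attribute [local instance] Matrix.normedAddCommGroup

/-!
Let `U` be the open unit ball of the space of matrices; `S` is split into the shells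
`|q|_∞ = k ^ N`. The pairing `(t, A) ↦` coefficient of `X⁻¹` in `∑ tᵢₗ Aᵢₗ` between polynomial
matrices and Laurent matrices turns the inequality `‖q A‖ < k ^ (-r)`, for `A ∈ U`, into
orthogonality to the finite space `tensorLT n q r` of all matrices `qᵀ c` with `deg cₗ < r`
(`distNearest_lt_iff_mem_annihilator`). By duality the annihilator of a finite space `T` fills
exactly the proportion `1 / #T` of `U` (`relIndex_annihilator`). This gives exact measures of all
neighbourhoods of rational planes `q A = p`, of their intersections with balls and with each other.

*Ubiquity* (`frequently_real_diff_le`). The events `‖q A‖ < k ^ (-r)` and `‖q' A‖ < k ^ (-r)` are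
independent up to the factor `#(tensorLT n q r ⊓ tensorLT n q' r)`. A nonzero `t` lies in
`tensorLT n q r` only if a component of `q` divides an entry of `t`, and that component
determines `q`; so the divisor bound `Polynomial.exists_natCard_divisors_le` controls the second
moment on a shell. A shell with far more than `k ^ (r n)` elements therefore produces neighbourhoods
that cover `U` up to small measure. Below the exponent of convergence infinitely many shells are
that large for `r = ⌊τ N⌋`, when `n τ < v(S)`.

*Full measure* (`measure_compl_approxSet`). If `n λ < v(S)`, take `λ < τ < v(S) / n`, and use that
the approximable set is invariant under translation by polynomial matrices, which move every matrix
into `U`.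

*Upper bound* (`dimH_approxSet_le`). In `U`, the set of solutions for one `q` with `|q|_∞ = k ^ N`
and `ψ q = k ^ (-r)` is a union of `k ^ ((N + r) m n - r n)` balls of radius `k ^ (-(N + r))`, and
the sum of the `s`-th powers of these radii over `q ∈ S` converges for every `s` above the claimed
dimension.

*Lower bound* (`le_dimH_approxSet`). A set has positive Hausdorff measure if no family of balls of
small `s`-mass covers it. Given such a family, a well approximable matrix outside of it is built as
the limit of nested balls. Each step goes first to a random point of a wide neighbourhood of a
rational plane, with `r = ⌊τ N⌋` supplied by ubiquity, and then to a random point of a narrow one,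
with `r = ⌈b N⌉` and `b > λ`. The first moment `exists_avoids_of_average` shows that some choice
avoids the large balls of the family and keeps the mass of the small ones near it under control.
This succeeds when `(1 + b) (s - n (m - 1)) < n (1 + τ)`, and as `b → λ` and `n τ → v(S)` this is
the claimed dimension.
-/

/-! ### Coefficients and absolute values of Laurent series -/

namespace LaurentInf

section Coefficients

variable {F : Type*} [Field F]

theorem coeff_zero (t : ℤ) : coeff (0 : LaurentInf F) t = 0 := rfl

theorem coeff_add (f g : LaurentInf F) (t : ℤ) : coeff (f + g) t = coeff f t + coeff g t := rfl

theorem coeff_sub (f g : LaurentInf F) (t : ℤ) : coeff (f - g) t = coeff f t - coeff g t := rfl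

theorem coeff_neg (f : LaurentInf F) (t : ℤ) : coeff (-f) t = -coeff f t := rfl

theorem coeff_smul (a : F) (f : LaurentInf F) (t : ℤ) : coeff (a • f) t = a * coeff f t := by
  have h : algebraMap F (LaurentInf F) a = (HahnSeries.C a : LaurentSeries F) := by
    change algebraMap F (LaurentSeries F) a = _
    rw [HahnSeries.algebraMap_apply']
    simp
  rw [Algebra.smul_def, h]
  exact (congrArg (fun g : LaurentSeries F => HahnSeries.coeff g t)
    HahnSeries.C_mul_eq_smul).trans HahnSeries.coeff_smul

/-- The coefficient of `X⁻ᵗ` as a linear functional. -/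
noncomputable def coeffLinear (t : ℤ) : LaurentInf F →ₗ[F] F where
  toFun f := coeff f t
  map_add' _ _ := rfl
  map_smul' a f := coeff_smul a f t

theorem coeff_sum {ι : Type*} (s : Finset ι) (f : ι → LaurentInf F) (t : ℤ) :
    coeff (∑ i ∈ s, f i) t = ∑ i ∈ s, coeff (f i) t :=
  map_sum (coeffLinear t) f s

theorem coeff_X_mul (f : LaurentInf F) (t : ℤ) : coeff (X F * f) t = coeff f (t + 1) := by
  have h := HahnSeries.coeff_single_mul (r := (1 : F)) (x := (show LaurentSeries F from f))
    (a := t) (b := -1)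
  rw [one_mul, sub_neg_eq_add] at h
  exact h

theorem coeff_X_pow_mul (i : ℕ) (f : LaurentInf F) (t : ℤ) :
    coeff (X F ^ i * f) t = coeff f (t + i) := by
  induction i generalizing t with
  | zero => simp
  | succ i ih =>
    rw [pow_succ', mul_assoc, coeff_X_mul, ih]
    congr 1
    push_cast
    ring

theorem coeff_ofPoly_mul (p : F[X]) (f : LaurentInf F) (t : ℤ) :
    coeff (ofPoly p * f) t = p.sum fun i a => a * coeff f (t + i) := by
  rw [ofPoly, Polynomial.aeval_eq_sum_range, Finset.sum_mul, coeff_sum,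
    Polynomial.sum_over_range _ (by simp)]
  refine Finset.sum_congr rfl fun i _ => ?_
  rw [smul_mul_assoc, coeff_smul, coeff_X_pow_mul]

theorem coeff_one (t : ℤ) : coeff (1 : LaurentInf F) t = if t = 0 then 1 else 0 := by
  have h := HahnSeries.coeff_one (Γ := ℤ) (R := F) (a := t)
  refine Eq.trans (b := HahnSeries.coeff (1 : LaurentSeries F) t) rfl (h.trans ?_)
  congr

theorem coeff_ofPoly_neg (p : F[X]) (i : ℕ) : coeff (ofPoly p) (-i) = p.coeff i := by
  rw [← mul_one (ofPoly p), coeff_ofPoly_mul, Polynomial.sum_def]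
  simp only [coeff_one, mul_ite, mul_one, mul_zero]
  have h (x : ℕ) : (-(i : ℤ) + x = 0) ↔ x = i := by omega
  simp +contextual [h, eq_comm]

theorem coeff_ofPoly_of_pos (p : F[X]) {t : ℤ} (ht : 0 < t) : coeff (ofPoly p) t = 0 := by
  rw [← mul_one (ofPoly p), coeff_ofPoly_mul, Polynomial.sum_def]
  refine Finset.sum_eq_zero fun i _ => ?_
  rw [coeff_one, if_neg (by omega), mul_zero]

theorem ofPoly_injective : Function.Injective (ofPoly : F[X] → LaurentInf F) := by
  intro p q h
  ext i
  rw [← coeff_ofPoly_neg, ← coeff_ofPoly_neg, h]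

theorem ofPoly_zero : ofPoly (0 : F[X]) = 0 := map_zero (Polynomial.aeval (X F))

theorem ofPoly_add (p q : F[X]) : ofPoly (p + q) = ofPoly p + ofPoly q :=
  map_add (Polynomial.aeval (X F)) p q

theorem ofPoly_mul (p q : F[X]) : ofPoly (p * q) = ofPoly p * ofPoly q :=
  map_mul (Polynomial.aeval (X F)) p q

theorem ofPoly_smul (a : F) (p : F[X]) : ofPoly (a • p) = a • ofPoly p :=
  map_smul (Polynomial.aeval (X F)) a p

theorem ofPoly_sum {ι : Type*} (s : Finset ι) (p : ι → F[X]) :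
    ofPoly (∑ i ∈ s, p i) = ∑ i ∈ s, ofPoly (p i) :=
  map_sum (Polynomial.aeval (X F)) p s

theorem ofPoly_ne_zero {p : F[X]} (hp : p ≠ 0) : ofPoly p ≠ 0 := by
  rw [← ofPoly_zero]
  exact ofPoly_injective.ne hp

end Coefficients

section Norm

variable {F : Type*} [Field F] [Finite F]

theorem card_pos_real (F : Type*) [Field F] [Finite F] : (0 : ℝ) < Nat.card F :=
  zero_lt_one.trans (one_lt_card F)

theorem norm_lt_iff (f : LaurentInf F) (N : ℤ) :
    ‖f‖ < (Nat.card F : ℝ) ^ (-N) ↔ ∀ i ≤ N, coeff f i = 0 := by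
  have hk := one_lt_card F
  constructor
  · intro h i hi
    by_cases hf : f = 0
    · rw [hf, coeff_zero]
    rw [norm_of_ne_zero hf, zpow_lt_zpow_iff_right₀ hk, neg_lt_neg_iff] at h
    exact HahnSeries.coeff_eq_zero_of_lt_order (lt_of_le_of_lt hi h)
  · intro h
    refine ((norm_le_iff f (N + 1)).2 fun i hi => h i (by omega)).trans_lt ?_
    exact zpow_lt_zpow_right₀ hk (by omega)

/-- Every Laurent series has a polynomial part. -/
theorem exists_ofPoly_coeff_eq (f : LaurentInf F) :
    ∃ p : F[X], ∀ t ≤ 0, coeff (ofPoly p) t = coeff f t := by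
  obtain ⟨D, hD⟩ := pow_unbounded_of_one_lt ‖f‖ (one_lt_card F)
  have h0 : ∀ t ≤ (-D : ℤ), coeff f t = 0 := (norm_lt_iff f (-D)).1 (by simpa using hD)
  refine ⟨∑ i ∈ Finset.range D, Polynomial.monomial i (coeff f (-(i : ℤ))), fun t ht => ?_⟩
  obtain ⟨i, rfl⟩ : ∃ i : ℕ, t = -(i : ℤ) := ⟨t.natAbs, by omega⟩
  rw [coeff_ofPoly_neg, Polynomial.finsetSum_coeff]
  simp only [Polynomial.coeff_monomial, Finset.sum_ite_eq', Finset.mem_range]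
  split_ifs with h
  · rfl
  · exact (h0 _ (by omega)).symm

theorem norm_ofPoly_le_iff (p : F[X]) (N : ℕ) :
    ‖ofPoly p‖ ≤ (Nat.card F : ℝ) ^ N ↔ p.natDegree ≤ N := by
  have h := norm_le_iff (ofPoly p) (-N)
  rw [neg_neg, zpow_natCast] at h
  rw [h, Polynomial.natDegree_le_iff_coeff_eq_zero]
  constructor
  · intro H i hi
    rw [← coeff_ofPoly_neg]
    exact H _ (by omega)
  · intro H t ht
    obtain ⟨i, rfl⟩ : ∃ i : ℕ, t = -(i : ℤ) := ⟨t.natAbs, by omega⟩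
    rw [coeff_ofPoly_neg]
    exact H _ (by omega)

theorem norm_ofPoly {p : F[X]} (hp : p ≠ 0) : ‖ofPoly p‖ = (Nat.card F : ℝ) ^ p.natDegree := by
  refine le_antisymm ((norm_ofPoly_le_iff p _).2 le_rfl) ?_
  by_contra! h
  have h2 := norm_lt_iff (ofPoly p) (-p.natDegree)
  rw [neg_neg, zpow_natCast] at h2
  have h3 := h2.1 h _ le_rfl
  rw [coeff_ofPoly_neg] at h3
  exact hp (Polynomial.leadingCoeff_eq_zero.1 h3)

end Norm

section Vectors

variable {F : Type*} [Field F] [Finite F] {m n : ℕ}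

theorem infAbs_le_iff (q : Fin m → F[X]) (N : ℕ) :
    infAbs q ≤ (Nat.card F : ℝ) ^ N ↔ ∀ i, (q i).natDegree ≤ N := by
  rw [infAbs, pi_norm_le_iff_of_nonneg (pow_nonneg (card_pos_real F).le _)]
  exact forall_congr' fun i => norm_ofPoly_le_iff _ _

theorem infAbs_nonneg (q : Fin m → F[X]) : 0 ≤ infAbs q := norm_nonneg _

/-- The maximum in `|q|_∞` is attained. -/
theorem exists_infAbs_eq {q : Fin m → F[X]} (hq : q ≠ 0) :
    ∃ i, q i ≠ 0 ∧ infAbs q = (Nat.card F : ℝ) ^ (q i).natDegree := by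
  obtain ⟨i₀, hi₀⟩ := Function.ne_iff.1 hq
  obtain ⟨i, -, hi⟩ := Finset.exists_max_image Finset.univ (fun i => ‖ofPoly (q i)‖)
    ⟨i₀, Finset.mem_univ _⟩
  have hpos : 0 < ‖ofPoly (q i)‖ :=
    (norm_pos_iff.2 (ofPoly_ne_zero hi₀)).trans_le (hi i₀ (Finset.mem_univ _))
  have hne : q i ≠ 0 := by
    rintro h
    rw [h, ofPoly_zero, norm_zero] at hpos
    exact lt_irrefl _ hpos
  refine ⟨i, hne, ?_⟩
  rw [← norm_ofPoly hne]
  refine le_antisymm ((pi_norm_le_iff_of_nonneg (norm_nonneg _)).2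
    fun j => hi j (Finset.mem_univ _)) (norm_le_pi_norm (vec q) i)

theorem infAbs_zero : infAbs (0 : Fin m → F[X]) = 0 := by
  have : vec (0 : Fin m → F[X]) = 0 := funext fun i => ofPoly_zero
  rw [infAbs, this, norm_zero]

theorem exists_infAbs_eq_pow {q : Fin m → F[X]} (hq : q ≠ 0) :
    ∃ N : ℕ, infAbs q = (Nat.card F : ℝ) ^ N :=
  let ⟨_, _, h⟩ := exists_infAbs_eq hq
  ⟨_, h⟩

theorem ne_zero_of_infAbs_eq_pow {q : Fin m → F[X]} {N : ℕ}
    (h : infAbs q = (Nat.card F : ℝ) ^ N) : q ≠ 0 := by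
  rintro rfl
  rw [infAbs_zero] at h
  exact (pow_pos (card_pos_real F) N).ne h

/-- A vector with `|q|_∞ = k ^ N` has a component of degree exactly `N`. -/
theorem exists_norm_eq {q : Fin m → F[X]} {N : ℕ} (h : infAbs q = (Nat.card F : ℝ) ^ N) :
    ∃ i, q i ≠ 0 ∧ (q i).natDegree = N := by
  obtain ⟨i, hi, h2⟩ := exists_infAbs_eq (ne_zero_of_infAbs_eq_pow h)
  rw [h] at h2
  exact ⟨i, hi, (pow_right_injective₀ (card_pos_real F) (one_lt_card F).ne' h2).symm⟩

theorem natDegree_le_of_infAbs_eq {q : Fin m → F[X]} {N : ℕ}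
    (h : infAbs q = (Nat.card F : ℝ) ^ N) (i : Fin m) : (q i).natDegree ≤ N :=
  (infAbs_le_iff q N).1 h.le i

/-- `‖v‖ < k ^ (-r)` says that the coefficients of `X⁻¹, …, X⁻ʳ` vanish. -/
theorem distNearest_lt_iff (v : Fin n → LaurentInf F) (r : ℕ) :
    distNearest v < (Nat.card F : ℝ) ^ (-(r : ℤ)) ↔
      ∀ l, ∀ t : ℤ, 0 < t → t ≤ r → coeff (v l) t = 0 := by
  rw [distNearest, Metric.infDist_lt_iff (Set.range_nonempty _)]
  have hpos : (0 : ℝ) < (Nat.card F : ℝ) ^ (-(r : ℤ)) := zpow_pos (card_pos_real F) _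
  constructor
  · rintro ⟨_, ⟨p, rfl⟩, h⟩ l t ht htr
    rw [dist_eq_norm, pi_norm_lt_iff hpos] at h
    have h2 := (norm_lt_iff _ _).1 (h l) t htr
    rw [Pi.sub_apply, coeff_sub] at h2
    change _ - coeff (ofPoly (p l)) t = 0 at h2
    rwa [coeff_ofPoly_of_pos _ ht, sub_zero] at h2
  · intro h
    choose p hp using fun l => exists_ofPoly_coeff_eq (v l)
    refine ⟨vec p, ⟨p, rfl⟩, ?_⟩
    rw [dist_eq_norm, pi_norm_lt_iff hpos]
    intro l
    rw [norm_lt_iff]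
    intro t ht
    rw [Pi.sub_apply, coeff_sub]
    change _ - coeff (ofPoly (p l)) t = 0
    rcases le_or_gt t 0 with h0 | h0
    · rw [hp l t h0, sub_self]
    · rw [coeff_ofPoly_of_pos _ h0, h l t h0 ht, sub_zero]

theorem distNearest_lt_one (v : Fin n → LaurentInf F) : distNearest v < 1 := by
  have h := (distNearest_lt_iff v 0).2 fun l t h1 h2 => by
    exact absurd h2 (by push_cast; omega)
  simpa using h

end Vectors

end LaurentInf

/-! ### Duality between polynomial matrices and matrices of Laurent series -/

/-- A subgroup of finite relative index tiles the bigger subgroup by translates. -/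
theorem measure_eq_relIndex_mul {G : Type*} [AddGroup G] [MeasurableSpace G] [MeasurableAdd G]
    (μ : Measure G) [μ.IsAddLeftInvariant] {H K : AddSubgroup G} (hHK : H ≤ K)
    (hH : MeasurableSet (H : Set G)) (hfin : H.relIndex K ≠ 0) :
    μ (K : Set G) = H.relIndex K * μ (H : Set G) := by
  let ι := K ⧸ H.addSubgroupOf K
  have hcard : Nat.card ι = H.relIndex K := rfl
  have : Finite ι := Nat.finite_of_card_ne_zero (hcard.trans_ne hfin)
  let C : ι → Set G := fun c => (fun x => -(c.out : G) + x) ⁻¹' (H : Set G)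
  have hmk (c : ι) (x : K) (hx : (x : G) ∈ C c) : c = QuotientAddGroup.mk x := by
    rw [← c.out_eq']
    refine QuotientAddGroup.eq.2 ?_
    exact hx
  have hun : (K : Set G) = ⋃ c, C c := by
    ext x
    simp only [Set.mem_iUnion]
    constructor
    · intro hx
      refine ⟨QuotientAddGroup.mk ⟨x, hx⟩, ?_⟩
      have h := QuotientAddGroup.eq.1 (Quotient.out_eq'
        (QuotientAddGroup.mk (⟨x, hx⟩ : K) : K ⧸ H.addSubgroupOf K))
      exact h
    · rintro ⟨c, hc⟩
      have := K.add_mem c.out.2 (hHK hc)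
      simpa using this
  have hd : Pairwise (Function.onFun Disjoint C) := by
    intro c d hcd
    refine Set.disjoint_left.2 fun x hx hy => hcd ?_
    have hxK : x ∈ (K : Set G) := by
      rw [hun]
      exact Set.mem_iUnion.2 ⟨c, hx⟩
    rw [hmk c ⟨x, hxK⟩ hx, hmk d ⟨x, hxK⟩ hy]
  rw [hun, measure_iUnion hd fun c => measurable_const_add _ hH]
  simp only [C, measure_preimage_add]
  rw [ENNReal.tsum_const, ENat.card_eq_coe_natCard, hcard]
  rfl

/-- A left-nondegenerate pairing of a finite-dimensional space with an arbitrary one identifies the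
former with the dual of a quotient of the latter. -/
theorem natCard_quotient_ker_flip {K T V : Type*} [Field K] [Finite K] [AddCommGroup V]
    [Module K V] [AddCommGroup T] [Module K T] [FiniteDimensional K T] (β : T →ₗ[K] V →ₗ[K] K)
    (hβ : Function.Injective β) :
    Nat.card (V ⧸ LinearMap.ker β.flip) = Nat.card T := by
  have h0 : (LinearMap.range β.flip).dualCoannihilator = ⊥ := by
    rw [eq_bot_iff]
    intro t ht
    rw [Submodule.mem_dualCoannihilator] at ht
    refine (map_eq_zero_iff β hβ).1 (LinearMap.ext fun v => ht _ ⟨v, rfl⟩)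
  have h1 := Subspace.finrank_add_finrank_dualCoannihilator_eq (LinearMap.range β.flip)
  rw [h0, finrank_bot, add_zero] at h1
  have h2 := β.flip.quotKerEquivRange.finrank_eq.trans h1
  have h3 : FiniteDimensional K (LinearMap.range β.flip) := by
    have : FiniteDimensional K (T →ₗ[K] K) := inferInstance
    infer_instance
  have hfin : Module.Finite K (V ⧸ LinearMap.ker β.flip) :=
    Module.Finite.equiv β.flip.quotKerEquivRange.symm
  rw [Module.natCard_eq_pow_finrank (K := K), Module.natCard_eq_pow_finrank (K := K) (V := T), h2]

namespace LaurentInf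

/-- The space of `m × n` matrices over `𝔽((X⁻¹))`. -/
abbrev LaurentMatrix (F : Type*) [Field F] (m n : ℕ) : Type _ :=
  Matrix (Fin m) (Fin n) (LaurentInf F)

section Pairing

variable {F : Type*} [Field F] {m n : ℕ}

/-- The `F`-bilinear pairing of a polynomial matrix `t` with a matrix `A` of Laurent series: the
coefficient of `X⁻¹` in `∑ tᵢₗ Aᵢₗ`. The characters of the group of matrices modulo polynomial
matrices all factor through some `pairing t`. -/
noncomputable def pairing : Matrix (Fin m) (Fin n) F[X] →ₗ[F]
    LaurentMatrix F m n →ₗ[F] F :=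
  LinearMap.mk₂ F (fun t A => coeff (∑ i, ∑ l, ofPoly (t i l) * A i l) 1)
    (fun t t' A => by
      simp only [Matrix.add_apply, ofPoly_add, add_mul, Finset.sum_add_distrib, coeff_add])
    (fun a t A => by
      simp only [Matrix.smul_apply, ofPoly_smul, smul_mul_assoc, ← Finset.smul_sum, coeff_smul,
        smul_eq_mul])
    (fun t A A' => by
      simp only [Matrix.add_apply, mul_add, Finset.sum_add_distrib, coeff_add])
    (fun a t A => by
      simp only [Matrix.smul_apply, mul_smul_comm, ← Finset.smul_sum, coeff_smul, smul_eq_mul])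

theorem pairing_apply (t : Matrix (Fin m) (Fin n) F[X]) (A : LaurentMatrix F m n) :
    pairing t A = coeff (∑ i, ∑ l, ofPoly (t i l) * A i l) 1 := rfl

variable (F m n) in
/-- The matrices `A` with `|A|_∞ < k ^ (-j)`, for a natural number `j`. -/
def ballSubmodule (j : ℕ) : Submodule F (LaurentMatrix F m n) where
  carrier := {A | ∀ i l, ∀ t ≤ (j : ℤ), coeff (A i l) t = 0}
  add_mem' {A B} hA hB i l t ht := by
    rw [Matrix.add_apply, coeff_add, hA i l t ht, hB i l t ht, add_zero]
  zero_mem' _ _ _ _ := rfl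
  smul_mem' a A hA i l t ht := by rw [Matrix.smul_apply, coeff_smul, hA i l t ht, mul_zero]

theorem ballSubmodule_anti {a b : ℕ} (hab : a ≤ b) :
    ballSubmodule F m n b ≤ ballSubmodule F m n a :=
  fun _ hA i l t ht => hA i l t (ht.trans (by exact_mod_cast hab))

theorem pairing_separates {t : Matrix (Fin m) (Fin n) F[X]} (ht : t ≠ 0) :
    ∃ A ∈ ballSubmodule F m n 0, pairing t A ≠ 0 := by
  obtain ⟨i, l, hil⟩ : ∃ i l, t i l ≠ 0 := by
    by_contra! h
    exact ht (Matrix.ext h)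
  let d := (t i l).natDegree
  let f : LaurentInf F := ofSeries (HahnSeries.single ((d : ℤ) + 1) 1)
  have hf (s : ℤ) : coeff f s = if s = (d : ℤ) + 1 then 1 else 0 := by
    refine (HahnSeries.coeff_single (Γ := ℤ)).trans ?_
    congr
  refine ⟨Matrix.single i l f, ?_, ?_⟩
  · intro i' l' s hs
    rw [Matrix.single_apply]
    split_ifs
    · rw [hf, if_neg]
      push_cast at hs
      omega
    · rfl
  · have h1 : ∑ i', ∑ l', ofPoly (t i' l') * Matrix.single i l f i' l' = ofPoly (t i l) * f := by
      rw [Finset.sum_eq_single i, Finset.sum_eq_single l]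
      · rw [Matrix.single_apply_same]
      · intro b _ hb
        rw [Matrix.single_apply, if_neg (fun h => hb h.2.symm), mul_zero]
      · simp
      · intro b _ hb
        refine Finset.sum_eq_zero fun c _ => ?_
        rw [Matrix.single_apply, if_neg (fun h => hb h.1.symm), mul_zero]
      · simp
    rw [pairing_apply, h1, coeff_ofPoly_mul, Polynomial.sum_def]
    simp only [hf]
    have h2 (x : ℕ) : ((1 : ℤ) + x = (d : ℤ) + 1) ↔ x = d := by omega
    simp only [h2, mul_ite, mul_one, mul_zero, Finset.sum_ite_eq']
    rw [if_pos (Polynomial.natDegree_mem_support_of_nonzero hil)]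
    exact Polynomial.leadingCoeff_ne_zero.2 hil

/-- The matrices in the open unit ball that are orthogonal to all matrices of `T`. -/
noncomputable def annihilator (T : Submodule F (Matrix (Fin m) (Fin n) F[X])) :
    Submodule F (LaurentMatrix F m n) where
  carrier := {A | A ∈ ballSubmodule F m n 0 ∧ ∀ t ∈ T, pairing t A = 0}
  add_mem' {A B} hA hB := ⟨add_mem hA.1 hB.1, fun t ht => by
    rw [map_add, hA.2 t ht, hB.2 t ht, add_zero]⟩
  zero_mem' := ⟨zero_mem _, fun t _ => map_zero _⟩
  smul_mem' a A hA := ⟨Submodule.smul_mem _ a hA.1, fun t ht => by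
    rw [map_smul, hA.2 t ht, smul_zero]⟩

theorem mem_annihilator {T : Submodule F (Matrix (Fin m) (Fin n) F[X])}
    {A : LaurentMatrix F m n} :
    A ∈ annihilator T ↔ A ∈ ballSubmodule F m n 0 ∧ ∀ t ∈ T, pairing t A = 0 := Iff.rfl

theorem annihilator_le (T : Submodule F (Matrix (Fin m) (Fin n) F[X])) :
    annihilator T ≤ ballSubmodule F m n 0 := fun _ h => h.1

theorem annihilator_sup (T T' : Submodule F (Matrix (Fin m) (Fin n) F[X])) :
    annihilator (T ⊔ T') = annihilator T ⊓ annihilator T' := by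
  ext A
  simp only [Submodule.mem_inf, mem_annihilator]
  constructor
  · rintro ⟨hA, h⟩
    exact ⟨⟨hA, fun t ht => h t (Submodule.mem_sup_left ht)⟩,
      hA, fun t ht => h t (Submodule.mem_sup_right ht)⟩
  · rintro ⟨⟨hA, h1⟩, -, h2⟩
    refine ⟨hA, fun t ht => ?_⟩
    obtain ⟨a, ha, b, hb, rfl⟩ := Submodule.mem_sup.1 ht
    rw [map_add, LinearMap.add_apply, h1 a ha, h2 b hb, add_zero]

/-- Duality: `T` is finite-dimensional and the pairing separates its points, so the quotient of the
unit ball by the annihilator of `T` is the dual space of `T`. -/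
theorem relIndex_annihilator [Finite F] (T : Submodule F (Matrix (Fin m) (Fin n) F[X])) [Finite T] :
    (annihilator T).toAddSubgroup.relIndex (ballSubmodule F m n 0).toAddSubgroup = Nat.card T := by
  let U := ballSubmodule F m n 0
  let β : T →ₗ[F] U →ₗ[F] F := (pairing.domRestrict₂ U).domRestrict T
  have hβ : Function.Injective β := by
    refine (injective_iff_map_eq_zero β).2 fun t ht => ?_
    by_contra h
    obtain ⟨A, hA, hne⟩ := pairing_separates (fun h' => h (Subtype.ext h'))
    exact hne (LinearMap.congr_fun ht (⟨A, hA⟩ : U))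
  have : Module.Finite F T := Module.Finite.of_finite
  have hN : (annihilator T).toAddSubgroup.addSubgroupOf U.toAddSubgroup =
      (LinearMap.ker β.flip).toAddSubgroup := by
    ext A
    constructor
    · intro hA
      change β.flip (⟨A.1, A.2⟩ : U) = 0
      exact LinearMap.ext fun t => hA.2 t t.2
    · intro hA
      change β.flip (⟨A.1, A.2⟩ : U) = 0 at hA
      exact ⟨A.2, fun t ht => LinearMap.congr_fun hA (⟨t, ht⟩ : T)⟩
  rw [AddSubgroup.relIndex, hN]
  exact natCard_quotient_ker_flip β hβ

end Pairing

end LaurentInf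

/-! ### Spaces of frequencies -/

theorem natCard_sup_mul_natCard_inf {K V : Type*} [Field K] [Finite K] [AddCommGroup V]
    [Module K V] (S T : Submodule K V) [Finite S] [Finite T] :
    Nat.card ↥(S ⊔ T) * Nat.card ↥(S ⊓ T) = Nat.card S * Nat.card T := by
  have : Module.Finite K S := Module.Finite.of_finite
  have : Module.Finite K T := Module.Finite.of_finite
  rw [Module.natCard_eq_pow_finrank (K := K), Module.natCard_eq_pow_finrank (K := K) (V := S),
    Module.natCard_eq_pow_finrank (K := K) (V := T),
    Module.natCard_eq_pow_finrank (K := K) (V := ↥(S ⊓ T)), ← pow_add, ← pow_add,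
    Submodule.finrank_sup_add_finrank_inf_eq]

theorem finite_sup_submodule {K V : Type*} [Field K] [Finite K] [AddCommGroup V]
    [Module K V] (S T : Submodule K V) [Finite S] [Finite T] : Finite ↥(S ⊔ T) := by
  refine Finite.of_surjective (fun x : S × T => (⟨x.1 + x.2, Submodule.add_mem_sup x.1.2 x.2.2⟩ :
    ↥(S ⊔ T))) ?_
  rintro ⟨x, hx⟩
  obtain ⟨a, ha, b, hb, rfl⟩ := Submodule.mem_sup.1 hx
  exact ⟨(⟨a, ha⟩, ⟨b, hb⟩), rfl⟩

theorem natCard_degreeLT (F : Type*) [Field F] (r : ℕ) :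
    Nat.card (Polynomial.degreeLT F r) = Nat.card F ^ r := by
  rw [Nat.card_congr (Polynomial.degreeLTEquiv F r).toEquiv, Nat.card_fun, Nat.card_fin]

theorem finite_degreeLT (F : Type*) [Field F] [Finite F] (r : ℕ) :
    Finite (Polynomial.degreeLT F r) :=
  Finite.of_equiv _ (Polynomial.degreeLTEquiv F r).symm.toEquiv

namespace LaurentInf

section Frequencies

variable {F : Type*} [Field F] {m n : ℕ}

variable (F m n) in
/-- The polynomial matrices with all entries of degree less than `j`. -/
def polyLT (j : ℕ) : Submodule F (Matrix (Fin m) (Fin n) F[X]) where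
  carrier := {t | ∀ i l, t i l ∈ Polynomial.degreeLT F j}
  add_mem' hs ht i l := add_mem (hs i l) (ht i l)
  zero_mem' _ _ := zero_mem _
  smul_mem' a _ ht i l := Submodule.smul_mem _ a (ht i l)

/-- The rank one polynomial matrices `qᵀ c` with all entries of `c` of degree less than `r`. -/
def tensorLT (n : ℕ) (q : Fin m → F[X]) (r : ℕ) : Submodule F (Matrix (Fin m) (Fin n) F[X]) where
  carrier := {t | ∃ c : Fin n → F[X], (∀ l, c l ∈ Polynomial.degreeLT F r) ∧
    t = Matrix.vecMulVec q c}
  add_mem' := by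
    rintro _ _ ⟨c, hc, rfl⟩ ⟨d, hd, rfl⟩
    exact ⟨c + d, fun l => add_mem (hc l) (hd l), (Matrix.vecMulVec_add q c d).symm⟩
  zero_mem' := ⟨0, fun _ => zero_mem _, by ext; simp [Matrix.vecMulVec_apply]⟩
  smul_mem' := by
    rintro a _ ⟨c, hc, rfl⟩
    exact ⟨a • c, fun l => Submodule.smul_mem _ a (hc l), by
      ext i l : 2
      simp [Matrix.vecMulVec_apply]⟩

/-- A matrix in `polyLT F m n j` as the family of its entries. -/
def polyLTEquiv (j : ℕ) : polyLT F m n j ≃ (Fin m → Fin n → Polynomial.degreeLT F j) where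
  toFun t i l := ⟨t.1 i l, t.2 i l⟩
  invFun f := ⟨Matrix.of fun i l => (f i l).1, fun i l => (f i l).2⟩
  left_inv _ := rfl
  right_inv _ := rfl

theorem natCard_polyLT (j : ℕ) :
    Nat.card (polyLT F m n j) = Nat.card F ^ (j * (m * n)) := by
  rw [Nat.card_congr (polyLTEquiv j), Nat.card_fun, Nat.card_fun, natCard_degreeLT,
    Nat.card_fin, Nat.card_fin, ← pow_mul, ← pow_mul]
  congr 1
  ring

theorem finite_polyLT [Finite F] (j : ℕ) : Finite (polyLT F m n j) := by
  have := finite_degreeLT F j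
  exact Finite.of_equiv _ (polyLTEquiv j).symm

theorem tensorLT_equiv {q : Fin m → F[X]} (hq : q ≠ 0) (r : ℕ) :
    Nonempty ((Fin n → Polynomial.degreeLT F r) ≃ (tensorLT n q r)) := by
  refine ⟨Equiv.ofBijective
    (fun c => ⟨Matrix.vecMulVec q fun l => (c l).1, _, fun l => (c l).2, rfl⟩) ⟨?_, ?_⟩⟩
  · intro c d h
    obtain ⟨i, hi⟩ := Function.ne_iff.1 hq
    funext l
    have h2 := congrFun (congrFun (Subtype.ext_iff.1 h) i) l
    exact Subtype.ext (mul_left_cancel₀ hi h2)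
  · rintro ⟨_, c, hc, rfl⟩
    exact ⟨fun l => ⟨c l, hc l⟩, rfl⟩

theorem natCard_tensorLT {q : Fin m → F[X]} (hq : q ≠ 0) (r : ℕ) :
    Nat.card (tensorLT n q r) =
      Nat.card F ^ (r * n) := by
  obtain ⟨e⟩ := tensorLT_equiv (n := n) hq r
  rw [← Nat.card_congr e, Nat.card_fun, natCard_degreeLT, Nat.card_fin, ← pow_mul]

theorem finite_tensorLT [Finite F] {q : Fin m → F[X]} (hq : q ≠ 0) (r : ℕ) :
    Finite (tensorLT n q r) := by
  obtain ⟨e⟩ := tensorLT_equiv (n := n) hq r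
  have := finite_degreeLT F r
  exact Finite.of_equiv _ e

theorem coeff_ofPoly_mul_eq_zero {p : F[X]} {r : ℕ} (hp : p ∈ Polynomial.degreeLT F r)
    {f : LaurentInf F} (hf : ∀ t : ℤ, 0 < t → t ≤ r → coeff f t = 0) :
    coeff (ofPoly p * f) 1 = 0 := by
  rw [coeff_ofPoly_mul, Polynomial.sum_def]
  refine Finset.sum_eq_zero fun s hs => ?_
  have hs' : s < r := by
    by_contra! h
    refine Polynomial.mem_support_iff.1 hs (Polynomial.coeff_eq_zero_of_degree_lt ?_)
    exact (Polynomial.mem_degreeLT.1 hp).trans_le (by exact_mod_cast h)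
  rw [hf _ (by omega) (by omega), mul_zero]

theorem coeff_ofPoly_X_pow_mul (s : ℕ) (f : LaurentInf F) :
    coeff (ofPoly (Polynomial.X ^ s) * f) 1 = coeff f (1 + s) := by
  rw [ofPoly, map_pow, Polynomial.aeval_X, coeff_X_pow_mul]

theorem X_pow_mem_degreeLT {s r : ℕ} (h : s < r) :
    (Polynomial.X ^ s : F[X]) ∈ Polynomial.degreeLT F r := by
  rw [Polynomial.mem_degreeLT, Polynomial.degree_X_pow]
  exact_mod_cast h

theorem pairing_single (i : Fin m) (l : Fin n) (p : F[X])
    (A : LaurentMatrix F m n) :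
    pairing (Matrix.single i l p) A = coeff (ofPoly p * A i l) 1 := by
  rw [pairing_apply, Finset.sum_eq_single i, Finset.sum_eq_single l]
  · rw [Matrix.single_apply_same]
  · intro b _ hb
    rw [Matrix.single_apply, if_neg (fun h => hb h.2.symm), ofPoly_zero, zero_mul]
  · simp
  · intro b _ hb
    refine Finset.sum_eq_zero fun c _ => ?_
    rw [Matrix.single_apply, if_neg (fun h => hb h.1.symm), ofPoly_zero, zero_mul]
  · simp

theorem pairing_vecMulVec (q : Fin m → F[X]) (c : Fin n → F[X])
    (A : LaurentMatrix F m n) :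
    pairing (Matrix.vecMulVec q c) A =
      ∑ l, coeff (ofPoly (c l) * Matrix.vecMul (vec q) A l) 1 := by
  rw [pairing_apply, Finset.sum_comm, coeff_sum]
  refine Finset.sum_congr rfl fun l _ => ?_
  congr 1
  change _ = ofPoly (c l) * ∑ i, ofPoly (q i) * A i l
  rw [Finset.mul_sum]
  refine Finset.sum_congr rfl fun i _ => ?_
  rw [Matrix.vecMulVec_apply, ofPoly_mul]
  ring

theorem annihilator_polyLT (j : ℕ) : annihilator (polyLT F m n j) = ballSubmodule F m n j := by
  ext A
  constructor
  · rintro ⟨hA, h⟩ i l t ht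
    rcases le_or_gt t 0 with h0 | h0
    · exact hA i l t h0
    obtain ⟨s, rfl⟩ : ∃ s : ℕ, t = 1 + s := ⟨(t - 1).toNat, by omega⟩
    rw [← coeff_ofPoly_X_pow_mul, ← pairing_single]
    refine h _ fun i' l' => ?_
    rw [Matrix.single_apply]
    split_ifs
    · exact X_pow_mem_degreeLT (by omega)
    · exact zero_mem _
  · intro hA
    refine ⟨ballSubmodule_anti (Nat.zero_le j) hA, fun t ht => ?_⟩
    rw [pairing_apply, coeff_sum]
    refine Finset.sum_eq_zero fun i _ => ?_
    rw [coeff_sum]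
    exact Finset.sum_eq_zero fun l _ => coeff_ofPoly_mul_eq_zero (ht i l) fun t _ h => hA i l t h

theorem mem_annihilator_tensorLT {q : Fin m → F[X]} {r : ℕ}
    {A : LaurentMatrix F m n} :
    A ∈ annihilator (tensorLT n q r) ↔ A ∈ ballSubmodule F m n 0 ∧
      ∀ l, ∀ t : ℤ, 0 < t → t ≤ r → coeff (Matrix.vecMul (vec q) A l) t = 0 := by
  refine and_congr_right fun _ => ⟨fun h l t ht htr => ?_, ?_⟩
  · obtain ⟨s, rfl⟩ : ∃ s : ℕ, t = 1 + s := ⟨(t - 1).toNat, by omega⟩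
    have h2 := h (Matrix.vecMulVec q (Pi.single l (Polynomial.X ^ s))) ⟨_, fun l' => by
      rcases eq_or_ne l' l with rfl | hl
      · rw [Pi.single_eq_same]
        exact X_pow_mem_degreeLT (by omega)
      · rw [Pi.single_eq_of_ne hl]
        exact zero_mem _, rfl⟩
    rw [pairing_vecMulVec, Finset.sum_eq_single l] at h2
    · rwa [Pi.single_eq_same, coeff_ofPoly_X_pow_mul] at h2
    · intro b _ hb
      rw [Pi.single_eq_of_ne hb, ofPoly_zero, zero_mul, coeff_zero]
    · simp
  · rintro h _ ⟨c, hc, rfl⟩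
    rw [pairing_vecMulVec]
    exact Finset.sum_eq_zero fun l _ => coeff_ofPoly_mul_eq_zero (hc l) (h l)

theorem annihilator_tensorLT_zero (q : Fin m → F[X]) :
    annihilator (tensorLT n q 0) = ballSubmodule F m n 0 := by
  ext A
  rw [mem_annihilator_tensorLT]
  refine and_iff_left fun l t h1 h2 => ?_
  push_cast at h2
  omega

/-- In the open unit ball, `‖q A‖ < k ^ (-r)` is an orthogonality relation. -/
theorem distNearest_lt_iff_mem_annihilator [Finite F] {q : Fin m → F[X]} {r : ℕ}
    {A : LaurentMatrix F m n} (hA : A ∈ ballSubmodule F m n 0) :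
    distNearest (Matrix.vecMul (vec q) A) < (Nat.card F : ℝ) ^ (-(r : ℤ)) ↔
      A ∈ annihilator (tensorLT n q r) := by
  rw [distNearest_lt_iff, mem_annihilator_tensorLT]
  exact (and_iff_right hA).symm

/-- Degrees add up: if `|q|_∞ = k ^ N`, then `qᵀ c` has entries of degree less than `j` if and only
if `c` has entries of degree less than `j - N`. -/
theorem polyLT_inf_tensorLT [Finite F] {q : Fin m → F[X]} {N : ℕ}
    (hq : infAbs q = (Nat.card F : ℝ) ^ N) {j r : ℕ} (hj : N ≤ j) (hjr : j ≤ N + r) :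
    polyLT F m n j ⊓ tensorLT n q r = tensorLT n q (j - N) := by
  ext t
  constructor
  · rintro ⟨ht, c, hc, rfl⟩
    refine ⟨c, fun l => ?_, rfl⟩
    obtain ⟨i, hi, hN⟩ := exists_norm_eq hq
    have h := ht i l
    rcases eq_or_ne (c l) 0 with h0 | h0
    · rw [h0]
      exact zero_mem _
    rw [Matrix.vecMulVec_apply, Polynomial.mem_degreeLT, Polynomial.degree_mul,
      Polynomial.degree_eq_natDegree hi, Polynomial.degree_eq_natDegree h0, hN] at h
    rw [Polynomial.mem_degreeLT, Polynomial.degree_eq_natDegree h0]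
    have h' : N + (c l).natDegree < j := by exact_mod_cast h
    exact_mod_cast (by omega : (c l).natDegree < j - N)
  · rintro ⟨c, hc, rfl⟩
    refine ⟨fun i l => ?_, c, fun l => ?_, rfl⟩
    · rw [Matrix.vecMulVec_apply]
      rcases eq_or_ne (c l) 0 with h0 | h0
      · rw [h0, mul_zero]
        exact zero_mem _
      rcases eq_or_ne (q i) 0 with h1 | h1
      · rw [h1, zero_mul]
        exact zero_mem _
      have h2 := natDegree_le_of_infAbs_eq hq i
      have h := hc l
      rw [Polynomial.mem_degreeLT, Polynomial.degree_eq_natDegree h0] at h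
      have h' : (c l).natDegree < j - N := by exact_mod_cast h
      rw [Polynomial.mem_degreeLT, Polynomial.degree_mul, Polynomial.degree_eq_natDegree h0,
        Polynomial.degree_eq_natDegree h1]
      exact_mod_cast (by omega : (q i).natDegree + (c l).natDegree < j)
    · exact Polynomial.degreeLT_mono (by omega) (hc l)

theorem annihilator_anti {S T : Submodule F (Matrix (Fin m) (Fin n) F[X])} (h : S ≤ T) :
    annihilator T ≤ annihilator S := fun _ hA => ⟨hA.1, fun t ht => hA.2 t (h ht)⟩

theorem exists_le_polyLT (T : Submodule F (Matrix (Fin m) (Fin n) F[X])) [Finite T] :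
    ∃ j, T ≤ polyLT F m n j := by
  obtain ⟨j, hj⟩ := (Set.finite_range
    fun x : T × Fin m × Fin n => (x.1.1 x.2.1 x.2.2).natDegree).bddAbove
  refine ⟨j + 1, fun t ht i l => ?_⟩
  have h : (t i l).natDegree ≤ j := hj ⟨(⟨t, ht⟩, i, l), rfl⟩
  rw [Polynomial.mem_degreeLT]
  exact Polynomial.degree_le_natDegree.trans_lt (by exact_mod_cast Nat.lt_succ_of_le h)

end Frequencies

end LaurentInf

/-! ### Haar measure of annihilators -/

namespace LaurentInf

section Topology

variable {F : Type*} [Field F] [Finite F] {m n : ℕ}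

instance : ProperSpace (LaurentInf F) := by
  have hX : 1 < ‖X F‖ := by
    have h : X F = ofPoly Polynomial.X := (Polynomial.aeval_X (X F)).symm
    rw [h, norm_ofPoly Polynomial.X_ne_zero, Polynomial.natDegree_X, pow_one]
    exact one_lt_card F
  let _ : NontriviallyNormedField (LaurentInf F) :=
    { (inferInstance : NormedField (LaurentInf F)) with non_trivial := ⟨X F, hX⟩ }
  exact ProperSpace.of_locallyCompactSpace (LaurentInf F)

instance : ProperSpace (LaurentMatrix F m n) :=
  inferInstanceAs (ProperSpace (Fin m → Fin n → LaurentInf F))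

theorem mem_ballSubmodule_iff_norm {j : ℕ} {A : LaurentMatrix F m n} :
    A ∈ ballSubmodule F m n j ↔ ‖A‖ < (Nat.card F : ℝ) ^ (-(j : ℤ)) := by
  rw [Matrix.norm_lt_iff (zpow_pos (card_pos_real F) _)]
  exact forall_congr' fun i => forall_congr' fun l => (norm_lt_iff _ _).symm

theorem coe_ballSubmodule (j : ℕ) : (ballSubmodule F m n j : Set (LaurentMatrix F m n)) =
    Metric.ball 0 ((Nat.card F : ℝ) ^ (-(j : ℤ))) := by
  ext A
  rw [SetLike.mem_coe, mem_ballSubmodule_iff_norm, mem_ball_zero_iff]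

theorem isOpen_ballSubmodule (j : ℕ) :
    IsOpen (ballSubmodule F m n j : Set (LaurentMatrix F m n)) := by
  rw [coe_ballSubmodule]
  exact Metric.isOpen_ball

theorem isClosed_ballSubmodule (j : ℕ) :
    IsClosed (ballSubmodule F m n j : Set (LaurentMatrix F m n)) :=
  AddSubgroup.isClosed_of_isOpen (ballSubmodule F m n j).toAddSubgroup (isOpen_ballSubmodule j)

theorem isCompact_ballSubmodule (j : ℕ) :
    IsCompact (ballSubmodule F m n j : Set (LaurentMatrix F m n)) := by
  refine Metric.isCompact_of_isClosed_isBounded (isClosed_ballSubmodule j) ?_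
  rw [coe_ballSubmodule]
  exact Metric.isBounded_ball

theorem isOpen_annihilator (T : Submodule F (Matrix (Fin m) (Fin n) F[X])) [Finite T] :
    IsOpen (annihilator T : Set (LaurentMatrix F m n)) := by
  obtain ⟨j, hj⟩ := exists_le_polyLT T
  refine AddSubgroup.isOpen_of_mem_nhds (annihilator T).toAddSubgroup (g := 0) ?_
  refine mem_of_superset ((isOpen_ballSubmodule j).mem_nhds (zero_mem _)) ?_
  rw [← annihilator_polyLT]
  exact annihilator_anti hj

end Topology

section Measure

variable {F : Type*} [Field F] [Finite F] {m n : ℕ}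
  [MeasurableSpace (LaurentMatrix F m n)]
  (μ : Measure (LaurentMatrix F m n)) [μ.IsAddHaarMeasure]

theorem measure_ballSubmodule_ne_zero (j : ℕ) :
    μ (ballSubmodule F m n j : Set (LaurentMatrix F m n)) ≠ 0 :=
  ((isOpen_ballSubmodule j).measure_pos μ ⟨0, zero_mem _⟩).ne'

theorem measure_ballSubmodule_ne_top (j : ℕ) :
    μ (ballSubmodule F m n j : Set (LaurentMatrix F m n)) ≠ ⊤ :=
  (isCompact_ballSubmodule j).measure_ne_top

theorem real_ballSubmodule_pos (j : ℕ) :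
    0 < μ.real (ballSubmodule F m n j : Set (LaurentMatrix F m n)) :=
  ENNReal.toReal_pos (measure_ballSubmodule_ne_zero μ j) (measure_ballSubmodule_ne_top μ j)

variable [BorelSpace (LaurentMatrix F m n)]

theorem measure_annihilator_mul (T : Submodule F (Matrix (Fin m) (Fin n) F[X])) [Finite T] :
    μ (annihilator T : Set (LaurentMatrix F m n)) * Nat.card T =
      μ (ballSubmodule F m n 0 : Set (LaurentMatrix F m n)) := by
  have h := measure_eq_relIndex_mul μ (H := (annihilator T).toAddSubgroup)
    (K := (ballSubmodule F m n 0).toAddSubgroup) (annihilator_le T)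
    (isOpen_annihilator T).measurableSet (by
      rw [relIndex_annihilator]
      exact Nat.card_pos.ne')
  rw [relIndex_annihilator, mul_comm] at h
  exact h.symm

theorem real_annihilator (T : Submodule F (Matrix (Fin m) (Fin n) F[X])) [Finite T] :
    μ.real (annihilator T : Set (LaurentMatrix F m n)) =
      μ.real (ballSubmodule F m n 0 : Set (LaurentMatrix F m n)) / Nat.card T := by
  have hc : (Nat.card T : ℝ) ≠ 0 := by exact_mod_cast Nat.card_pos.ne'
  rw [eq_div_iff hc, Measure.real, Measure.real, ← measure_annihilator_mul μ T, ENNReal.toReal_mul,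
    ENNReal.toReal_natCast]

theorem real_ballSubmodule (j : ℕ) :
    μ.real (ballSubmodule F m n j : Set (LaurentMatrix F m n)) =
      μ.real (ballSubmodule F m n 0 : Set (LaurentMatrix F m n)) /
        (Nat.card F : ℝ) ^ (j * (m * n)) := by
  have := finite_polyLT (F := F) (m := m) (n := n) j
  rw [← annihilator_polyLT, real_annihilator, natCard_polyLT, Nat.cast_pow]

theorem real_annihilator_tensorLT {q : Fin m → F[X]} (hq : q ≠ 0) (r : ℕ) :
    μ.real (annihilator (tensorLT n q r) : Set (LaurentMatrix F m n)) =
      μ.real (ballSubmodule F m n 0 : Set (LaurentMatrix F m n)) / (Nat.card F : ℝ) ^ (r * n) := by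
  have := finite_tensorLT (n := n) hq r
  rw [real_annihilator, natCard_tensorLT hq, Nat.cast_pow]

/-- A ball of radius at most `k ^ (-N)` around `0` sees only the plane `q A = 0`, of codimension
`n`. As long as the radius is at least the thickness `k ^ (-(N + r))` of its neighbourhood, the part
of the neighbourhood in the ball has the measure of a neighbourhood of a linear subspace. -/
theorem real_ballSubmodule_inf_annihilator {q : Fin m → F[X]} {N : ℕ}
    (hq : infAbs q = (Nat.card F : ℝ) ^ N) {j r : ℕ} (hj : N ≤ j) (hjr : j ≤ N + r) :
    μ.real (ballSubmodule F m n j ⊓ annihilator (tensorLT n q r) : Submodule F _) =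
      μ.real (ballSubmodule F m n 0 : Set (LaurentMatrix F m n)) *
        (Nat.card F : ℝ) ^ ((j - N) * n) / (Nat.card F : ℝ) ^ (j * (m * n) + r * n) := by
  have hq0 := ne_zero_of_infAbs_eq_pow hq
  have := finite_tensorLT (n := n) hq0 r
  have := finite_polyLT (F := F) (m := m) (n := n) j
  have := finite_sup_submodule (polyLT F m n j) (tensorLT n q r)
  have hc := natCard_sup_mul_natCard_inf (polyLT F m n j) (tensorLT n q r)
  rw [polyLT_inf_tensorLT hq hj hjr, natCard_tensorLT hq0, natCard_tensorLT hq0, natCard_polyLT,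
    ← pow_add] at hc
  rw [← annihilator_polyLT, ← annihilator_sup, real_annihilator]
  have hk := card_pos_real F
  have hc' : (Nat.card ↥(polyLT F m n j ⊔ tensorLT n q r) : ℝ) * (Nat.card F : ℝ) ^ ((j - N) * n) =
      (Nat.card F : ℝ) ^ (j * (m * n) + r * n) := by exact_mod_cast hc
  have h0 : (Nat.card ↥(polyLT F m n j ⊔ tensorLT n q r) : ℝ) ≠ 0 := by
    exact_mod_cast Nat.card_pos.ne'
  rw [← hc']
  have := (pow_pos hk ((j - N) * n)).ne'
  field_simp

theorem measurableSet_ballSubmodule (j : ℕ) :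
    MeasurableSet (ballSubmodule F m n j : Set (LaurentMatrix F m n)) :=
  (isOpen_ballSubmodule j).measurableSet

end Measure

end LaurentInf

/-! ### The number of divisors of a polynomial -/

section Divisors

open UniqueFactorizationMonoid Polynomial

variable {F : Type*} [Field F]

theorem Polynomial.eq_of_associated_of_leadingCoeff_eq {p q : F[X]} (hp : p ≠ 0)
    (h : Associated p q) (hl : p.leadingCoeff = q.leadingCoeff) : p = q := by
  obtain ⟨u, rfl⟩ := h
  obtain ⟨r, -, hr⟩ := Polynomial.isUnit_iff.1 u.isUnit
  rw [← hr, leadingCoeff_mul, leadingCoeff_C] at hl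
  have h1 : r = 1 := mul_left_cancel₀ (leadingCoeff_ne_zero.2 hp) (by rw [mul_one]; exact hl.symm)
  rw [← hr, h1, C_1, mul_one]

open Classical in
theorem Polynomial.sum_natDegree_normalizedFactors {t : F[X]} (ht : t ≠ 0) :
    ((normalizedFactors t).map natDegree).sum = t.natDegree := by
  rw [← natDegree_multiset_prod _ (zero_notMem_normalizedFactors t)]
  exact natDegree_eq_of_degree_eq (degree_eq_degree_of_associated (prod_normalizedFactors ht))

open Classical in
/-- A divisor is determined by its leading coefficient, the multiplicities of its prime factors of
degree less than `L`, and the multiset of its prime factors of degree at least `L`, of which there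
are at most `deg t / L`. -/
theorem Polynomial.natCard_divisors_le [Finite F] {t : F[X]} (ht : t ≠ 0) {L : ℕ} (hL : 0 < L) :
    Finite {d // d ∣ t} ∧ Nat.card {d // d ∣ t} ≤
      Nat.card F * ((t.natDegree + 1) ^ Nat.card (degreeLT F L) * 2 ^ (t.natDegree / L)) := by
  have hfin := finite_degreeLT F L
  let big : Multiset F[X] → Multiset F[X] := Multiset.filter (fun p => L ≤ p.natDegree)
  let B := (big (normalizedFactors t)).powerset.toFinset
  have hne (d : {d // d ∣ t}) : d.1 ≠ 0 := ne_zero_of_dvd_ne_zero ht d.2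
  have hle (d : {d // d ∣ t}) : normalizedFactors d.1 ≤ normalizedFactors t :=
    (dvd_iff_normalizedFactors_le_normalizedFactors (hne d) ht).1 d.2
  have hpos (x : F[X]) (hx : x ∈ normalizedFactors t) : 1 ≤ x.natDegree :=
    (irreducible_of_normalized_factor x hx).natDegree_pos
  have hcard : (normalizedFactors t).card ≤ t.natDegree := by
    rw [← sum_natDegree_normalizedFactors ht]
    simpa using Multiset.card_nsmul_le_sum (s := (normalizedFactors t).map natDegree) (a := 1)
      (by simpa using hpos)
  have hbig : (big (normalizedFactors t)).card ≤ t.natDegree / L := by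
    rw [Nat.le_div_iff_mul_le hL, ← sum_natDegree_normalizedFactors ht]
    have h1 := Multiset.card_nsmul_le_sum (s := (big (normalizedFactors t)).map natDegree) (a := L)
      (by
        intro x hx
        obtain ⟨p, hp, rfl⟩ := Multiset.mem_map.1 hx
        exact (Multiset.mem_filter.1 hp).2)
    rw [Multiset.card_map, smul_eq_mul] at h1
    refine h1.trans ?_
    obtain ⟨s, hs⟩ := Multiset.le_iff_exists_add.1
      (Multiset.map_le_map (f := natDegree) (Multiset.filter_le (fun p => L ≤ p.natDegree)
        (normalizedFactors t)))
    rw [hs, Multiset.sum_add]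
    exact Nat.le_add_right _ _
  let Φ : {d // d ∣ t} → F × (degreeLT F L → Fin (t.natDegree + 1)) × B := fun d =>
    (d.1.leadingCoeff, fun p => ⟨(normalizedFactors d.1).count p.1,
      Nat.lt_succ_of_le (((Multiset.count_le_card _ _).trans
        (Multiset.card_le_card (hle d))).trans hcard)⟩,
      ⟨big (normalizedFactors d.1), by
        rw [Multiset.mem_toFinset, Multiset.mem_powerset]
        exact Multiset.filter_le_filter _ (hle d)⟩)
  have hΦ : Function.Injective Φ := by
    intro d d' h
    simp only [Φ, Prod.mk.injEq, Subtype.mk.injEq] at h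
    obtain ⟨h1, h2, h3⟩ := h
    have hnf : normalizedFactors d.1 = normalizedFactors d'.1 := by
      ext x
      rcases lt_or_ge x.natDegree L with hx | hx
      · have hx' : x ∈ degreeLT F L := by
          rw [mem_degreeLT]
          exact degree_le_natDegree.trans_lt (by exact_mod_cast hx)
        have := congrFun h2 ⟨x, hx'⟩
        simpa using this
      · have := congrArg (Multiset.count x) h3
        rwa [Multiset.count_filter_of_pos (p := fun p : F[X] => L ≤ p.natDegree) hx,
          Multiset.count_filter_of_pos (p := fun p : F[X] => L ≤ p.natDegree) hx] at this
    refine Subtype.ext (eq_of_associated_of_leadingCoeff_eq (hne d) ?_ h1)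
    exact (prod_normalizedFactors (hne d)).symm.trans
      (hnf ▸ prod_normalizedFactors (hne d'))
  refine ⟨Finite.of_injective Φ hΦ, (Nat.card_le_card_of_injective Φ hΦ).trans ?_⟩
  rw [Nat.card_prod, Nat.card_prod, Nat.card_fun, Nat.card_fin]
  refine Nat.mul_le_mul_left _ (Nat.mul_le_mul_left _ ?_)
  rw [Nat.card_eq_fintype_card, Fintype.card_coe]
  refine (Multiset.toFinset_card_le _).trans ?_
  rw [Multiset.card_powerset]
  exact Nat.pow_le_pow_right two_pos hbig

/-- The divisor bound: a nonzero polynomial `t` has `O(|t| ^ ε)` divisors. -/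
theorem Polynomial.exists_natCard_divisors_le (F : Type*) [Field F] [Finite F] {ε : ℝ}
    (hε : 0 < ε) :
    ∃ C : ℝ, 0 < C ∧ ∀ t : F[X], t ≠ 0 → Finite {d // d ∣ t} ∧
      (Nat.card {d // d ∣ t} : ℝ) ≤ C * (Nat.card F : ℝ) ^ (ε * t.natDegree) := by
  have hk2 : (2 : ℝ) ≤ Nat.card F := by exact_mod_cast Finite.one_lt_card (α := F)
  have hk1 : (1 : ℝ) < Nat.card F := by linarith
  have hk0 : (0 : ℝ) < Nat.card F := by linarith
  obtain ⟨L, hL⟩ := exists_nat_gt (2 / ε)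
  have hL0 : (0 : ℝ) < L := (by positivity : 0 < 2 / ε).trans hL
  let P := Nat.card (degreeLT F L)
  have hlim : Tendsto (fun D : ℕ => ((D : ℝ) + 1) ^ P * ((Nat.card F : ℝ) ^ (-(ε / 2))) ^ D)
      atTop (𝓝 0) := by
    have hr : (Nat.card F : ℝ) ^ (-(ε / 2)) < 1 :=
      Real.rpow_lt_one_of_one_lt_of_neg hk1 (by linarith)
    have hr0 : 0 < (Nat.card F : ℝ) ^ (-(ε / 2)) := Real.rpow_pos_of_pos hk0 _
    have h := (tendsto_pow_const_mul_const_pow_of_lt_one P hr0.le hr).comp (tendsto_add_atTop_nat 1)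
    have h2 := h.mul_const ((Nat.card F : ℝ) ^ (-(ε / 2)))⁻¹
    rw [zero_mul] at h2
    refine h2.congr fun D => ?_
    simp only [Function.comp_apply, Nat.cast_add, Nat.cast_one, pow_succ]
    field_simp
  obtain ⟨M, hM⟩ := hlim.bddAbove_range
  have hM' (D : ℕ) : ((D : ℝ) + 1) ^ P ≤ M * (Nat.card F : ℝ) ^ (ε / 2 * D) := by
    have h := hM ⟨D, rfl⟩
    simp only at h
    rw [← Real.rpow_natCast (_ ^ (-(ε / 2))), ← Real.rpow_mul hk0.le] at h
    calc ((D : ℝ) + 1) ^ P = ((D : ℝ) + 1) ^ P * (Nat.card F : ℝ) ^ (-(ε / 2) * D) *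
          (Nat.card F : ℝ) ^ (ε / 2 * D) := by
          rw [mul_assoc, ← Real.rpow_add hk0]
          simp
      _ ≤ _ := by gcongr
  have hM0 : 0 < M := by
    have := hM' 0
    simp only [Nat.cast_zero, zero_add, one_pow, mul_zero, Real.rpow_zero, mul_one] at this
    linarith
  refine ⟨Nat.card F * M, by positivity, fun t ht => ?_⟩
  obtain ⟨h1, h2⟩ := Polynomial.natCard_divisors_le ht (L := L) (by exact_mod_cast hL0)
  refine ⟨h1, ?_⟩
  have h3 : (Nat.card {d // d ∣ t} : ℝ) ≤
      Nat.card F * (((t.natDegree : ℝ) + 1) ^ P * 2 ^ (t.natDegree / L)) := by exact_mod_cast h2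
  have h4 : (2 : ℝ) ^ (t.natDegree / L) ≤ (Nat.card F : ℝ) ^ (ε / 2 * t.natDegree) := by
    calc (2 : ℝ) ^ (t.natDegree / L) ≤ (Nat.card F : ℝ) ^ (t.natDegree / L) := by gcongr
      _ = (Nat.card F : ℝ) ^ ((t.natDegree / L : ℕ) : ℝ) := (Real.rpow_natCast _ _).symm
      _ ≤ _ := by
        refine Real.rpow_le_rpow_of_exponent_le hk1.le ?_
        refine (Nat.cast_div_le (α := ℝ)).trans ?_
        rw [div_le_iff₀ hL0]
        have h5 : 1 ≤ ε / 2 * L := by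
          rw [div_lt_iff₀ hε] at hL
          linarith
        nlinarith [Nat.cast_nonneg (α := ℝ) t.natDegree]
  calc (Nat.card {d // d ∣ t} : ℝ) ≤ _ := h3
    _ ≤ Nat.card F * ((M * (Nat.card F : ℝ) ^ (ε / 2 * t.natDegree)) *
        (Nat.card F : ℝ) ^ (ε / 2 * t.natDegree)) := by
        gcongr
        exact hM' _
    _ = _ := by
      rw [mul_assoc M, ← Real.rpow_add hk0]
      ring_nf

end Divisors

/-! ### Second moments -/

/-- Chebyshev's inequality for the number of sets that contain a point: sets of equal measure that
are independent on average cover most of the space. -/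
theorem measureReal_diff_biUnion_le {X ι : Type*} [MeasurableSpace X] (μ : Measure X) {U : Set X}
    (hU : MeasurableSet U) (hUfin : μ U ≠ ⊤) (s : Finset ι) (E : ι → Set X)
    (hE : ∀ i ∈ s, MeasurableSet (E i)) (hEU : ∀ i ∈ s, E i ⊆ U) {p D : ℝ} (hp : 0 < p)
    (h1 : ∀ i ∈ s, μ.real (E i) = p * μ.real U)
    (h2 : ∑ i ∈ s, ∑ j ∈ s, μ.real (E i ∩ E j) ≤ μ.real U * p ^ 2 * ((s.card : ℝ) ^ 2 + D)) :
    μ.real (U \ ⋃ i ∈ s, E i) * (s.card : ℝ) ^ 2 ≤ μ.real U * D := by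
  let ν := μ.restrict U
  have : IsFiniteMeasure ν := ⟨by simpa [ν] using hUfin.lt_top⟩
  have hνreal (A : Set X) (hA : MeasurableSet A) (hAU : A ⊆ U) : ν.real A = μ.real A := by
    rw [measureReal_restrict_apply hA, Set.inter_eq_left.2 hAU]
  let f : ι → X → ℝ := fun i => (E i).indicator 1
  have hf (i j : ι) (x : X) : f i x * f j x = (E i ∩ E j).indicator 1 x :=
    (congrFun Set.inter_indicator_one x).symm
  have hint (A : Set X) (hA : MeasurableSet A) : Integrable (A.indicator (1 : X → ℝ)) ν :=
    (integrable_const (1 : ℝ)).indicator hA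
  let e : ℝ := s.card * p
  have hexp (x : X) : (∑ i ∈ s, f i x - e) ^ 2 =
      ∑ i ∈ s, ∑ j ∈ s, (E i ∩ E j).indicator 1 x - 2 * e * ∑ i ∈ s, f i x + e ^ 2 := by
    have : (∑ i ∈ s, f i x) ^ 2 = ∑ i ∈ s, ∑ j ∈ s, (E i ∩ E j).indicator 1 x := by
      rw [sq, Finset.sum_mul_sum]
      exact Finset.sum_congr rfl fun i _ => Finset.sum_congr rfl fun j _ => hf i j x
    rw [← this]
    ring
  have hi1 : Integrable (fun x => ∑ i ∈ s, ∑ j ∈ s, (E i ∩ E j).indicator (1 : X → ℝ) x) ν :=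
    integrable_finsetSum _ fun i hi => integrable_finsetSum _ fun j hj =>
      hint _ ((hE i hi).inter (hE j hj))
  have hi2 : Integrable (fun x => ∑ i ∈ s, f i x) ν :=
    integrable_finsetSum _ fun i hi => hint _ (hE i hi)
  have hsub : Integrable (fun x => ∑ i ∈ s, ∑ j ∈ s, (E i ∩ E j).indicator (1 : X → ℝ) x -
      2 * e * ∑ i ∈ s, f i x) ν := hi1.sub (hi2.const_mul _)
  have hi3 : Integrable (fun x => ∑ i ∈ s, ∑ j ∈ s, (E i ∩ E j).indicator (1 : X → ℝ) x -
      2 * e * ∑ i ∈ s, f i x + e ^ 2) ν :=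
    hsub.add (integrable_const _)
  have hI1 : ∫ x, ∑ i ∈ s, ∑ j ∈ s, (E i ∩ E j).indicator (1 : X → ℝ) x ∂ν =
      ∑ i ∈ s, ∑ j ∈ s, μ.real (E i ∩ E j) := by
    rw [integral_finsetSum _ fun i hi => integrable_finsetSum _ fun j hj =>
      hint _ ((hE i hi).inter (hE j hj))]
    refine Finset.sum_congr rfl fun i hi => ?_
    rw [integral_finsetSum _ fun j hj => hint _ ((hE i hi).inter (hE j hj))]
    refine Finset.sum_congr rfl fun j hj => ?_
    rw [integral_indicator_one ((hE i hi).inter (hE j hj)),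
      hνreal _ ((hE i hi).inter (hE j hj)) (Set.inter_subset_left.trans (hEU i hi))]
  have hI2 : ∫ x, ∑ i ∈ s, f i x ∂ν = e * μ.real U := by
    rw [integral_finsetSum _ fun i hi => hint _ (hE i hi)]
    rw [Finset.sum_congr rfl fun i hi => (integral_indicator_one (hE i hi)).trans
      ((hνreal _ (hE i hi) (hEU i hi)).trans (h1 i hi))]
    simp only [Finset.sum_const, nsmul_eq_mul, e]
    ring
  have hvar : ∫ x, (∑ i ∈ s, f i x - e) ^ 2 ∂ν ≤ μ.real U * p ^ 2 * D := by
    simp only [hexp]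
    rw [integral_add hsub (integrable_const _),
      integral_sub hi1 (hi2.const_mul _), integral_const_mul, hI1, hI2, integral_const,
      smul_eq_mul, measureReal_restrict_apply_univ]
    have : e ^ 2 = (s.card : ℝ) ^ 2 * p ^ 2 := by simp only [e]; ring
    nlinarith
  have hmeas : MeasurableSet (U \ ⋃ i ∈ s, E i) :=
    hU.diff (Finset.measurableSet_biUnion s hE)
  have hlow : e ^ 2 * μ.real (U \ ⋃ i ∈ s, E i) ≤ ∫ x, (∑ i ∈ s, f i x - e) ^ 2 ∂ν := by
    have h := integral_mono (μ := ν) (f := fun x => e ^ 2 *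
      (U \ ⋃ i ∈ s, E i).indicator (1 : X → ℝ) x) (g := fun x => (∑ i ∈ s, f i x - e) ^ 2)
      ((hint _ hmeas).const_mul _) (by simpa only [hexp] using hi3) (fun x => by
        by_cases hx : x ∈ U \ ⋃ i ∈ s, E i
        · have h0 : ∑ i ∈ s, f i x = 0 := by
            refine Finset.sum_eq_zero fun i hi => ?_
            refine Set.indicator_of_notMem (fun hxi => hx.2 ?_) _
            exact Set.mem_biUnion (Finset.mem_coe.2 hi) hxi
          simp only [Set.indicator_of_mem hx, h0, Pi.one_apply]
          linarith [sq_nonneg e]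
        · simp only [Set.indicator_of_notMem hx, mul_zero]
          positivity)
    rwa [integral_const_mul, integral_indicator_one hmeas,
      hνreal _ hmeas Set.sdiff_subset] at h
  have hfin := hlow.trans hvar
  have hp2 : 0 < p ^ 2 := by positivity
  have : e ^ 2 = (s.card : ℝ) ^ 2 * p ^ 2 := by simp only [e]; ring
  rw [this] at hfin
  refine le_of_mul_le_mul_right ?_ hp2
  linarith

namespace LaurentInf

variable {F : Type*} [Field F] {m n : ℕ}

/-- A nonzero frequency `t` belongs to few of the spaces `tensorLT n q r`: a component of `q`
divides an entry of `t`, and it determines `q`. -/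
theorem natCard_filter_mem_tensorLT_le
    {t : Matrix (Fin m) (Fin n) F[X]} {i : Fin m}
    {l : Fin n} (ht : t i l ≠ 0) (hfin : Finite {d // d ∣ t i l}) (s : Set (Fin m → F[X]))
    (r : ℕ) : Nat.card ↥{q | q ∈ s ∧ t ∈ tensorLT n q r} ≤ Nat.card {d // d ∣ t i l} := by
  have hdvd (q : ↥{q | q ∈ s ∧ t ∈ tensorLT n q r}) : q.1 i ∣ t i l := by
    obtain ⟨c, -, hc⟩ := q.2.2
    exact ⟨c l, congrFun (congrFun hc i) l⟩
  refine Nat.card_le_card_of_injective (fun q => (⟨q.1 i, hdvd q⟩ : {d // d ∣ t i l})) ?_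
  rintro ⟨q, _, c, _, hc⟩ ⟨q', _, c', _, hc'⟩ h
  have h1 : q i = q' i := Subtype.ext_iff.1 h
  have h2 : q i * c l = t i l := by rw [hc]; rfl
  have h3 (j : Fin m) : q j * c l = q' j * c' l := by
    have : t j l = q' j * c' l := by rw [hc']; rfl
    rw [← this, hc]
    rfl
  have hqi : q i ≠ 0 := by
    intro h0
    rw [h0, zero_mul] at h2
    exact ht h2.symm
  have hcl : c l ≠ 0 := by
    intro h0
    rw [h0, mul_zero] at h2
    exact ht h2.symm
  have h4 : c l = c' l := by
    have := h3 i
    rw [← h1] at this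
    exact mul_left_cancel₀ hqi this
  refine Subtype.ext (funext fun j => mul_right_cancel₀ hcl ?_)
  rw [h3 j, h4]

variable [Finite F]

/-- In the double sum `t = 0` contributes `#s ^ 2`, and each nonzero `t` in a space
`tensorLT n q r` contributes at most the number of divisors of an entry. -/
theorem sum_natCard_inf_tensorLT_le {N r : ℕ} {s : Finset (Fin m → F[X])}
    (hs : ∀ q ∈ s, infAbs q = (Nat.card F : ℝ) ^ N) {d : ℕ}
    (hd : ∀ t : F[X], t ≠ 0 → t.natDegree ≤ N + r →
      Finite {d // d ∣ t} ∧ Nat.card {d // d ∣ t} ≤ d) :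
    ∑ q ∈ s, ∑ q' ∈ s, Nat.card ↥(tensorLT n q r ⊓ tensorLT n q' r) ≤
      s.card ^ 2 + s.card * (Nat.card F ^ (r * n) * d) := by
  classical
  have key (q : Fin m → F[X]) (hq : q ∈ s) :
      ∑ q' ∈ s, Nat.card ↥(tensorLT n q r ⊓ tensorLT n q' r) ≤
        s.card + Nat.card F ^ (r * n) * d := by
    have hq0 := ne_zero_of_infAbs_eq_pow (hs q hq)
    have hfin := finite_tensorLT (n := n) hq0 r
    let T : Finset (Matrix (Fin m) (Fin n) F[X]) := (Set.toFinite (tensorLT n q r : Set _)).toFinset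
    have hT (t) : t ∈ T ↔ t ∈ tensorLT n q r := by simp [T]
    have hTc : T.card = Nat.card F ^ (r * n) := by
      rw [← natCard_tensorLT hq0, ← Nat.card_eq_card_finite_toFinset]
      rfl
    have h1 (q' : Fin m → F[X]) : Nat.card ↥(tensorLT n q r ⊓ tensorLT n q' r) =
        ∑ t ∈ T, if t ∈ tensorLT n q' r then 1 else 0 := by
      rw [← Finset.sum_filter, Finset.sum_const, smul_eq_mul, mul_one, ← Nat.card_eq_finsetCard]
      refine Nat.card_congr (Equiv.subtypeEquivRight fun t => ?_)
      rw [Finset.mem_filter, hT, Submodule.mem_inf]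
    simp only [h1]
    rw [Finset.sum_comm]
    have h0 : (0 : Matrix (Fin m) (Fin n) F[X]) ∈ T := (hT 0).2 (zero_mem _)
    rw [← Finset.add_sum_erase T _ h0]
    refine Nat.add_le_add ?_ ?_
    · refine (Finset.sum_le_card_nsmul s _ 1 fun q' _ => ?_).trans_eq (by simp)
      split_ifs <;> simp
    · have h2 : ∀ t ∈ T.erase 0, (∑ q' ∈ s, if t ∈ tensorLT n q' r then 1 else 0) ≤ d := by
        intro t ht
        rw [Finset.mem_erase, hT] at ht
        obtain ⟨ht0, c, hc, rfl⟩ := ht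
        obtain ⟨i, l, hil⟩ : ∃ i l, Matrix.vecMulVec q c i l ≠ 0 := by
          by_contra! h
          exact ht0 (Matrix.ext h)
        have hdeg : (Matrix.vecMulVec q c i l).natDegree ≤ N + r := by
          rw [Matrix.vecMulVec_apply]
          refine Polynomial.natDegree_mul_le.trans (Nat.add_le_add
            (natDegree_le_of_infAbs_eq (hs q hq) i) ?_)
          exact Polynomial.natDegree_le_of_degree_le (Polynomial.mem_degreeLT.1 (hc l)).le
        obtain ⟨hf, hle⟩ := hd _ hil hdeg
        refine le_trans (le_of_eq ?_)
          ((natCard_filter_mem_tensorLT_le hil hf (s : Set _) r).trans hle)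
        rw [← Finset.sum_filter, Finset.sum_const, smul_eq_mul, mul_one, ← Nat.card_eq_finsetCard]
        refine Nat.card_congr (Equiv.subtypeEquivRight fun q' => ?_)
        rw [Finset.mem_filter]
        rfl
      refine (Finset.sum_le_card_nsmul _ _ d h2).trans ?_
      rw [smul_eq_mul, ← hTc]
      exact Nat.mul_le_mul_right _ (Finset.card_le_card (Finset.erase_subset _ _))
  calc _ ≤ ∑ q ∈ s, (s.card + Nat.card F ^ (r * n) * d) := Finset.sum_le_sum key
    _ = _ := by
      rw [Finset.sum_const, smul_eq_mul]
      ring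

/-- The matrices with `‖q A‖ ≥ k ^ (-r)` for all `q` in a set of vectors of the same absolute
value have small measure if this set is large. -/
theorem real_diff_biUnion_annihilator_le [MeasurableSpace (LaurentMatrix F m n)]
    [BorelSpace (LaurentMatrix F m n)] (μ : Measure (LaurentMatrix F m n)) [μ.IsAddHaarMeasure]
    {N r : ℕ} {s : Finset (Fin m → F[X])}
    (hs : ∀ q ∈ s, infAbs q = (Nat.card F : ℝ) ^ N) {d : ℕ}
    (hd : ∀ t : F[X], t ≠ 0 → t.natDegree ≤ N + r →
      Finite {d // d ∣ t} ∧ Nat.card {d // d ∣ t} ≤ d) :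
    μ.real ((ballSubmodule F m n 0 : Set (LaurentMatrix F m n)) \
      ⋃ q ∈ s, (annihilator (tensorLT n q r) : Set (LaurentMatrix F m n))) * s.card ≤
      μ.real (ballSubmodule F m n 0 : Set (LaurentMatrix F m n)) *
        ((Nat.card F : ℝ) ^ (r * n) * d) := by
  rcases s.eq_empty_or_nonempty with rfl | hne
  · simp only [Finset.card_empty, Nat.cast_zero, mul_zero]
    positivity
  have hk := card_pos_real F
  have hkr : (0 : ℝ) < (Nat.card F : ℝ) ^ (r * n) := pow_pos hk _
  have hopen (q : Fin m → F[X]) (hq : q ∈ s) :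
      IsOpen (annihilator (tensorLT n q r) : Set (LaurentMatrix F m n)) := by
    have := finite_tensorLT (n := n) (ne_zero_of_infAbs_eq_pow (hs q hq)) r
    exact isOpen_annihilator _
  have h := measureReal_diff_biUnion_le μ (measurableSet_ballSubmodule 0)
    (measure_ballSubmodule_ne_top μ 0) s
    (fun q => (annihilator (tensorLT n q r) : Set (LaurentMatrix F m n)))
    (fun q hq => (hopen q hq).measurableSet) (fun q _ => annihilator_le _)
    (p := ((Nat.card F : ℝ) ^ (r * n))⁻¹) (D := s.card * ((Nat.card F : ℝ) ^ (r * n) * d))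
    (inv_pos.2 hkr) (fun q hq => by
      rw [real_annihilator_tensorLT μ (ne_zero_of_infAbs_eq_pow (hs q hq)), div_eq_inv_mul]) (by
      have h1 : ∀ q ∈ s, ∀ q' ∈ s,
          μ.real ((annihilator (tensorLT n q r) : Set (LaurentMatrix F m n)) ∩
            (annihilator (tensorLT n q' r) : Set (LaurentMatrix F m n))) =
          μ.real (ballSubmodule F m n 0 : Set (LaurentMatrix F m n)) *
            ((Nat.card F : ℝ) ^ (r * n))⁻¹ ^ 2 *
            Nat.card ↥(tensorLT n q r ⊓ tensorLT n q' r) := by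
        intro q hq q' hq'
        have hq0 := ne_zero_of_infAbs_eq_pow (hs q hq)
        have hq0' := ne_zero_of_infAbs_eq_pow (hs q' hq')
        have := finite_tensorLT (n := n) hq0 r
        have := finite_tensorLT (n := n) hq0' r
        have := finite_sup_submodule (tensorLT n q r) (tensorLT n q' r)
        have hc := natCard_sup_mul_natCard_inf (tensorLT n q r) (tensorLT n q' r)
        rw [natCard_tensorLT hq0, natCard_tensorLT hq0'] at hc
        have hc' : (Nat.card ↥(tensorLT n q r ⊔ tensorLT n q' r) : ℝ) *
            Nat.card ↥(tensorLT n q r ⊓ tensorLT n q' r) =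
            (Nat.card F : ℝ) ^ (r * n) * (Nat.card F : ℝ) ^ (r * n) := by exact_mod_cast hc
        have h0 : (Nat.card ↥(tensorLT n q r ⊔ tensorLT n q' r) : ℝ) ≠ 0 := by
          exact_mod_cast Nat.card_pos.ne'
        have h2 := real_annihilator μ (tensorLT n q r ⊔ tensorLT n q' r)
        rw [annihilator_sup] at h2
        refine h2.trans ?_
        field_simp
        linear_combination (-μ.real (ballSubmodule F m n 0 : Set (LaurentMatrix F m n))) * hc'
      rw [Finset.sum_congr rfl fun q hq => Finset.sum_congr rfl fun q' hq' => h1 q hq q' hq']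
      simp only [← Finset.mul_sum]
      refine mul_le_mul_of_nonneg_left ?_ (by positivity)
      exact_mod_cast sum_natCard_inf_tensorLT_le (n := n) hs hd)
  have hc : (0 : ℝ) < s.card := by exact_mod_cast hne.card_pos
  refine le_of_mul_le_mul_right ?_ hc
  linarith

end LaurentInf

/-! ### Shells and the exponent of convergence -/

namespace LaurentInf

section Shells

variable {F : Type*} [Field F] [Finite F] {m : ℕ}

theorem finite_infAbs_le (N : ℕ) : Finite {q : Fin m → F[X] // infAbs q ≤ (Nat.card F : ℝ) ^ N} ∧
    Nat.card {q : Fin m → F[X] // infAbs q ≤ (Nat.card F : ℝ) ^ N} ≤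
      Nat.card F ^ ((N + 1) * m) := by
  have hfin := finite_degreeLT F (N + 1)
  let Φ : {q : Fin m → F[X] // infAbs q ≤ (Nat.card F : ℝ) ^ N} →
      (Fin m → Polynomial.degreeLT F (N + 1)) := fun q i => ⟨q.1 i, by
    rw [Polynomial.mem_degreeLT]
    refine Polynomial.degree_le_natDegree.trans_lt ?_
    exact_mod_cast Nat.lt_succ_of_le ((infAbs_le_iff q.1 N).1 q.2 i)⟩
  have hΦ : Function.Injective Φ := fun q q' h => Subtype.ext (funext fun i =>
    Subtype.ext_iff.1 (congrFun h i))
  refine ⟨Finite.of_injective Φ hΦ, (Nat.card_le_card_of_injective Φ hΦ).trans_eq ?_⟩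
  rw [Nat.card_fun, natCard_degreeLT, Nat.card_fin, ← pow_mul]

theorem setFinite_infAbs_le (R : ℝ) : {q : Fin m → F[X] | infAbs q ≤ R}.Finite := by
  obtain ⟨N, hN⟩ := pow_unbounded_of_one_lt R (one_lt_card F)
  exact Set.Finite.subset (Set.finite_coe_iff.1 (finite_infAbs_le (F := F) (m := m) N).1)
    fun q hq => le_trans hq hN.le

/-- The vectors of `S` with `|q|_∞ = k ^ N`. -/
def shell (S : Set (Fin m → F[X])) (N : ℕ) : Set (Fin m → F[X]) :=
  {q | q ∈ S ∧ infAbs q = (Nat.card F : ℝ) ^ N}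

theorem finite_shell (S : Set (Fin m → F[X])) (N : ℕ) : (shell S N).Finite :=
  (setFinite_infAbs_le ((Nat.card F : ℝ) ^ N)).subset fun _ hq => hq.2.le

theorem ncard_shell_le (S : Set (Fin m → F[X])) (N : ℕ) :
    (shell S N).ncard ≤ Nat.card F ^ ((N + 1) * m) := by
  refine le_trans ?_ (finite_infAbs_le (F := F) (m := m) N).2
  exact Set.ncard_le_ncard (t := {q | infAbs q ≤ (Nat.card F : ℝ) ^ N}) (fun q hq => hq.2.le)
    (setFinite_infAbs_le _)

/-- The terms of the series that defines `convExponent` are constant on shells, and a bound for the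
sizes of the shells bounds the series by a geometric one. -/
theorem summable_of_ncard_shell_le {S : Set (Fin m → F[X])} {C a b : ℝ} (hab : a < b)
    (h : ∀ᶠ N : ℕ in atTop, ((shell S N).ncard : ℝ) ≤ C * (Nat.card F : ℝ) ^ (a * N)) :
    Summable fun q : ↥(S \ {0}) => infAbs q.1 ^ (-b) := by
  have hk1 := one_lt_card F
  have hk := card_pos_real F
  have hg : Summable fun N : ℕ => ((shell S N).ncard : ℝ) * (Nat.card F : ℝ) ^ (-b * N) := by
    have hr : (Nat.card F : ℝ) ^ (a - b) < 1 :=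
      Real.rpow_lt_one_of_one_lt_of_neg hk1 (by linarith)
    refine Summable.of_norm_bounded_eventually_nat (g := fun N : ℕ =>
      C * ((Nat.card F : ℝ) ^ (a - b)) ^ N)
      ((summable_geometric_of_lt_one (Real.rpow_nonneg hk.le _) hr).mul_left C) ?_
    filter_upwards [h] with N hN
    rw [Real.norm_of_nonneg (by positivity), ← Real.rpow_natCast (_ ^ (a - b)),
      ← Real.rpow_mul hk.le]
    calc _ ≤ C * (Nat.card F : ℝ) ^ (a * N) * (Nat.card F : ℝ) ^ (-b * N) := by gcongr
      _ = _ := by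
        rw [mul_assoc, ← Real.rpow_add hk]
        ring_nf
  choose! lev hlev using fun q : Fin m → F[X] => exists_infAbs_eq_pow (q := q)
  refine summable_of_sum_le (c := ∑' N : ℕ, ((shell S N).ncard : ℝ) * (Nat.card F : ℝ) ^ (-b * N))
    (fun q => Real.rpow_nonneg (infAbs_nonneg _) _) fun u => ?_
  classical
  rw [← Finset.sum_fiberwise_of_maps_to (t := u.image fun q => lev q.1) (g := fun q => lev q.1)
    (fun q hq => Finset.mem_image_of_mem _ hq)]
  refine le_trans (Finset.sum_le_sum fun N _ => ?_)
    (hg.sum_le_tsum _ fun N _ => by positivity)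
  have hterm : ∀ q ∈ u.filter (fun q => lev q.1 = N),
      infAbs q.1 ^ (-b) = (Nat.card F : ℝ) ^ (-b * N) := by
    intro q hq
    rw [hlev q.1 q.2.2, (Finset.mem_filter.1 hq).2, ← Real.rpow_natCast, ← Real.rpow_mul hk.le]
    ring_nf
  rw [Finset.sum_congr rfl hterm, Finset.sum_const, nsmul_eq_mul]
  refine mul_le_mul_of_nonneg_right ?_ (Real.rpow_nonneg hk.le _)
  rw [← Finset.card_image_of_injective _ Subtype.val_injective, ← Set.ncard_coe_finset]
  have hsub : ((u.filter fun q => lev q.1 = N).image Subtype.val : Set (Fin m → F[X])) ⊆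
      shell S N := by
    intro q hq
    obtain ⟨q', hq', rfl⟩ := Finset.mem_image.1 (Finset.mem_coe.1 hq)
    have := hlev q'.1 q'.2.2
    rw [(Finset.mem_filter.1 hq').2] at this
    exact ⟨q'.2.1, this⟩
  exact_mod_cast Set.ncard_le_ncard hsub (finite_shell S N)

theorem one_le_infAbs {q : Fin m → F[X]} (hq : q ≠ 0) : 1 ≤ infAbs q := by
  obtain ⟨N, hN⟩ := exists_infAbs_eq_pow hq
  rw [hN]
  exact one_le_pow₀ (one_lt_card F).le

theorem pos_of_summable {S : Set (Fin m → F[X])} (hS : S.Infinite) {v : ℝ}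
    (hv : Summable fun q : ↥(S \ {0}) => infAbs q.1 ^ (-v)) : 0 < v := by
  by_contra! h
  have : Infinite ↥(S \ {0}) := (hS.sdiff (Set.finite_singleton 0)).to_subtype
  have h2 := hv.tendsto_cofinite_zero
  have h3 : ∀ᶠ q : ↥(S \ {0}) in cofinite, infAbs q.1 ^ (-v) < 1 :=
    h2.eventually (gt_mem_nhds one_pos)
  obtain ⟨q, hq⟩ := h3.exists
  exact absurd (Real.one_le_rpow (one_le_infAbs q.2.2) (by linarith)) (not_le.2 hq)

theorem bddBelow_summable {S : Set (Fin m → F[X])} (hS : S.Infinite) :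
    BddBelow {v : ℝ | Summable fun q : ↥(S \ {0}) => infAbs q.1 ^ (-v)} :=
  ⟨0, fun _ hv => (pos_of_summable hS hv).le⟩

theorem nonempty_summable (S : Set (Fin m → F[X])) :
    {v : ℝ | Summable fun q : ↥(S \ {0}) => infAbs q.1 ^ (-v)}.Nonempty := by
  have hk := card_pos_real F
  refine ⟨m + 1, summable_of_ncard_shell_le (C := (Nat.card F : ℝ) ^ m) (a := m) (by linarith)
    (Eventually.of_forall fun N => ?_)⟩
  calc ((shell S N).ncard : ℝ) ≤ (Nat.card F : ℝ) ^ ((N + 1) * m) := by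
        exact_mod_cast ncard_shell_le S N
    _ = _ := by
      rw [add_mul, one_mul, pow_add, mul_comm N m, ← Real.rpow_natCast _ (m * N)]
      push_cast
      ring

theorem convExponent_nonneg {S : Set (Fin m → F[X])} (hS : S.Infinite) : 0 ≤ convExponent S :=
  Real.sInf_nonneg fun _ hv => (pos_of_summable hS hv).le

theorem exists_summable_lt {S : Set (Fin m → F[X])} {v : ℝ} (hv : convExponent S < v) :
    ∃ v' < v, Summable fun q : ↥(S \ {0}) => infAbs q.1 ^ (-v') := by
  obtain ⟨v', h1, h2⟩ := exists_lt_of_csInf_lt (nonempty_summable S) hv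
  exact ⟨v', h2, h1⟩

/-- Below the exponent of convergence, infinitely many shells are large. -/
theorem frequently_le_ncard_shell {S : Set (Fin m → F[X])} (hS : S.Infinite) {v : ℝ}
    (hv : v < convExponent S) :
    ∃ᶠ N : ℕ in atTop, (Nat.card F : ℝ) ^ (v * N) ≤ (shell S N).ncard := by
  intro h
  obtain ⟨b, hb1, hb2⟩ := exists_between hv
  refine notMem_of_lt_csInf hb2 (bddBelow_summable hS)
    (summable_of_ncard_shell_le (C := 1) hb1 ?_)
  filter_upwards [h] with N hN
  rw [one_mul]
  exact (not_le.1 hN).le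

theorem frequently_shell_nonempty {S : Set (Fin m → F[X])} (hS : S.Infinite) :
    ∃ᶠ N : ℕ in atTop, (shell S N).Nonempty := by
  refine (frequently_le_ncard_shell hS (sub_one_lt (convExponent S))).mono fun N hN => ?_
  refine Set.nonempty_of_ncard_ne_zero fun h0 => ?_
  rw [h0, Nat.cast_zero] at hN
  exact absurd hN (not_le.2 (Real.rpow_pos_of_pos (card_pos_real F) _))

end Shells

section Ubiquity

variable {F : Type*} [Field F] [Finite F] {m n : ℕ}
  [MeasurableSpace (LaurentMatrix F m n)] [BorelSpace (LaurentMatrix F m n)]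
  (μ : Measure (LaurentMatrix F m n)) [μ.IsAddHaarMeasure]

/-- Ubiquity: for infinitely many `N`, all matrices `A` of the unit ball outside a set of small
measure satisfy `‖q A‖ < k ^ (-⌊τ N⌋)` for a vector `q ∈ S` with `|q|_∞ = k ^ N`. The case `τ = 0`
is separate because `v(S)` may be `0`. -/
theorem frequently_real_diff_le {S : Set (Fin m → F[X])} (hS : S.Infinite) {τ : ℝ} (hτ : 0 ≤ τ)
    (hτv : n * τ < convExponent S ∨ τ = 0) {η : ℝ} (hη : 0 < η) :
    ∃ᶠ N : ℕ in atTop, μ.real ((ballSubmodule F m n 0 : Set (LaurentMatrix F m n)) \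
      ⋃ q ∈ shell S N, (annihilator (tensorLT n q ⌊τ * N⌋₊) : Set (LaurentMatrix F m n))) ≤ η := by
  have hk := card_pos_real F
  have hk1 := one_lt_card F
  rcases hτv with hv | rfl
  · obtain ⟨v, hv1, hv2⟩ := exists_between hv
    -- The divisor bound costs `k ^ (ε (N + r))`, which uses up half of the gap `k ^ ((v - n τ) N)`.
    let ε : ℝ := (v - n * τ) / (2 * (1 + τ))
    have hε : 0 < ε := div_pos (by linarith) (by linarith)
    have hε2 : ε * (1 + τ) = (v - n * τ) / 2 := by
      simp only [ε]
      field_simp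
    obtain ⟨C, hC, hdiv⟩ := Polynomial.exists_natCard_divisors_le F hε
    let M := μ.real (ballSubmodule F m n 0 : Set (LaurentMatrix F m n))
    let g := (v - n * τ) / 2
    have hlim : Tendsto (fun N : ℕ => M * C * ((Nat.card F : ℝ) ^ (-g)) ^ N) atTop (𝓝 0) := by
      rw [← mul_zero (M * C)]
      refine (tendsto_pow_atTop_nhds_zero_of_lt_one (Real.rpow_nonneg hk.le _) ?_).const_mul _
      refine Real.rpow_lt_one_of_one_lt_of_neg hk1 ?_
      simp only [g]
      linarith
    refine ((frequently_le_ncard_shell hS hv2).and_eventually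
      (hlim.eventually (gt_mem_nhds hη))).mono ?_
    rintro N ⟨hN1, hN2⟩
    let r := ⌊τ * N⌋₊
    have hr : (r : ℝ) ≤ τ * N := Nat.floor_le (by positivity)
    have h := real_diff_biUnion_annihilator_le (n := n) μ (N := N) (r := r)
      (s := (finite_shell S N).toFinset) (fun q hq => ((finite_shell S N).mem_toFinset.1 hq).2)
      (d := ⌊C * (Nat.card F : ℝ) ^ (ε * (N + r))⌋₊) (fun t ht hdeg => by
        obtain ⟨h1, h2⟩ := hdiv t ht
        refine ⟨h1, Nat.le_floor (h2.trans ?_)⟩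
        gcongr
        · exact hk1.le
        · exact_mod_cast hdeg)
    simp only [Set.Finite.mem_toFinset] at h
    rw [← Set.ncard_eq_toFinset_card _ (finite_shell S N)] at h
    refine le_trans ?_ hN2.le
    have hpos : 0 < (Nat.card F : ℝ) ^ (v * N) := Real.rpow_pos_of_pos hk _
    refine le_of_mul_le_mul_right ?_ hpos
    refine (mul_le_mul_of_nonneg_left hN1 measureReal_nonneg).trans (h.trans ?_)
    have h1 : (Nat.card F : ℝ) ^ (r * n) ≤ (Nat.card F : ℝ) ^ (n * τ * N) := by
      rw [← Real.rpow_natCast]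
      refine Real.rpow_le_rpow_of_exponent_le hk1.le ?_
      push_cast
      nlinarith [Nat.cast_nonneg (α := ℝ) n]
    have h2 : (⌊C * (Nat.card F : ℝ) ^ (ε * (N + r))⌋₊ : ℝ) ≤
        C * (Nat.card F : ℝ) ^ (g * N) := by
      refine (Nat.floor_le (by positivity)).trans ?_
      refine mul_le_mul_of_nonneg_left (Real.rpow_le_rpow_of_exponent_le hk1.le ?_) hC.le
      have h3 : ε * (N + r) ≤ ε * ((1 + τ) * N) :=
        mul_le_mul_of_nonneg_left (by linarith) hε.le
      calc ε * (N + r) ≤ ε * ((1 + τ) * N) := h3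
        _ = g * N := by rw [← mul_assoc, hε2]
    calc _ ≤ M * ((Nat.card F : ℝ) ^ (n * τ * N) * (C * (Nat.card F : ℝ) ^ (g * N))) := by
          gcongr
      _ = _ := by
        rw [← Real.rpow_natCast (_ ^ (-g)), ← Real.rpow_mul hk.le]
        have : (Nat.card F : ℝ) ^ (n * τ * N) * (Nat.card F : ℝ) ^ (g * N) =
            (Nat.card F : ℝ) ^ (-g * N) * (Nat.card F : ℝ) ^ (v * N) := by
          rw [← Real.rpow_add hk, ← Real.rpow_add hk]
          simp only [g]
          ring_nf
        linear_combination (M * C) * this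
  · -- For `τ = 0` each single neighbourhood is the whole ball.
    refine (frequently_shell_nonempty hS).mono fun N ⟨q, hq⟩ => ?_
    have : (ballSubmodule F m n 0 : Set (LaurentMatrix F m n)) \
      ⋃ q ∈ shell S N, (annihilator (tensorLT n q ⌊(0 : ℝ) * N⌋₊) : Set (LaurentMatrix F m n)) =
        ∅ := by
      rw [Set.sdiff_eq_empty]
      intro A hA
      refine Set.mem_biUnion hq ?_
      rw [zero_mul, Nat.floor_zero, annihilator_tensorLT_zero]
      exact hA
    rw [this, measureReal_empty]
    exact hη.le

end Ubiquity

end LaurentInf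

/-! ### The order of the approximation function -/

namespace LaurentInf

section Order

variable {F : Type*} [Field F] [Finite F] {m n : ℕ} {S : Set (Fin m → F[X])}
  {ψ : (Fin m → F[X]) → ℝ} {l : ℝ}

theorem eventually_shell {P : (Fin m → F[X]) → Prop}
    (h : ∀ᶠ q in comap infAbs atTop ⊓ 𝓟 S, P q) :
    ∀ᶠ N : ℕ in atTop, ∀ q ∈ shell S N, P q := by
  rw [eventually_inf_principal, eventually_comap] at h
  have := (tendsto_pow_atTop_atTop_of_one_lt (one_lt_card F)).eventually h
  filter_upwards [this] with N hN q hq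
  exact hN q hq.2 hq.1

theorem eventually_rpow_le (hψ : ∀ q, 0 < ψ q) (hl : HasOrderAtInfinity S ψ l) {a : ℝ}
    (ha : l < a) :
    ∀ᶠ N : ℕ in atTop, ∀ q ∈ shell S N, (Nat.card F : ℝ) ^ (-(a * N)) ≤ ψ q := by
  have hk := card_pos_real F
  filter_upwards [eventually_shell (hl.eventually (gt_mem_nhds ha)), eventually_gt_atTop 0]
    with N hN hN0 q hq
  have h := hN q hq
  have hlog : 0 < N * Real.log (Nat.card F) :=
    mul_pos (by exact_mod_cast hN0) (Real.log_pos (one_lt_card F))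
  rw [hq.2, Real.log_pow, div_lt_iff₀ hlog] at h
  rw [← Real.log_le_log_iff (Real.rpow_pos_of_pos hk _) (hψ q), Real.log_rpow hk]
  linarith

theorem eventually_le_rpow (hψ : ∀ q, 0 < ψ q) (hl : HasOrderAtInfinity S ψ l) {a : ℝ}
    (ha : a < l) :
    ∀ᶠ N : ℕ in atTop, ∀ q ∈ shell S N, ψ q ≤ (Nat.card F : ℝ) ^ (-(a * N)) := by
  have hk := card_pos_real F
  filter_upwards [eventually_shell (hl.eventually (lt_mem_nhds ha)), eventually_gt_atTop 0]
    with N hN hN0 q hq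
  have h := hN q hq
  have hlog : 0 < N * Real.log (Nat.card F) :=
    mul_pos (by exact_mod_cast hN0) (Real.log_pos (one_lt_card F))
  rw [hq.2, Real.log_pow, lt_div_iff₀ hlog] at h
  rw [← Real.log_le_log_iff (hψ q) (Real.rpow_pos_of_pos hk _), Real.log_rpow hk]
  linarith

/-- A bounded function has nonnegative order at infinity. -/
theorem order_nonneg (hS : S.Infinite) (hψ : ∀ q, 0 < ψ q) {B : ℝ} (hB : ∀ q, ψ q ≤ B)
    (hl : HasOrderAtInfinity S ψ l) : 0 ≤ l := by
  by_contra! hneg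
  obtain ⟨a, ha1, ha2⟩ := exists_between hneg
  have hk := card_pos_real F
  have hr : 1 < (Nat.card F : ℝ) ^ (-a) := Real.one_lt_rpow (one_lt_card F) (by linarith)
  have hlim := (tendsto_pow_atTop_atTop_of_one_lt hr).eventually (eventually_gt_atTop B)
  obtain ⟨N, ⟨q, hq⟩, h1, h2⟩ := ((frequently_shell_nonempty hS).and_eventually
    ((eventually_rpow_le hψ hl ha1).and hlim)).exists
  have h3 := h1 q hq
  rw [← Real.rpow_natCast, ← Real.rpow_mul hk.le, neg_mul] at h2
  linarith [hB q]

theorem infinite_of_frequently {P : (Fin m → F[X]) → Prop}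
    (h : ∃ᶠ N : ℕ in atTop, ∃ q ∈ shell S N, P q) : {q | q ∈ S ∧ P q}.Infinite := by
  intro hfin
  obtain ⟨B, hB⟩ := (hfin.image infAbs).bddAbove
  obtain ⟨N, ⟨q, hq, hP⟩, hN⟩ := (h.and_eventually
    ((tendsto_pow_atTop_atTop_of_one_lt (one_lt_card F)).eventually (eventually_gt_atTop B))).exists
  have h1 : infAbs q ≤ B := hB ⟨q, ⟨hq.1, hP⟩, rfl⟩
  rw [hq.2] at h1
  exact absurd h1 (not_le.2 hN)

/-- Powers of `k` with integral exponents: a lower bound `k ^ (-a)` may be rounded up. -/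
theorem zpow_neg_natCast_le_of_rpow_le {x : ℝ} (hx : ∃ r : ℤ, x = (Nat.card F : ℝ) ^ r) {a : ℝ}
    {N : ℕ} (h : (Nat.card F : ℝ) ^ (-a) ≤ x) (hN : ∀ r : ℤ, (r : ℝ) ≤ a → r ≤ N) :
    (Nat.card F : ℝ) ^ (-(N : ℤ)) ≤ x := by
  obtain ⟨r, rfl⟩ := hx
  rw [← Real.rpow_intCast, Real.rpow_le_rpow_left_iff (one_lt_card F)] at h
  have := hN (-r) (by push_cast; linarith)
  exact zpow_le_zpow_right₀ (one_lt_card F).le (by omega)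

end Order

/-! ### Invariance under translation by polynomial matrices -/

section Translation

variable {F : Type*} [Field F] {m n : ℕ}

/-- A polynomial matrix, as a matrix over `𝔽((X⁻¹))`. -/
noncomputable def ofPolyMatrix (P : Matrix (Fin m) (Fin n) F[X]) : LaurentMatrix F m n :=
  P.map ofPoly

theorem vecMul_ofPolyMatrix (q : Fin m → F[X]) (P : Matrix (Fin m) (Fin n) F[X]) :
    Matrix.vecMul (vec q) (ofPolyMatrix P) = vec (Matrix.vecMul q P) := by
  funext l
  change ∑ i, ofPoly (q i) * ofPoly (P i l) = ofPoly (∑ i, q i * P i l)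
  rw [ofPoly_sum]
  exact Finset.sum_congr rfl fun i _ => (ofPoly_mul _ _).symm

variable [Finite F]

theorem distNearest_sub_vec (v : Fin n → LaurentInf F) (p : Fin n → F[X]) :
    distNearest (v - vec p) = distNearest v := by
  have hiso : Isometry fun w : Fin n → LaurentInf F => w - vec p :=
    Isometry.of_dist_eq fun a b => dist_sub_right a b _
  have himg : (fun w : Fin n → LaurentInf F => w - vec p) '' Set.range vec = Set.range vec := by
    ext w
    constructor
    · rintro ⟨_, ⟨p', rfl⟩, rfl⟩
      refine ⟨p' - p, funext fun i => ?_⟩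
      exact map_sub (Polynomial.aeval (X F)) (p' i) (p i)
    · rintro ⟨p', rfl⟩
      refine ⟨_, ⟨p' + p, rfl⟩, funext fun i => ?_⟩
      have := ofPoly_add (p' i) (p i)
      change ofPoly (p' i + p i) - ofPoly (p i) = ofPoly (p' i)
      rw [this, add_sub_cancel_right]
  have h := Metric.infDist_image hiso (x := v) (t := Set.range vec)
  rw [himg] at h
  exact h

theorem sub_ofPolyMatrix_mem_approxSet {S : Set (Fin m → F[X])} {ψ : (Fin m → F[X]) → ℝ}
    {A : LaurentMatrix F m n} (P : Matrix (Fin m) (Fin n) F[X]) :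
    A - ofPolyMatrix P ∈ approxSet n S ψ ↔ A ∈ approxSet n S ψ := by
  simp only [approxSet, Set.mem_ofPred_eq, Matrix.vecMul_sub, vecMul_ofPolyMatrix,
    distNearest_sub_vec]

theorem exists_sub_ofPolyMatrix_mem (A : LaurentMatrix F m n) :
    ∃ P : Matrix (Fin m) (Fin n) F[X], A - ofPolyMatrix P ∈ ballSubmodule F m n 0 := by
  choose p hp using fun i l => exists_ofPoly_coeff_eq (A i l)
  refine ⟨Matrix.of p, fun i l t ht => ?_⟩
  change coeff (A i l - ofPoly (p i l)) t = 0
  rw [coeff_sub, hp i l t (by simpa using ht), sub_self]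

instance : Countable F[X] :=
  Function.Injective.countable (f := fun p : F[X] => p.toFinsupp.coeff) fun p q h => by
    simpa using h

instance : Countable (Matrix (Fin m) (Fin n) F[X]) :=
  inferInstanceAs (Countable (Fin m → Fin n → F[X]))

end Translation

/-! ### Full measure -/

section FullMeasure

variable {F : Type*} [Field F] [Finite F] {m n : ℕ}
  [MeasurableSpace (LaurentMatrix F m n)] [BorelSpace (LaurentMatrix F m n)]
  (μ : Measure (LaurentMatrix F m n)) [μ.IsAddHaarMeasure]

/-- Almost every matrix of the unit ball lies in infinitely many of the sets that ubiquity provides,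
since each tail of them covers it up to arbitrarily small measure. -/
theorem measure_ballSubmodule_diff_approxSet {S : Set (Fin m → F[X])} (hS : S.Infinite)
    {ψ : (Fin m → F[X]) → ℝ} (hψ : ∀ q, ∃ r : ℤ, ψ q = (Nat.card F : ℝ) ^ r) {l : ℝ}
    (hl : HasOrderAtInfinity S ψ l) (hl0 : 0 ≤ l) (hn : 0 < n) (hv : n * l < convExponent S) :
    μ ((ballSubmodule F m n 0 : Set (LaurentMatrix F m n)) \ approxSet n S ψ) = 0 := by
  have hψ0 (q : Fin m → F[X]) : 0 < ψ q := by
    obtain ⟨r, hr⟩ := hψ q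
    rw [hr]
    exact zpow_pos (card_pos_real F) r
  have hn0 : (0 : ℝ) < n := by exact_mod_cast hn
  obtain ⟨τ, hτ1, hτ2⟩ := exists_between ((lt_div_iff₀ hn0).2 (by rwa [mul_comm]) :
    l < convExponent S / n)
  rw [lt_div_iff₀ hn0, mul_comm] at hτ2
  let U := (ballSubmodule F m n 0 : Set (LaurentMatrix F m n))
  let E : ℕ → Set (LaurentMatrix F m n) := fun N => ⋃ q ∈ shell S N,
    (annihilator (tensorLT n q ⌊τ * N⌋₊) : Set (LaurentMatrix F m n))
  have hsub : U \ approxSet n S ψ ⊆ ⋃ M : ℕ, ⋂ N ≥ M, U \ E N := by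
    rintro A ⟨hA, hAW⟩
    by_contra hcon
    refine hAW (infinite_of_frequently ?_)
    have hfreq : ∃ᶠ N in atTop, A ∈ E N := by
      rw [frequently_atTop]
      intro M
      simp only [Set.mem_iUnion, not_exists, Set.mem_iInter, not_forall] at hcon
      obtain ⟨N, hN, h⟩ := hcon M
      exact ⟨N, hN, by_contra fun h' => h ⟨hA, h'⟩⟩
    refine (hfreq.and_eventually (eventually_rpow_le hψ0 hl hτ1)).mono ?_
    rintro N ⟨hN1, hN2⟩
    obtain ⟨q, hq, hAq⟩ := Set.mem_iUnion₂.1 hN1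
    refine ⟨q, hq, ((distNearest_lt_iff_mem_annihilator hA).2 hAq).trans_le ?_⟩
    refine zpow_neg_natCast_le_of_rpow_le (hψ q) (hN2 q hq) fun r hr => ?_
    rcases le_or_gt r 0 with h0 | h0
    · exact h0.trans (Int.natCast_nonneg _)
    · lift r to ℕ using h0.le
      exact_mod_cast Nat.le_floor (by exact_mod_cast hr)
  refine measure_mono_null hsub (measure_iUnion_null fun M => ?_)
  have hfin (A : Set (LaurentMatrix F m n)) : μ (U \ A) ≠ ⊤ :=
    ((measure_mono Set.sdiff_subset).trans_lt (measure_ballSubmodule_ne_top μ 0).lt_top).ne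
  have hle : ∀ η > 0, μ.real (⋂ N ≥ M, U \ E N) ≤ η := by
    intro η hη
    obtain ⟨N, hNM, hN⟩ := frequently_atTop.1
      (frequently_real_diff_le μ hS (hl0.trans hτ1.le) (Or.inl hτ2) hη) M
    exact (measureReal_mono (Set.biInter_subset_of_mem (t := fun N => U \ E N) hNM)
      (hfin _)).trans hN
  have h0 : μ.real (⋂ N ≥ M, U \ E N) = 0 :=
    le_antisymm (le_of_forall_pos_le_add fun η hη => by simpa using hle η hη) measureReal_nonneg
  refine (measureReal_eq_zero_iff ?_).1 h0
  exact ((measure_mono (Set.biInter_subset_of_mem (t := fun N => U \ E N) (le_refl M))).trans_lt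
    (hfin _).lt_top).ne

theorem measure_compl_approxSet {S : Set (Fin m → F[X])} (hS : S.Infinite)
    {ψ : (Fin m → F[X]) → ℝ} (hψ : ∀ q, ∃ r : ℤ, ψ q = (Nat.card F : ℝ) ^ r) {l : ℝ}
    (hl : HasOrderAtInfinity S ψ l) (hl0 : 0 ≤ l) (hn : 0 < n) (hv : n * l < convExponent S) :
    μ (approxSet n S ψ)ᶜ = 0 := by
  have hsub : (approxSet n S ψ)ᶜ ⊆ ⋃ P : Matrix (Fin m) (Fin n) F[X],
      (fun A => -ofPolyMatrix P + A) ⁻¹'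
        ((ballSubmodule F m n 0 : Set (LaurentMatrix F m n)) \ approxSet n S ψ) := by
    intro A hA
    obtain ⟨P, hP⟩ := exists_sub_ofPolyMatrix_mem A
    refine Set.mem_iUnion.2 ⟨P, ?_⟩
    rw [Set.mem_preimage, neg_add_eq_sub]
    exact ⟨hP, fun h => hA ((sub_ofPolyMatrix_mem_approxSet P).1 h)⟩
  refine measure_mono_null hsub (measure_iUnion_null fun P => ?_)
  rw [measure_preimage_add]
  exact measure_ballSubmodule_diff_approxSet μ hS hψ hl hl0 hn hv

end FullMeasure

end LaurentInf

/-! ### The upper bound for the Hausdorff dimension -/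

theorem AddSubgroup.exists_fin_cover {G : Type*} [AddGroup G] {H K : AddSubgroup G}
    (h : H.relIndex K ≠ 0) :
    ∃ f : Fin (H.relIndex K) → G, ∀ x ∈ K, ∃ i, -f i + x ∈ H := by
  have hfin : Finite (K ⧸ H.addSubgroupOf K) := Nat.finite_of_card_ne_zero h
  let e : (K ⧸ H.addSubgroupOf K) ≃ Fin (H.relIndex K) := Finite.equivFin _
  refine ⟨fun i => ((e.symm i).out : G), fun x hx => ⟨e (QuotientAddGroup.mk ⟨x, hx⟩), ?_⟩⟩
  have h := QuotientAddGroup.eq.1 (Quotient.out_eq'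
    (QuotientAddGroup.mk (⟨x, hx⟩ : K) : K ⧸ H.addSubgroupOf K))
  simp only [e.symm_apply_apply]
  exact h

namespace LaurentInf

variable {F : Type*} [Field F] [Finite F] {m n : ℕ}

theorem ballSubmodule_le_annihilator {q : Fin m → F[X]} {N : ℕ}
    (hq : infAbs q = (Nat.card F : ℝ) ^ N) (r : ℕ) :
    ballSubmodule F m n (N + r) ≤ annihilator (tensorLT n q r) := by
  rw [← annihilator_polyLT]
  refine annihilator_anti ?_
  have h := polyLT_inf_tensorLT (n := n) hq (Nat.le_add_right N r) le_rfl
  rw [Nat.add_sub_cancel_left] at h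
  exact inf_eq_right.1 h

/-- The matrices of the unit ball with `‖q A‖ < k ^ (-r)` are covered by balls whose radius is
the thickness of the neighbourhoods of the planes `q A = p`. -/
theorem exists_fin_cover_annihilator {q : Fin m → F[X]} {N : ℕ}
    (hq : infAbs q = (Nat.card F : ℝ) ^ N) (r : ℕ) :
    ∃ c : ℕ, c * Nat.card F ^ (r * n) = Nat.card F ^ ((N + r) * (m * n)) ∧
      ∃ f : Fin c → LaurentMatrix F m n, ∀ A ∈ annihilator (tensorLT n q r),
        ∃ i, -f i + A ∈ ballSubmodule F m n (N + r) := by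
  have hq0 := ne_zero_of_infAbs_eq_pow hq
  have := finite_tensorLT (n := n) hq0 r
  have := finite_polyLT (F := F) (m := m) (n := n) (N + r)
  have hmul := AddSubgroup.relIndex_mul_relIndex (ballSubmodule F m n (N + r)).toAddSubgroup
    (annihilator (tensorLT n q r)).toAddSubgroup (ballSubmodule F m n 0).toAddSubgroup
    (ballSubmodule_le_annihilator hq r) (annihilator_le _)
  rw [relIndex_annihilator, natCard_tensorLT hq0, ← annihilator_polyLT (N + r),
    relIndex_annihilator, natCard_polyLT, annihilator_polyLT] at hmul
  refine ⟨_, hmul, AddSubgroup.exists_fin_cover ?_⟩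
  intro h0
  rw [h0, zero_mul] at hmul
  exact (pow_pos Nat.card_pos _).ne hmul

theorem ediam_le_of_forall_mem {j : ℕ} {B : Set (LaurentMatrix F m n)} {f : LaurentMatrix F m n}
    (h : ∀ A ∈ B, -f + A ∈ ballSubmodule F m n j) :
    Metric.ediam B ≤ ENNReal.ofReal ((Nat.card F : ℝ) ^ (-(j : ℤ))) := by
  refine Metric.ediam_le fun A hA A' hA' => ?_
  rw [edist_dist, dist_eq_norm]
  refine ENNReal.ofReal_le_ofReal (le_of_lt (mem_ballSubmodule_iff_norm.1 ?_))
  have := sub_mem (h A hA) (h A' hA')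
  rwa [add_sub_add_left_eq_sub] at this

/-- The inequality `‖q A‖ < ψ q` is an orthogonality relation for some `r ≥ a`. If `ψ q ≥ 1`, the
inequality holds for all `A`, and `r = 0` serves; then only `a ≤ 0` is allowed. -/
theorem exists_nat_forall_mem_annihilator {q : Fin m → F[X]} {ψ : (Fin m → F[X]) → ℝ}
    (hψ : ∃ r : ℤ, ψ q = (Nat.card F : ℝ) ^ r) {a : ℝ}
    (ha : a ≤ 0 ∨ ψ q ≤ (Nat.card F : ℝ) ^ (-a)) :
    ∃ r : ℕ, a ≤ r ∧ ∀ A ∈ ballSubmodule F m n 0,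
      distNearest (Matrix.vecMul (vec q) A) < ψ q → A ∈ annihilator (tensorLT n q r) := by
  obtain ⟨r, hr⟩ := hψ
  refine ⟨(-r).toNat, ?_, fun A hA hd => (distNearest_lt_iff_mem_annihilator hA).1 ?_⟩
  · rcases ha with ha | ha
    · exact ha.trans (Nat.cast_nonneg _)
    · rw [hr, ← Real.rpow_intCast, Real.rpow_le_rpow_left_iff (one_lt_card F)] at ha
      have h1 : ((-r : ℤ) : ℝ) ≤ ((-r).toNat : ℤ) := by exact_mod_cast Int.self_le_toNat _
      push_cast at h1
      linarith
  · rcases le_or_gt r 0 with h | h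
    · rwa [Int.toNat_of_nonneg (by omega), neg_neg, ← hr]
    · rw [Int.toNat_of_nonpos (by omega)]
      simpa using distNearest_lt_one _

/-- Exponents `a` slightly below `l` and `v` slightly above `v(S)` for the covering argument. For
`l = 0` the choice is `a = 0`, which requires no bound for `ψ`. -/
theorem exists_exponents {S : Set (Fin m → F[X])} {l s : ℝ} (hl0 : 0 ≤ l)
    (hs : n * ((m : ℝ) - 1) + (n + convExponent S) / (1 + l) < s) (hv0 : 0 ≤ convExponent S) :
    ∃ a v : ℝ, 0 ≤ a ∧ (a < l ∨ a = 0) ∧ n * ((m : ℝ) - 1) ≤ s ∧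
      (Summable fun q : ↥(S \ {0}) => infAbs q.1 ^ (-v)) ∧
      v + n ≤ (1 + a) * (s - n * ((m : ℝ) - 1)) := by
  let x := s - n * ((m : ℝ) - 1)
  have hx : (n + convExponent S) / (1 + l) < x := by simp only [x]; linarith
  have hx0 : 0 < x := lt_of_le_of_lt (by positivity) hx
  rw [div_lt_iff₀ (by linarith)] at hx
  have hsx : n * ((m : ℝ) - 1) ≤ s := by simp only [x] at hx0; linarith
  rcases hl0.eq_or_lt with rfl | hl
  · obtain ⟨v, hv1, hv2⟩ := exists_summable_lt (show convExponent S < x - n by linarith)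
    exact ⟨0, v, le_rfl, Or.inr rfl, hsx, hv2, by change _ ≤ _ * x; linarith⟩
  · have hlt : max 0 ((n + convExponent S) / x - 1) < l := by
      refine max_lt hl ?_
      rw [sub_lt_iff_lt_add, div_lt_iff₀ hx0]
      linarith
    obtain ⟨a, ha1, ha2⟩ := exists_between hlt
    have ha3 := (le_max_right _ _).trans_lt ha1
    rw [sub_lt_iff_lt_add, div_lt_iff₀ hx0] at ha3
    obtain ⟨v, hv1, hv2⟩ := exists_summable_lt (show convExponent S < (1 + a) * x - n by linarith)
    exact ⟨a, v, (le_max_left _ _).trans ha1.le, Or.inl ha2, hsx, hv2,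
      by change _ ≤ _ * x; linarith⟩

theorem borelSpace_metric [MeasurableSpace (LaurentMatrix F m n)]
    [h : BorelSpace (LaurentMatrix F m n)] :
    @BorelSpace (LaurentMatrix F m n) PseudoEMetricSpace.toUniformSpace.toTopologicalSpace _ := h

-- The topology of matrices and that of their maximum norm agree by definition, but instance search
-- does not see it.
attribute [local instance] borelSpace_metric

/-- The balls of radius `k ^ (-(N + r))` near the planes of `q`, for all `q` outside a finite set,
cover the approximable matrices of the unit ball with finite total mass. -/
theorem hausdorffMeasure_approxSet_inter_ne_top [MeasurableSpace (LaurentMatrix F m n)]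
    [BorelSpace (LaurentMatrix F m n)] {S : Set (Fin m → F[X])} (hS : S.Infinite)
    {ψ : (Fin m → F[X]) → ℝ} (hψ : ∀ q, ∃ r : ℤ, ψ q = (Nat.card F : ℝ) ^ r) {l : ℝ}
    (hl : HasOrderAtInfinity S ψ l) (hl0 : 0 ≤ l) {s : ℝ} (hs0 : 0 < s)
    (hs : n * ((m : ℝ) - 1) + (n + convExponent S) / (1 + l) < s) :
    Measure.hausdorffMeasure s (approxSet n S ψ ∩
      (ballSubmodule F m n 0 : Set (LaurentMatrix F m n))) ≠ ⊤ := by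
  have hk := card_pos_real F
  have hk1 := one_lt_card F
  have hψ0 (q : Fin m → F[X]) : 0 < ψ q := by
    obtain ⟨r, hr⟩ := hψ q
    rw [hr]
    exact zpow_pos hk r
  obtain ⟨a, v, ha0, hal, hsn, hsum, hav⟩ := exists_exponents hl0 hs (convExponent_nonneg hS)
  have hev : ∀ᶠ N : ℕ in atTop, ∀ q ∈ shell S N,
      a * N ≤ 0 ∨ ψ q ≤ (Nat.card F : ℝ) ^ (-(a * N)) := by
    rcases hal with h | rfl
    · filter_upwards [eventually_le_rpow hψ0 hl h] with N hN q hq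
      exact Or.inr (hN q hq)
    · exact Eventually.of_forall fun N q _ => Or.inl (by simp)
  obtain ⟨N₀, hN₀⟩ := eventually_atTop.1 hev
  let Q := {q : Fin m → F[X] // q ∈ S ∧ ∃ N ≥ N₀, infAbs q = (Nat.card F : ℝ) ^ N}
  have hdata (q : Q) : ∃ (c j : ℕ) (f : Fin c → LaurentMatrix F m n),
      (c : ℝ) * ((Nat.card F : ℝ) ^ (-(j : ℤ))) ^ s ≤ infAbs q.1 ^ (-v) ∧
      ∀ A ∈ ballSubmodule F m n 0, distNearest (Matrix.vecMul (vec q.1) A) < ψ q.1 →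
        ∃ i, -f i + A ∈ ballSubmodule F m n j := by
    obtain ⟨q, hqS, N, hN, hq⟩ := q
    obtain ⟨r, har, hr⟩ := exists_nat_forall_mem_annihilator (n := n) (hψ q)
      (hN₀ N hN q ⟨hqS, hq⟩)
    obtain ⟨c, hc, f, hf⟩ := exists_fin_cover_annihilator (n := n) hq r
    refine ⟨c, N + r, f, ?_, fun A hA hd => hf A (hr A hA hd)⟩
    have hc' : (c : ℝ) = (Nat.card F : ℝ) ^ (((N + r) * (m * n) - r * n : ℝ)) := by
      have h1 : (c : ℝ) * (Nat.card F : ℝ) ^ (r * n) = (Nat.card F : ℝ) ^ ((N + r) * (m * n)) := by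
        exact_mod_cast hc
      rw [Real.rpow_sub hk, eq_div_iff (Real.rpow_pos_of_pos hk _).ne']
      rw [← Real.rpow_natCast, ← Real.rpow_natCast] at h1
      push_cast at h1
      exact h1
    rw [hc', hq, ← Real.rpow_intCast, ← Real.rpow_natCast, ← Real.rpow_mul hk.le,
      ← Real.rpow_mul hk.le, ← Real.rpow_add hk]
    refine Real.rpow_le_rpow_of_exponent_le hk1.le ?_
    push_cast
    have h2 : a * N * (s - n * ((m : ℝ) - 1)) ≤ r * (s - n * ((m : ℝ) - 1)) :=
      mul_le_mul_of_nonneg_right har (by linarith)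
    have h3 := mul_le_mul_of_nonneg_right hav (Nat.cast_nonneg (α := ℝ) N)
    nlinarith
  choose c j f hcost hcover using hdata
  let w : Q → ENNReal := fun q => ENNReal.ofReal (infAbs q.1 ^ (-v))
  have hw : ∑' q, w q ≠ ⊤ := by
    let g : Q → ↥(S \ {0}) := fun q => ⟨q.1, q.2.1, by
      obtain ⟨N, -, hN⟩ := q.2.2
      exact ne_zero_of_infAbs_eq_pow hN⟩
    have hg : Function.Injective g := fun q q' h => Subtype.ext (congrArg (fun z => z.1) h)
    have h1 := hsum.comp_injective hg
    have h2 := ENNReal.ofReal_tsum_of_nonneg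
      (fun q => Real.rpow_nonneg (infAbs_nonneg (g q).1) _) h1
    exact (h2.symm.trans_ne ENNReal.ofReal_ne_top)
  have hcell (q : Q) (i : Fin (c q)) : Metric.ediam {A : LaurentMatrix F m n |
      -f q i + A ∈ ballSubmodule F m n (j q)} ≤
      ENNReal.ofReal ((Nat.card F : ℝ) ^ (-(j q : ℤ))) :=
    ediam_le_of_forall_mem fun A hA => hA
  have hcw (q : Q) : (c q : ENNReal) * ENNReal.ofReal ((Nat.card F : ℝ) ^ (-(j q : ℤ))) ^ s ≤
      w q := by
    rw [ENNReal.ofReal_rpow_of_nonneg (zpow_nonneg hk.le _) hs0.le, ← ENNReal.ofReal_natCast,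
      ← ENNReal.ofReal_mul (Nat.cast_nonneg _)]
    exact ENNReal.ofReal_le_ofReal (hcost q)
  -- The covers are indexed by the finite sets `u` of vectors that are left out; the total mass of
  -- the cover, raised to the power `1 / s`, bounds the diameters of its members.
  have hmain := Measure.hausdorffMeasure_le_liminf_tsum (β := Finset Q)
    (ι := fun u => Σ q : {q // q ∉ u}, Fin (c q.1)) s
    (approxSet n S ψ ∩ (ballSubmodule F m n 0 : Set (LaurentMatrix F m n)))
    (l := atTop) (fun u => (∑' q : {q // q ∉ u}, w q.1) ^ (s⁻¹)) (by
      have h := (ENNReal.continuous_rpow_const (y := s⁻¹)).tendsto 0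
      rw [ENNReal.zero_rpow_of_pos (by positivity)] at h
      exact h.comp (ENNReal.tendsto_tsum_compl_atTop_zero hw))
    (fun u x => {A | -f x.1.1 x.2 + A ∈ ballSubmodule F m n (j x.1.1)})
    (Eventually.of_forall fun u x => by
      rw [ENNReal.le_rpow_inv_iff hs0]
      refine (ENNReal.rpow_le_rpow (hcell x.1.1 x.2) hs0.le).trans ?_
      refine le_trans ?_ (ENNReal.le_tsum x.1)
      refine le_trans ?_ (hcw x.1.1)
      refine le_mul_of_one_le_left (zero_le) ?_
      exact_mod_cast Fin.pos x.2)
    (Eventually.of_forall fun u => by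
      rintro A ⟨hAW, hAU⟩
      have hfin : ((Subtype.val '' (u : Set Q)) ∪
          {q : Fin m → F[X] | infAbs q ≤ (Nat.card F : ℝ) ^ N₀}).Finite :=
        ((Finset.finite_toSet u).image _).union (setFinite_infAbs_le _)
      obtain ⟨q, ⟨hqS, hqd⟩, hq⟩ := (Set.Infinite.sdiff hAW hfin).nonempty
      rw [Set.mem_union, not_or] at hq
      have hqN : (Nat.card F : ℝ) ^ N₀ < infAbs q := not_le.1 hq.2
      obtain ⟨N, hN⟩ := exists_infAbs_eq_pow (q := q) (by
        rintro rfl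
        rw [infAbs_zero] at hqN
        exact absurd (pow_pos hk N₀) (not_lt.2 hqN.le))
      rw [hN] at hqN
      let q' : Q := ⟨q, hqS, N, ((pow_lt_pow_iff_right₀ hk1).1 hqN).le, hN⟩
      obtain ⟨i, hi⟩ := hcover q' A hAU hqd
      exact Set.mem_iUnion.2 ⟨⟨⟨q', fun h => hq.1 ⟨q', h, rfl⟩⟩, i⟩, hi⟩)
  refine (hmain.trans_lt ?_).ne
  refine lt_of_le_of_lt (b := ∑' q, w q) ?_ hw.lt_top
  rw [← liminf_const (f := (atTop : Filter (Finset Q))) (∑' q, w q)]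
  refine liminf_le_liminf (Eventually.of_forall fun u => ?_)
  rw [ENNReal.tsum_sigma']
  refine le_trans (ENNReal.tsum_le_tsum (g := fun q : {q // q ∉ u} => w q.1) fun q => ?_)
    (ENNReal.tsum_comp_le_tsum_of_injective Subtype.val_injective w)
  refine le_trans (ENNReal.tsum_le_tsum fun i => ENNReal.rpow_le_rpow (hcell q.1 i) hs0.le) ?_
  rw [ENNReal.tsum_const, ENat.card_eq_coe_natCard, Nat.card_fin]
  exact hcw q.1

theorem dimH_approxSet_le {S : Set (Fin m → F[X])} (hS : S.Infinite)
    {ψ : (Fin m → F[X]) → ℝ} (hψ : ∀ q, ∃ r : ℤ, ψ q = (Nat.card F : ℝ) ^ r) {l : ℝ}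
    (hl : HasOrderAtInfinity S ψ l) (hl0 : 0 ≤ l) :
    dimH (approxSet n S ψ) ≤
      ENNReal.ofReal (n * ((m : ℝ) - 1) + (n + convExponent S) / (1 + l)) := by
  have hsub : approxSet n S ψ ⊆ ⋃ P : Matrix (Fin m) (Fin n) F[X],
      (fun A => A + ofPolyMatrix P) '' (approxSet n S ψ ∩
        (ballSubmodule F m n 0 : Set (LaurentMatrix F m n))) := by
    intro A hA
    obtain ⟨P, hP⟩ := exists_sub_ofPolyMatrix_mem A
    exact Set.mem_iUnion.2 ⟨P, A - ofPolyMatrix P, ⟨(sub_ofPolyMatrix_mem_approxSet P).2 hA, hP⟩,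
      sub_add_cancel _ _⟩
  have hiso (P : Matrix (Fin m) (Fin n) F[X]) :
      Isometry fun A : LaurentMatrix F m n => A + ofPolyMatrix P :=
    Isometry.of_dist_eq fun a b => dist_add_right a b _
  refine (dimH_mono hsub).trans ?_
  rw [dimH_iUnion]
  refine iSup_le fun P => ?_
  rw [(hiso P).dimH_image]
  by_contra! h
  obtain ⟨s, hs1, hs2⟩ := ENNReal.lt_iff_exists_nnreal_btwn.1 h
  have hs0 : (0 : ℝ) < s := by
    have : (0 : ENNReal) < s := lt_of_le_of_lt zero_le hs1
    exact_mod_cast this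
  rw [← ENNReal.ofReal_coe_nnreal, ENNReal.ofReal_lt_ofReal_iff hs0] at hs1
  let _ : MeasurableSpace (LaurentMatrix F m n) := borel _
  have : BorelSpace (LaurentMatrix F m n) := ⟨rfl⟩
  exact absurd (dimH_le_of_hausdorffMeasure_ne_top
    (hausdorffMeasure_approxSet_inter_ne_top hS hψ hl hl0 hs0 hs1)) (not_le.2 hs2)

end LaurentInf

attribute [local instance] LaurentInf.borelSpace_metric

/-! ### Avoiding a cover by small balls -/

namespace LaurentInf

section Avoidance

variable {F : Type*} [Field F] [Finite F] {m n : ℕ}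

theorem natCast_card_ne_zero (F : Type*) [Field F] [Finite F] : (Nat.card F : ENNReal) ≠ 0 := by
  exact_mod_cast Nat.card_pos.ne'

theorem one_le_natCast_card (F : Type*) [Field F] [Finite F] : (1 : ENNReal) ≤ Nat.card F := by
  exact_mod_cast Nat.card_pos

theorem natCast_card_rpow_mul (F : Type*) [Field F] [Finite F] (x y : ℝ) :
    (Nat.card F : ENNReal) ^ x * (Nat.card F : ENNReal) ^ y = (Nat.card F : ENNReal) ^ (x + y) :=
  (ENNReal.rpow_add x y (natCast_card_ne_zero F) (ENNReal.natCast_ne_top _)).symm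

/-- No ball of the family with centres `c i` and radii `k ^ (-j i)` contains the ball with centre
`x` and radius `k ^ (-a)`. -/
def Avoids (c : ℕ → LaurentMatrix F m n) (j : ℕ → ℕ) (x : LaurentMatrix F m n) (a : ℕ) : Prop :=
  ∀ i, j i ≤ a → x - c i ∉ ballSubmodule F m n (j i)

open Classical in
/-- The sum of the `s`-th powers of the radii of the balls of the family that have their centres
in the ball with centre `x` and radius `k ^ (-a)`. -/
noncomputable def coverMass (c : ℕ → LaurentMatrix F m n) (j : ℕ → ℕ) (s : ℝ)
    (x : LaurentMatrix F m n) (a : ℕ) : ENNReal :=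
  ∑' i, if x - c i ∈ ballSubmodule F m n a then (Nat.card F : ENNReal) ^ (-(s * j i)) else 0

open Classical in
/-- A first moment argument: a random point of `T` avoids the balls of radius at least `k ^ (-e)`,
and the mass of the smaller balls near it is controlled by the average mass. -/
theorem exists_avoids_of_average [MeasurableSpace (LaurentMatrix F m n)]
    [BorelSpace (LaurentMatrix F m n)] (μ : Measure (LaurentMatrix F m n)) [μ.IsAddHaarMeasure]
    {c : ℕ → LaurentMatrix F m n} {j : ℕ → ℕ} {s : ℝ} {y : LaurentMatrix F m n} {b e : ℕ}
    (hbe : b ≤ e) (hy : Avoids c j y b) {T : Set (LaurentMatrix F m n)} (hT : MeasurableSet T)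
    (hTy : ∀ z ∈ T, z - y ∈ ballSubmodule F m n b) (hT0 : μ T ≠ 0) (hT1 : μ T ≠ ⊤)
    {A κ w : ENNReal}
    (hA : ∀ i x, b ≤ i → i ≤ e → μ (T ∩ {z | z - x ∈ ballSubmodule F m n i}) ≤
      A * (Nat.card F : ENNReal) ^ (-(s * i)) * μ T)
    (hκ : ∀ x, μ (T ∩ {z | z - x ∈ ballSubmodule F m n e}) ≤ κ * μ T)
    (hsum : coverMass c j s y b * (A + w * κ) < 1) :
    ∃ z ∈ T, Avoids c j z e ∧ coverMass c j s z e * w < 1 := by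
  let θ : ℕ → ENNReal := fun i => (Nat.card F : ENNReal) ^ (-(s * j i))
  let B : LaurentMatrix F m n → ℕ → Set (LaurentMatrix F m n) :=
    fun x i => {z | z - x ∈ ballSubmodule F m n i}
  have hB (x : LaurentMatrix F m n) (i : ℕ) : MeasurableSet (B x i) := by
    have : Continuous fun z : LaurentMatrix F m n => z - x := continuous_id.sub continuous_const
    exact ((isOpen_ballSubmodule i).preimage this).measurableSet
  -- If `∑ g i z < 1`, then `z` lies in no ball of radius between `k ^ (-b)` and `k ^ (-e)`, and the
  -- smaller balls near `z` have mass less than `1 / w`. The mean of this sum over `T` is below `1`.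
  let g : ℕ → LaurentMatrix F m n → ENNReal := fun i =>
    if y - c i ∈ ballSubmodule F m n b then
      if j i ≤ e then (B (c i) (j i)).indicator fun _ => 1
      else (B (c i) e).indicator fun _ => w * θ i
    else fun _ => 0
  have hg (i : ℕ) : Measurable (g i) := by
    simp only [g]
    split_ifs
    · exact measurable_const.indicator (hB _ _)
    · exact measurable_const.indicator (hB _ _)
    · exact measurable_const
  have hint (i : ℕ) : ∫⁻ z in T, g i z ∂μ ≤
      (if y - c i ∈ ballSubmodule F m n b then θ i else 0) * ((A + w * κ) * μ T) := by
    simp only [g]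
    split_ifs with h1 h2
    · rw [lintegral_indicator_const (hB _ _), one_mul, Measure.restrict_apply (hB _ _),
        Set.inter_comm]
      have hb : b ≤ j i := by
        by_contra! hlt
        exact hy i hlt.le (ballSubmodule_anti hlt.le h1)
      refine (hA (j i) (c i) hb h2).trans ?_
      calc A * θ i * μ T = θ i * (A * μ T) := by ring
        _ ≤ _ := by gcongr; exact le_self_add
    · rw [lintegral_indicator_const (hB _ _), Measure.restrict_apply (hB _ _), Set.inter_comm]
      calc w * θ i * μ (T ∩ B (c i) e) ≤ w * θ i * (κ * μ T) := by gcongr; exact hκ _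
        _ = θ i * (w * κ * μ T) := by ring
        _ ≤ _ := by gcongr; exact le_add_self
    · simp
  have htot : ∫⁻ z in T, ∑' i, g i z ∂μ < μ T := by
    rw [lintegral_tsum fun i => (hg i).aemeasurable]
    refine (ENNReal.tsum_le_tsum hint).trans_lt ?_
    rw [ENNReal.tsum_mul_right, ← mul_assoc]
    conv_rhs => rw [← one_mul (μ T)]
    exact ENNReal.mul_lt_mul_left hT0 hT1 hsum
  obtain ⟨z, hz, hz1⟩ : ∃ z ∈ T, ∑' i, g i z < 1 := by
    by_contra! hcon
    refine absurd htot (not_lt.2 ?_)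
    calc μ T = ∫⁻ _ in T, 1 ∂μ := by simp
      _ ≤ _ := setLIntegral_mono' hT hcon
  have hzy := hTy z hz
  have hcenter {i a : ℕ} (ha : b ≤ a) (h : z - c i ∈ ballSubmodule F m n a) :
      y - c i ∈ ballSubmodule F m n b := by
    have := sub_mem (ballSubmodule_anti ha h) hzy
    rwa [sub_sub_sub_cancel_left] at this
  have havoid : Avoids c j z e := by
    intro i hi hmem
    rcases le_total (j i) b with hb | hb
    · refine hy i hb ?_
      have := sub_mem hmem (ballSubmodule_anti hb hzy)
      rwa [sub_sub_sub_cancel_left] at this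
    · have h1 : g i z = 1 := by
        simp only [g]
        rw [if_pos (hcenter hb hmem), if_pos hi]
        exact Set.indicator_of_mem (s := B (c i) (j i)) hmem _
      exact absurd (h1.ge.trans (ENNReal.le_tsum i)) (not_le.2 hz1)
  refine ⟨z, hz, havoid, lt_of_le_of_lt ?_ hz1⟩
  rw [coverMass, ← ENNReal.tsum_mul_right]
  refine ENNReal.tsum_le_tsum fun i => ?_
  split_ifs with h
  · have hlt : ¬ j i ≤ e := fun hle => havoid i hle (ballSubmodule_anti hle h)
    simp only [g]
    rw [if_pos (hcenter hbe h), if_neg hlt, Set.indicator_of_mem (s := B (c i) e) h, mul_comm]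
  · rw [zero_mul]
    exact zero_le

/-- A point of a neighbourhood of a plane `q A = p` is near a point of the plane. -/
theorem exists_sub_mem_ballSubmodule {q : Fin m → F[X]} {N : ℕ}
    (hq : infAbs q = (Nat.card F : ℝ) ^ N) {r : ℕ} {y : LaurentMatrix F m n}
    (hy : y ∈ annihilator (tensorLT n q r)) (r' : ℕ) :
    ∃ z ∈ annihilator (tensorLT n q r'), z - y ∈ ballSubmodule F m n (N + r) := by
  rw [mem_annihilator_tensorLT] at hy
  obtain ⟨i, hi, hN⟩ := exists_norm_eq hq
  choose p hp using fun l => exists_ofPoly_coeff_eq (Matrix.vecMul (vec q) y l)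
  let u : Fin n → LaurentInf F := fun l => Matrix.vecMul (vec q) y l - ofPoly (p l)
  have hu (l : Fin n) (t : ℤ) (ht : t ≤ r) : coeff (u l) t = 0 := by
    simp only [u]
    rw [coeff_sub]
    rcases le_or_gt t 0 with h0 | h0
    · rw [hp l t h0, sub_self]
    · rw [hy.2 l t h0 ht, coeff_ofPoly_of_pos _ h0, sub_zero]
  have hk := card_pos_real F
  have hB (l : Fin n) (t : ℤ) (ht : t ≤ (N + r : ℕ)) : coeff (u l / ofPoly (q i)) t = 0 := by
    refine (norm_lt_iff _ ((N + r : ℕ) : ℤ)).1 ?_ t ht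
    rw [norm_div, norm_ofPoly hi, hN, div_lt_iff₀ (pow_pos hk N), ← zpow_natCast,
      ← zpow_add₀ hk.ne']
    have := (norm_lt_iff (u l) r).2 (hu l)
    refine this.trans_eq ?_
    congr 1
    push_cast
    ring
  let B : LaurentMatrix F m n := Matrix.of fun i' l => if i' = i then -(u l / ofPoly (q i)) else 0
  have hBmem : B ∈ ballSubmodule F m n (N + r) := by
    intro i' l t ht
    simp only [B, Matrix.of_apply]
    split_ifs
    · rw [coeff_neg, hB l t ht, neg_zero]
    · rfl
  refine ⟨y + B, mem_annihilator_tensorLT.2 ⟨add_mem hy.1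
    (ballSubmodule_anti (Nat.zero_le _) hBmem), fun l t ht _ => ?_⟩, by rwa [add_sub_cancel_left]⟩
  have h1 : Matrix.vecMul (vec q) B l = -u l := by
    change ∑ i', ofPoly (q i') * (if i' = i then -(u l / ofPoly (q i)) else 0) = -u l
    simp only [mul_ite, mul_zero, Finset.sum_ite_eq', Finset.mem_univ, if_true]
    rw [mul_neg, mul_div_cancel₀ _ (ofPoly_ne_zero hi)]
  rw [Matrix.vecMul_add, Pi.add_apply, h1]
  have h2 : Matrix.vecMul (vec q) y l + -u l = ofPoly (p l) := by
    simp only [u]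
    ring
  rw [h2, coeff_ofPoly_of_pos _ ht]

section Measure

variable [MeasurableSpace (LaurentMatrix F m n)]
    [BorelSpace (LaurentMatrix F m n)] (μ : Measure (LaurentMatrix F m n)) [μ.IsAddHaarMeasure]

theorem measure_ballSubmodule (j : ℕ) : μ (ballSubmodule F m n j : Set (LaurentMatrix F m n)) =
    (Nat.card F : ENNReal) ^ (-(j * (m * n) : ℝ)) *
      μ (ballSubmodule F m n 0 : Set (LaurentMatrix F m n)) := by
  refine (ENNReal.toReal_eq_toReal_iff' (measure_ballSubmodule_ne_top μ j)
    (ENNReal.mul_ne_top ?_ (measure_ballSubmodule_ne_top μ 0))).1 ?_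
  · exact ENNReal.rpow_ne_top_of_ne_zero (natCast_card_ne_zero F) (ENNReal.natCast_ne_top _)
  · rw [ENNReal.toReal_mul, ← ENNReal.toReal_rpow, ENNReal.toReal_natCast]
    refine (real_ballSubmodule μ j).trans ?_
    rw [Real.rpow_neg (card_pos_real F).le, ← Real.rpow_natCast, div_eq_inv_mul]
    push_cast
    rfl

theorem measure_ballSubmodule_inf_annihilator {q : Fin m → F[X]} {N : ℕ}
    (hq : infAbs q = (Nat.card F : ℝ) ^ N) {b j r : ℕ} (hb : N ≤ b) (hbj : b ≤ j)
    (hj : j ≤ N + r) :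
    μ (ballSubmodule F m n j ⊓ annihilator (tensorLT n q r) : Submodule F _) =
      (Nat.card F : ENNReal) ^ (-((j - b) * (m * n - n) : ℝ)) *
      μ (ballSubmodule F m n b ⊓ annihilator (tensorLT n q r) : Submodule F _) := by
  have hfin (i : ℕ) :
      μ (ballSubmodule F m n i ⊓ annihilator (tensorLT n q r) : Submodule F _) ≠ ⊤ :=
    ((measure_mono inf_le_left).trans_lt (measure_ballSubmodule_ne_top μ i).lt_top).ne
  refine (ENNReal.toReal_eq_toReal_iff' (hfin j) (ENNReal.mul_ne_top ?_ (hfin b))).1 ?_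
  · exact ENNReal.rpow_ne_top_of_ne_zero (natCast_card_ne_zero F) (ENNReal.natCast_ne_top _)
  · rw [ENNReal.toReal_mul, ← ENNReal.toReal_rpow, ENNReal.toReal_natCast]
    refine (real_ballSubmodule_inf_annihilator μ hq (hb.trans hbj) hj).trans ?_
    have h2 := real_ballSubmodule_inf_annihilator (n := n) μ hq hb (hbj.trans hj)
    rw [Measure.real] at h2
    rw [h2]
    have hk := card_pos_real F
    rw [mul_div_assoc, mul_div_assoc,
      mul_left_comm ((Nat.card F : ℝ) ^ (-(((j : ℝ) - b) * (m * n - n))))]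
    congr 1
    simp only [← Real.rpow_natCast]
    rw [← Real.rpow_sub hk, ← Real.rpow_sub hk, ← Real.rpow_add hk]
    congr 1
    push_cast [Nat.cast_sub hb, Nat.cast_sub (hb.trans hbj)]
    ring

theorem measure_sub_mem (x : LaurentMatrix F m n) (B : Set (LaurentMatrix F m n)) :
    μ {z | z - x ∈ B} = μ B := by
  have : {z | z - x ∈ B} = (fun z => -x + z) ⁻¹' B := by
    ext z
    rw [Set.mem_preimage, neg_add_eq_sub]
    rfl
  rw [this, measure_preimage_add]

/-- Refinement inside a set that fills at least half of a ball. The invariant is that the mass of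
the family in a ball of radius `ρ` is less than `ρ ^ s / 4`; here it turns into a bound that is
better than `ρ ^ s` and gives room for the refinement to a plane. -/
theorem exists_avoids_of_large {c : ℕ → LaurentMatrix F m n} {j : ℕ → ℕ} {s : ℝ} (hs : s ≤ m * n)
    {x : LaurentMatrix F m n} {a : ℕ} (hx : x ∈ ballSubmodule F m n 0) (hxa : Avoids c j x a)
    (hmass : coverMass c j s x a * (4 * (Nat.card F : ENNReal) ^ (s * a)) < 1)
    {E : Set (LaurentMatrix F m n)} (hE : MeasurableSet E)
    (hEa : μ ((ballSubmodule F m n 0 : Set (LaurentMatrix F m n)) \ E) ≤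
      μ (ballSubmodule F m n a : Set (LaurentMatrix F m n)) / 2) {b : ℕ} (hab : a ≤ b) :
    ∃ y ∈ E, y - x ∈ ballSubmodule F m n a ∧ Avoids c j y b ∧
      coverMass c j s y b * (Nat.card F : ENNReal) ^ (s * a + (b - a) * (m * n)) < 1 := by
  let U := (ballSubmodule F m n 0 : Set (LaurentMatrix F m n))
  let M := μ (ballSubmodule F m n a : Set (LaurentMatrix F m n))
  let B := {z | z - x ∈ ballSubmodule F m n a}
  have hBμ : μ B = M := measure_sub_mem μ x _
  have hBU : B ⊆ U := fun z hz => by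
    have := add_mem (ballSubmodule_anti (Nat.zero_le a) hz) hx
    rwa [sub_add_cancel] at this
  have hB : MeasurableSet B := by
    have : Continuous fun z : LaurentMatrix F m n => z - x := continuous_id.sub continuous_const
    exact ((isOpen_ballSubmodule a).preimage this).measurableSet
  have hM0 : M ≠ 0 := measure_ballSubmodule_ne_zero μ a
  have hM1 : M ≠ ⊤ := measure_ballSubmodule_ne_top μ a
  have hhalf : M / 2 ≤ μ (E ∩ B) := by
    have h1 : M ≤ μ (E ∩ B) + M / 2 := by
      calc M = μ B := hBμ.symm
        _ ≤ μ ((E ∩ B) ∪ (U \ E)) := measure_mono fun z hz => by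
            by_cases h : z ∈ E
            · exact Or.inl ⟨h, hz⟩
            · exact Or.inr ⟨hBU hz, h⟩
        _ ≤ _ := (measure_union_le _ _).trans (by gcongr)
    refine ENNReal.le_of_add_le_add_right (ENNReal.div_ne_top hM1 two_ne_zero) ?_
    rwa [ENNReal.add_halves]
  have h2M : M ≤ 2 * μ (E ∩ B) := by
    calc M = 2 * (M / 2) := (ENNReal.mul_div_cancel two_ne_zero ENNReal.ofNat_ne_top).symm
      _ ≤ _ := by gcongr
  have hball (i : ℕ) (hi : a ≤ i) (x' : LaurentMatrix F m n) :
      μ (E ∩ B ∩ {z | z - x' ∈ ballSubmodule F m n i}) ≤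
        2 * (Nat.card F : ENNReal) ^ (-((i - a) * (m * n) : ℝ)) * μ (E ∩ B) := by
    calc _ ≤ μ {z | z - x' ∈ ballSubmodule F m n i} := measure_mono Set.inter_subset_right
      _ = μ (ballSubmodule F m n i : Set (LaurentMatrix F m n)) := measure_sub_mem μ x' _
      _ = (Nat.card F : ENNReal) ^ (-((i - a) * (m * n) : ℝ)) * M := by
        simp only [M]
        rw [measure_ballSubmodule μ i, measure_ballSubmodule μ a,
          ← mul_assoc ((Nat.card F : ENNReal) ^ (-((i - a) * (m * n) : ℝ))), natCast_card_rpow_mul]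
        congr 2
        ring
      _ ≤ (Nat.card F : ENNReal) ^ (-((i - a) * (m * n) : ℝ)) * (2 * μ (E ∩ B)) := by gcongr
      _ = _ := by ring
  obtain ⟨y, hy, hy1, hy2⟩ := exists_avoids_of_average μ (s := s) (T := E ∩ B) hab hxa (hE.inter hB)
    (fun z hz => hz.2) (fun h0 => by
      rw [h0, mul_zero, nonpos_iff_eq_zero] at h2M
      exact hM0 h2M)
    ((measure_mono Set.inter_subset_right).trans_lt (hBμ.trans_lt hM1.lt_top)).ne
    (A := 2 * (Nat.card F : ENNReal) ^ (s * a))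
    (κ := 2 * (Nat.card F : ENNReal) ^ (-((b - a) * (m * n) : ℝ)))
    (w := (Nat.card F : ENNReal) ^ (s * a + (b - a) * (m * n))) (fun i x' hi _ => by
      refine (hball i hi x').trans ?_
      rw [mul_assoc 2 _ (_ ^ (-(s * i))), natCast_card_rpow_mul]
      gcongr
      · exact one_le_natCast_card F
      · have : (a : ℝ) ≤ i := by exact_mod_cast hi
        nlinarith)
    (fun x' => hball b hab x') (by
      refine lt_of_eq_of_lt ?_ hmass
      congr 1
      rw [mul_left_comm, natCast_card_rpow_mul, add_neg_cancel_right, ← add_mul]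
      norm_num)
  exact ⟨y, hy.1, hy.2, hy1, hy2⟩

/-- Refinement to the narrow neighbourhood of a rational plane, starting in its wide neighbourhood.
At scales above the thickness the neighbourhood has dimension `m n - n ≤ s`, so that its worst scale
is the final one, `k ^ (-(N + r'))`. -/
theorem exists_avoids_of_plane (μ : Measure (LaurentMatrix F m n)) [μ.IsAddHaarMeasure]
    {c : ℕ → LaurentMatrix F m n} {j : ℕ → ℕ} {s : ℝ} (hs : (m * n - n : ℝ) ≤ s)
    {q : Fin m → F[X]} {N : ℕ} (hq : infAbs q = (Nat.card F : ℝ) ^ N) {r r' : ℕ}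
    (hr : r ≤ r') {y : LaurentMatrix F m n} (hy : y ∈ annihilator (tensorLT n q r))
    (hyb : Avoids c j y (N + r)) {t : ℝ}
    (hmass : coverMass c j s y (N + r) * (Nat.card F : ENNReal) ^ t < 1)
    (ht : (N + r) * (m * n - n) + (N + r') * (s - (m * n - n)) + 3 ≤ t) :
    ∃ z ∈ annihilator (tensorLT n q r'), z - y ∈ ballSubmodule F m n (N + r) ∧
      Avoids c j z (N + r') ∧
      coverMass c j s z (N + r') * (4 * (Nat.card F : ENNReal) ^ (s * (N + r'))) < 1 := by
  have hq0 := ne_zero_of_infAbs_eq_pow hq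
  have := finite_tensorLT (n := n) hq0 r'
  let H : ℕ → Submodule F (LaurentMatrix F m n) :=
    fun i => ballSubmodule F m n i ⊓ annihilator (tensorLT n q r')
  let T : Set (LaurentMatrix F m n) :=
    {z | z - y ∈ ballSubmodule F m n (N + r)} ∩ annihilator (tensorLT n q r')
  have hT : MeasurableSet T := by
    have hc : Continuous fun z : LaurentMatrix F m n => z - y := continuous_id.sub continuous_const
    exact ((isOpen_ballSubmodule _).preimage hc).measurableSet.inter
      (isOpen_annihilator _).measurableSet
  obtain ⟨z₀, hz₀, hz₀y⟩ := exists_sub_mem_ballSubmodule hq hy r'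
  have hTH : μ (H (N + r) : Set (LaurentMatrix F m n)) ≤ μ T := by
    rw [← measure_sub_mem μ z₀]
    refine measure_mono fun z hz => ⟨?_, ?_⟩
    · have := add_mem hz.1 hz₀y
      rwa [sub_add_sub_cancel] at this
    · have := add_mem hz.2 hz₀
      rwa [sub_add_cancel] at this
  have hH0 : μ (H (N + r) : Set (LaurentMatrix F m n)) ≠ 0 :=
    (((isOpen_ballSubmodule (N + r)).inter (isOpen_annihilator (tensorLT n q r'))).measure_pos μ
      ⟨0, zero_mem _, zero_mem _⟩).ne'
  have hball (i : ℕ) (hi : N + r ≤ i) (hi' : i ≤ N + r') (x : LaurentMatrix F m n) :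
      μ (T ∩ {z | z - x ∈ ballSubmodule F m n i}) ≤
        (Nat.card F : ENNReal) ^ (-((i - (N + r)) * (m * n - n) : ℝ)) * μ T := by
    have h1 : μ (T ∩ {z | z - x ∈ ballSubmodule F m n i}) ≤
        μ (H i : Set (LaurentMatrix F m n)) := by
      rcases (T ∩ {z | z - x ∈ ballSubmodule F m n i}).eq_empty_or_nonempty with h | ⟨z₁, h₁, h₁'⟩
      · rw [h, measure_empty]
        exact zero_le
      · rw [← measure_sub_mem μ z₁ (H i : Set (LaurentMatrix F m n))]
        refine measure_mono fun z hz => ⟨?_, sub_mem hz.1.2 h₁.2⟩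
        have := sub_mem (show z - x ∈ ballSubmodule F m n i from hz.2)
          (show z₁ - x ∈ ballSubmodule F m n i from h₁')
        rwa [sub_sub_sub_cancel_right] at this
    refine h1.trans ?_
    have h2 := measure_ballSubmodule_inf_annihilator (n := n) μ hq (Nat.le_add_right N r) hi hi'
    push_cast at h2
    refine h2.trans_le ?_
    gcongr
  obtain ⟨z, hz, hz1, hz2⟩ := exists_avoids_of_average μ (s := s) (T := T) (b := N + r)
    (e := N + r') (by omega) hyb hT
    (fun z hz => hz.1) (fun h0 => hH0 (by
      rw [h0, nonpos_iff_eq_zero] at hTH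
      exact hTH))
    ((measure_mono fun z hz => annihilator_le _ hz.2).trans_lt
      (measure_ballSubmodule_ne_top μ 0).lt_top).ne
    (A := (Nat.card F : ENNReal) ^ ((N + r) * (m * n - n) + (N + r') * (s - (m * n - n)) : ℝ))
    (κ := (Nat.card F : ENNReal) ^ (-((r' - r) * (m * n - n) : ℝ)))
    (w := 4 * (Nat.card F : ENNReal) ^ (s * (N + r'))) (fun i x hi hi' => by
      refine (hball i hi hi' x).trans ?_
      rw [natCast_card_rpow_mul]
      gcongr
      · exact one_le_natCast_card F
      · have : (i : ℝ) ≤ N + r' := by exact_mod_cast hi'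
        nlinarith)
    (fun x => by
      have h := hball (N + r') (by omega) le_rfl x
      push_cast at h
      rwa [add_sub_add_left_eq_sub] at h) (by
      refine lt_of_le_of_lt ?_ hmass
      gcongr
      rw [mul_assoc, natCast_card_rpow_mul]
      have h1 : s * (N + r') + -((r' - r) * (m * n - n) : ℝ) =
        (N + r) * (m * n - n) + (N + r') * (s - (m * n - n)) := by ring
      rw [h1]
      have h2 : (2 : ENNReal) ≤ Nat.card F := by exact_mod_cast Finite.one_lt_card (α := F)
      -- The exponent `3` in `ht` pays for the factor `1 + 4`, as `k ≥ 2`.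
      have h3 : (5 : ENNReal) ≤ (Nat.card F : ENNReal) ^ (3 : ℝ) := by
        calc (5 : ENNReal) ≤ 2 ^ (3 : ℝ) := by
              rw [show (3 : ℝ) = ((3 : ℕ) : ℝ) by norm_num, ENNReal.rpow_natCast]
              norm_num
          _ ≤ _ := by gcongr
      calc _ = (5 : ENNReal) * (Nat.card F : ENNReal) ^
            ((N + r) * (m * n - n) + (N + r') * (s - (m * n - n)) : ℝ) := by
            rw [show (5 : ENNReal) = 1 + 4 by norm_num, add_mul (1 : ENNReal) 4,
              one_mul]
        _ ≤ (Nat.card F : ENNReal) ^ (3 : ℝ) * (Nat.card F : ENNReal) ^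
            ((N + r) * (m * n - n) + (N + r') * (s - (m * n - n)) : ℝ) := by gcongr
        _ ≤ _ := by
          rw [natCast_card_rpow_mul]
          gcongr
          · exact one_le_natCast_card F
          · linarith)
  exact ⟨z, hz.2, hz.1, hz1, hz2⟩

end Measure

end Avoidance

end LaurentInf

/-! ### The lower bound for the Hausdorff dimension -/

namespace LaurentInf

section LowerBound

variable {F : Type*} [Field F] [Finite F] {m n : ℕ}

/-- One step of the construction of a well approximable matrix that avoids a cover: first to a
wide neighbourhood of a rational plane, which ubiquity provides, then to a narrow one. -/
theorem exists_avoids_step [MeasurableSpace (LaurentMatrix F m n)]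
    [BorelSpace (LaurentMatrix F m n)] (μ : Measure (LaurentMatrix F m n)) [μ.IsAddHaarMeasure]
    {S : Set (Fin m → F[X])} (hS : S.Infinite) {τ b s : ℝ} (hτ : 0 ≤ τ)
    (hτv : n * τ < convExponent S ∨ τ = 0) (hτb : τ ≤ b) (hs1 : (m * n - n : ℝ) ≤ s)
    (hs2 : s ≤ m * n) (hs3 : (1 + b) * (s - (m * n - n)) < n * (1 + τ))
    {c : ℕ → LaurentMatrix F m n} {j : ℕ → ℕ} {x : LaurentMatrix F m n} {a : ℕ}
    (hx : x ∈ ballSubmodule F m n 0) (hxa : Avoids c j x a)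
    (hmass : coverMass c j s x a * (4 * (Nat.card F : ENNReal) ^ (s * a)) < 1)
    {P : ℕ → Prop} (hP : ∀ᶠ N in atTop, P N) :
    ∃ N, P N ∧ ∃ q ∈ shell S N, ∃ z ∈ annihilator (tensorLT n q ⌈b * N⌉₊),
      z - x ∈ ballSubmodule F m n a ∧ Avoids c j z (N + ⌈b * N⌉₊) ∧
      coverMass c j s z (N + ⌈b * N⌉₊) *
        (4 * (Nat.card F : ENNReal) ^ (s * (N + ⌈b * N⌉₊ : ℕ))) < 1 := by
  have hgap : 0 < n * (1 + τ) - (1 + b) * (s - (m * n - n)) := by linarith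
  -- The strict inequality `hs3` leaves an exponent linear in `N` that absorbs the roundings of
  -- `τ N` and `b N`, the factor `k ^ 3` and the dependence on the previous radius.
  have hlarge := (tendsto_natCast_atTop_atTop (R := ℝ)).const_mul_atTop hgap |>.eventually_ge_atTop
    ((s - (m * n - n)) + 3 + a * (m * n - s) + n)
  have hη : 0 < μ.real (ballSubmodule F m n a : Set (LaurentMatrix F m n)) / 2 :=
    half_pos (real_ballSubmodule_pos μ a)
  obtain ⟨N, hN, hPN, hNlarge, hNa⟩ := ((frequently_real_diff_le μ hS hτ hτv hη).and_eventually
    (hP.and (hlarge.and (eventually_ge_atTop a)))).exists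
  let r := ⌊τ * N⌋₊
  let r' := ⌈b * N⌉₊
  have hN0 : (0 : ℝ) ≤ N := Nat.cast_nonneg N
  have hrr : r ≤ r' := by
    have h1 : (r : ℝ) ≤ τ * N := Nat.floor_le (by positivity)
    have h2 : b * N ≤ r' := Nat.le_ceil _
    have h3 : τ * N ≤ b * N := by gcongr
    exact_mod_cast h1.trans (h3.trans h2)
  have hopen : ∀ q ∈ shell S N,
      MeasurableSet (annihilator (tensorLT n q r) : Set (LaurentMatrix F m n)) := by
    intro q hq
    have := finite_tensorLT (n := n) (ne_zero_of_infAbs_eq_pow hq.2) r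
    exact (isOpen_annihilator _).measurableSet
  obtain ⟨y, hy, hyx, hyb, hym⟩ := exists_avoids_of_large μ hs2 hx hxa hmass
    (E := ⋃ q ∈ shell S N, (annihilator (tensorLT n q r) : Set (LaurentMatrix F m n)))
    ((finite_shell S N).measurableSet_biUnion hopen) (by
      have hfin : μ ((ballSubmodule F m n 0 : Set (LaurentMatrix F m n)) \
          ⋃ q ∈ shell S N, (annihilator (tensorLT n q r) : Set (LaurentMatrix F m n))) ≠ ⊤ :=
        ((measure_mono Set.sdiff_subset).trans_lt (measure_ballSubmodule_ne_top μ 0).lt_top).ne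
      rw [← ENNReal.toReal_le_toReal hfin
        (ENNReal.div_ne_top (measure_ballSubmodule_ne_top μ a) two_ne_zero), ENNReal.toReal_div]
      exact hN) (b := N + r) (by omega)
  obtain ⟨q, hq, hyq⟩ := Set.mem_iUnion₂.1 hy
  obtain ⟨z, hz, hzy, hza, hzm⟩ := exists_avoids_of_plane μ hs1 hq.2 hrr hyq hyb hym (by
    have h1 : τ * N < r + 1 := Nat.lt_floor_add_one _
    have h2 : (r' : ℝ) < b * N + 1 := Nat.ceil_lt_add_one (by
      have : 0 ≤ b := hτ.trans hτb
      positivity)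
    have h3 : (r' : ℝ) * (s - (m * n - n)) ≤ (b * N + 1) * (s - (m * n - n)) :=
      mul_le_mul_of_nonneg_right h2.le (by linarith)
    have h4 : τ * N * n ≤ (r + 1) * n := mul_le_mul_of_nonneg_right h1.le (Nat.cast_nonneg n)
    push_cast
    nlinarith)
  refine ⟨N, hPN, q, hq, z, hz, ?_, hza, ?_⟩
  · have := add_mem (ballSubmodule_anti (by omega) hzy) hyx
    rwa [sub_add_sub_cancel] at this
  · rw [Nat.cast_add]
    exact hzm

/-- A family of balls of small total mass does not cover `W_S(m, n; ψ)`. -/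
theorem exists_mem_approxSet_forall_notMem {S : Set (Fin m → F[X])} (hS : S.Infinite)
    {ψ : (Fin m → F[X]) → ℝ} {τ b s : ℝ} (hτ : 0 ≤ τ)
    (hτv : n * τ < convExponent S ∨ τ = 0) (hτb : τ ≤ b) (hs1 : (m * n - n : ℝ) ≤ s)
    (hs2 : s ≤ m * n) (hs3 : (1 + b) * (s - (m * n - n)) < n * (1 + τ))
    (hψ : ∀ᶠ N : ℕ in atTop, ∀ q ∈ shell S N, (Nat.card F : ℝ) ^ (-(⌈b * N⌉₊ : ℤ)) ≤ ψ q)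
    (c : ℕ → LaurentMatrix F m n) (j : ℕ → ℕ)
    (hmass : (∑' i, (Nat.card F : ENNReal) ^ (-(s * j i))) * 4 < 1) :
    ∃ A ∈ approxSet n S ψ, ∀ i, A - c i ∉ ballSubmodule F m n (j i) := by
  let _ : MeasurableSpace (LaurentMatrix F m n) := borel _
  have : BorelSpace (LaurentMatrix F m n) := ⟨rfl⟩
  have : LocallyCompactSpace (LaurentMatrix F m n) :=
    inferInstanceAs (LocallyCompactSpace (Fin m → Fin n → LaurentInf F))
  let μ : Measure (LaurentMatrix F m n) := Measure.addHaar
  -- The invariant of the construction, for a ball with centre `p.1` and radius `k ^ (-p.2)`.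
  let Good : LaurentMatrix F m n × ℕ → Prop := fun p => p.1 ∈ ballSubmodule F m n 0 ∧
    Avoids c j p.1 p.2 ∧
    coverMass c j s p.1 p.2 * (4 * (Nat.card F : ENNReal) ^ (s * p.2)) < 1
  have hstep (p : {p // Good p}) : ∃ p' : {p // Good p},
      p'.1.1 - p.1.1 ∈ ballSubmodule F m n p.1.2 ∧ p.1.2 < p'.1.2 ∧
      ∃ N ≥ p.1.2, ∃ q ∈ shell S N, ∀ z, z - p'.1.1 ∈ ballSubmodule F m n p'.1.2 →
        distNearest (Matrix.vecMul (vec q) z) < ψ q := by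
    obtain ⟨⟨x, a⟩, hx, hxa, hxm⟩ := p
    obtain ⟨N, ⟨hN, hNψ⟩, q, hq, z, hz, hzx, hza, hzm⟩ := exists_avoids_step μ hS hτ hτv hτb hs1
      hs2 hs3 hx hxa hxm ((eventually_gt_atTop a).and hψ)
    refine ⟨⟨(z, N + ⌈b * N⌉₊), annihilator_le _ hz, hza, hzm⟩, hzx, ?_, N, hN.le, q, hq,
      fun z' hz' => ?_⟩
    · change a < N + _
      omega
    · have h1 := add_mem (ballSubmodule_le_annihilator hq.2 _ hz') hz
      rw [sub_add_cancel] at h1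
      exact ((distNearest_lt_iff_mem_annihilator (annihilator_le _ h1)).2 h1).trans_le (hNψ q hq)
  choose next hnext using hstep
  have hinit : Good (0, 0) := by
    refine ⟨zero_mem _, ?_, ?_⟩
    · intro i hi _
      have h0 : j i = 0 := Nat.le_zero.1 hi
      have h1 := ENNReal.le_tsum (f := fun i => (Nat.card F : ENNReal) ^ (-(s * j i))) i
      simp only [h0, Nat.cast_zero, mul_zero, neg_zero, ENNReal.rpow_zero] at h1
      refine absurd hmass (not_lt.2 ?_)
      calc (1 : ENNReal) ≤ 1 * 4 := by norm_num
        _ ≤ _ := by gcongr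
    · refine lt_of_le_of_lt ?_ hmass
      simp only [Nat.cast_zero, mul_zero, ENNReal.rpow_zero, mul_one]
      gcongr
      refine ENNReal.tsum_le_tsum fun i => ?_
      split_ifs
      · exact le_rfl
      · exact zero_le
  let p : ℕ → {p // Good p} := fun t => Nat.rec ⟨(0, 0), hinit⟩ (fun _ => next) t
  have hp (t : ℕ) := hnext (p t)
  let Z : ℕ → Set (LaurentMatrix F m n) :=
    fun t => (fun z => z - (p t).1.1) ⁻¹'
      (ballSubmodule F m n (p t).1.2 : Set (LaurentMatrix F m n))
  have hmono (t : ℕ) : t ≤ (p t).1.2 := by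
    induction t with
    | zero => exact Nat.zero_le _
    | succ t ih => exact lt_of_le_of_lt ih (hp t).2.1
  have hclosed (t : ℕ) : IsClosed (Z t) :=
    (isClosed_ballSubmodule _).preimage (continuous_id.sub continuous_const)
  have hcompact : IsCompact (Z 0) := by
    have : Z 0 = (ballSubmodule F m n 0 : Set (LaurentMatrix F m n)) := by
      ext z
      simp [Z, p]
    rw [this]
    exact isCompact_ballSubmodule 0
  obtain ⟨A, hA⟩ := IsCompact.nonempty_iInter_of_sequence_nonempty_isCompact_isClosed Z
    (fun t z hz => by
      have h1 : z - (p (t + 1)).1.1 ∈ ballSubmodule F m n (p (t + 1)).1.2 := hz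
      have := add_mem (ballSubmodule_anti (hp t).2.1.le h1) (hp t).1
      rwa [sub_add_sub_cancel] at this)
    (fun t => ⟨(p t).1.1, by
      rw [Set.mem_preimage, sub_self]
      exact zero_mem _⟩) hcompact hclosed
  rw [Set.mem_iInter] at hA
  refine ⟨A, ?_, fun i hi => ?_⟩
  · refine infinite_of_frequently (frequently_atTop.2 fun M => ?_)
    obtain ⟨-, -, N, hN, q, hq, hz⟩ := hp M
    exact ⟨N, (hmono M).trans hN, q, hq, hz A (hA (M + 1))⟩
  · refine (p (j i)).2.2.1 i (hmono (j i)) ?_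
    have h1 : A - (p (j i)).1.1 ∈ ballSubmodule F m n (j i) :=
      ballSubmodule_anti (hmono (j i)) (hA (j i))
    have := sub_mem hi h1
    rwa [sub_sub_sub_cancel_left] at this

theorem natCast_card_rpow_eq_ofReal (F : Type*) [Field F] [Finite F] (x : ℝ) :
    (Nat.card F : ENNReal) ^ x = ENNReal.ofReal ((Nat.card F : ℝ) ^ x) := by
  rw [← ENNReal.ofReal_rpow_of_pos (card_pos_real F), ENNReal.ofReal_natCast]

theorem exists_rpow_neg_le (F : Type*) [Field F] [Finite F] {s : ℝ} (hs : 0 < s) {ε : NNReal}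
    (hε : 0 < ε) : ∃ j : ℕ, (Nat.card F : ENNReal) ^ (-(s * j)) ≤ ε := by
  have hk := card_pos_real F
  obtain ⟨j, hj⟩ := exists_pow_lt_of_lt_one (show (0 : ℝ) < ε by exact_mod_cast hε)
    (Real.rpow_lt_one_of_one_lt_of_neg (one_lt_card F) (neg_lt_zero.2 hs))
  refine ⟨j, ?_⟩
  rw [natCast_card_rpow_eq_ofReal, ← neg_mul, Real.rpow_mul hk.le, Real.rpow_natCast,
    ← ENNReal.ofReal_coe_nnreal]
  exact ENNReal.ofReal_le_ofReal hj.le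

/-- A set of small diameter lies in a ball of comparable radius. Sets of diameter `0` have no
comparable ball of positive radius, hence the error term `ε`. -/
theorem exists_ballSubmodule_cover {s : ℝ} (hs : 0 < s) (B : Set (LaurentMatrix F m n))
    (hB : Metric.ediam B ≤ (Nat.card F : ENNReal) ^ (-1 : ℝ)) {ε : NNReal} (hε : 0 < ε) :
    ∃ (x : LaurentMatrix F m n) (j : ℕ), (∀ A ∈ B, A - x ∈ ballSubmodule F m n j) ∧
      (Nat.card F : ENNReal) ^ (-(s * j)) ≤
        (Nat.card F : ENNReal) ^ (2 * s) * (⨆ _ : B.Nonempty, Metric.ediam B ^ s) + ε := by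
  have hk := card_pos_real F
  have hk1 := one_lt_card F
  rcases B.eq_empty_or_nonempty with rfl | ⟨x, hx⟩
  · obtain ⟨j, hj⟩ := exists_rpow_neg_le F hs hε
    exact ⟨0, j, fun A hA => absurd hA (Set.notMem_empty A), hj.trans le_add_self⟩
  rcases eq_or_ne (Metric.ediam B) 0 with h0 | h0
  · obtain ⟨j, hj⟩ := exists_rpow_neg_le F hs hε
    refine ⟨x, j, fun A hA => ?_, hj.trans le_add_self⟩
    rw [Metric.ediam_eq_zero_iff.1 h0 hA hx, sub_self]
    exact zero_mem _
  have hfin : Metric.ediam B ≠ ⊤ := ne_top_of_le_ne_top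
    (ENNReal.rpow_ne_top_of_ne_zero (natCast_card_ne_zero F) (ENNReal.natCast_ne_top _)) hB
  let δ := (Metric.ediam B).toReal
  have hδ : 0 < δ := ENNReal.toReal_pos h0 hfin
  have hδB : ENNReal.ofReal δ = Metric.ediam B := ENNReal.ofReal_toReal hfin
  have hδ1 : δ ≤ (Nat.card F : ℝ)⁻¹ := by
    rw [← hδB, natCast_card_rpow_eq_ofReal, Real.rpow_neg_one] at hB
    exact (ENNReal.ofReal_le_ofReal_iff (inv_pos.2 hk).le).1 hB
  have hk2 : (Nat.card F : ℝ)⁻¹ < 1 := inv_lt_one_of_one_lt₀ hk1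
  obtain ⟨N, hN1, hN2⟩ := exists_nat_pow_near_of_lt_one hδ (hδ1.trans hk2.le) (inv_pos.2 hk) hk2
  obtain ⟨j, rfl⟩ : ∃ j, N = j + 1 := by
    refine Nat.exists_eq_succ_of_ne_zero ?_
    rintro rfl
    rw [zero_add, pow_one] at hN1
    exact absurd hδ1 (not_le.2 hN1)
  refine ⟨x, j, fun A hA => ?_, ?_⟩
  · rw [mem_ballSubmodule_iff_norm, ← dist_eq_norm]
    have h1 : dist A x ≤ δ := by
      rw [dist_edist]
      exact ENNReal.toReal_mono hfin (Metric.edist_le_ediam_of_mem hA hx)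
    refine (h1.trans hN2).trans_lt ?_
    rw [zpow_neg, zpow_natCast, ← inv_pow]
    exact pow_lt_pow_right_of_lt_one₀ (inv_pos.2 hk) hk2 (Nat.lt_succ_self j)
  · refine le_trans ?_ le_self_add
    have hne : B.Nonempty := ⟨x, hx⟩
    rw [iSup_pos hne, ← hδB, natCast_card_rpow_eq_ofReal,
      natCast_card_rpow_eq_ofReal, ENNReal.ofReal_rpow_of_pos hδ,
      ← ENNReal.ofReal_mul (Real.rpow_nonneg hk.le _)]
    refine ENNReal.ofReal_le_ofReal ?_
    calc (Nat.card F : ℝ) ^ (-(s * j)) =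
          (Nat.card F : ℝ) ^ (2 * s) * (((Nat.card F : ℝ)⁻¹) ^ (j + 1 + 1)) ^ s := by
          rw [inv_pow, ← Real.rpow_natCast, ← Real.rpow_neg hk.le, ← Real.rpow_mul hk.le,
            ← Real.rpow_add hk]
          push_cast
          ring_nf
      _ ≤ _ := by gcongr

/-- A set has positive Hausdorff measure if no family of balls of small total mass covers it. -/
theorem hausdorffMeasure_ne_zero_of_forall_exists [MeasurableSpace (LaurentMatrix F m n)]
    [BorelSpace (LaurentMatrix F m n)] {s : ℝ} (hs : 0 < s) {W : Set (LaurentMatrix F m n)}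
    (h : ∀ (c : ℕ → LaurentMatrix F m n) (j : ℕ → ℕ),
      (∑' i, (Nat.card F : ENNReal) ^ (-(s * j i))) * 4 < 1 →
        ∃ A ∈ W, ∀ i, A - c i ∉ ballSubmodule F m n (j i)) :
    Measure.hausdorffMeasure s W ≠ 0 := by
  intro h0
  -- `K` is the loss in replacing the sets of a cover by balls.
  let K := (Nat.card F : ENNReal) ^ (2 * s)
  have hK0 : K ≠ 0 := (ENNReal.rpow_pos (natCast_card_ne_zero F).bot_lt
    (ENNReal.natCast_ne_top _)).ne'
  have hK1 : K ≠ ⊤ :=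
    ENNReal.rpow_ne_top_of_ne_zero (natCast_card_ne_zero F) (ENNReal.natCast_ne_top _)
  rw [Measure.hausdorffMeasure_apply, ENNReal.iSup_eq_zero] at h0
  have h1 := h0 ((Nat.card F : ENNReal) ^ (-1 : ℝ))
  rw [ENNReal.iSup_eq_zero] at h1
  have h2 := (h1 (ENNReal.rpow_pos (natCast_card_ne_zero F).bot_lt
    (ENNReal.natCast_ne_top _))).trans_lt (show 0 < K⁻¹ * 16⁻¹ from
      ENNReal.mul_pos (ENNReal.inv_ne_zero.2 hK1) (by simp))
  simp only [iInf_lt_iff] at h2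
  obtain ⟨t, hWt, htd, hts⟩ := h2
  obtain ⟨ε, hε, hεs⟩ := ENNReal.exists_pos_sum_of_countable (ε := 16⁻¹) (by simp) ℕ
  choose c j hmem hmass using fun i => exists_ballSubmodule_cover hs (t i) (htd i) (hε i)
  obtain ⟨A, hA, hav⟩ := h c j (by
    have h3 : ∑' i, (Nat.card F : ENNReal) ^ (-(s * j i)) ≤ 16⁻¹ + 16⁻¹ := by
      refine (ENNReal.tsum_le_tsum hmass).trans ?_
      rw [ENNReal.tsum_add, ENNReal.tsum_mul_left]
      refine add_le_add ?_ hεs.le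
      calc _ ≤ K * (K⁻¹ * 16⁻¹) := by gcongr
        _ = 16⁻¹ := by rw [← mul_assoc, ENNReal.mul_inv_cancel hK0 hK1, one_mul]
    refine (mul_le_mul_left h3 4).trans_lt ?_
    rw [← two_mul, mul_right_comm]
    rw [← div_eq_mul_inv]
    refine (ENNReal.div_lt_iff (by simp) (by simp)).2 ?_
    norm_num)
  obtain ⟨i, hi⟩ := Set.mem_iUnion.1 (hWt hA)
  exact hav i (hmem i A hi)

/-- Exponents `τ` slightly below `v(S) / n` and `b` slightly above `l` for the construction of well
approximable matrices. -/
theorem exists_ubiquity_exponents {S : Set (Fin m → F[X])} (hn : 0 < n) {l s : ℝ} (hl0 : 0 ≤ l)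
    (hv0 : 0 ≤ convExponent S) (hvl : convExponent S ≤ n * l) (hs1 : n * ((m : ℝ) - 1) < s)
    (hs : s < n * ((m : ℝ) - 1) + (n + convExponent S) / (1 + l)) :
    ∃ τ b : ℝ, 0 ≤ τ ∧ (n * τ < convExponent S ∨ τ = 0) ∧ τ ≤ b ∧ l < b ∧
      (1 + b) * (s - (m * n - n)) < n * (1 + τ) := by
  have hn0 : (0 : ℝ) < n := by exact_mod_cast hn
  have hσ : s - (m * n - n) = s - n * ((m : ℝ) - 1) := by ring
  rw [hσ]
  let σ := s - n * ((m : ℝ) - 1)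
  have hσ0 : 0 < σ := by simp only [σ]; linarith
  have hσ1 : σ < (n + convExponent S) / (1 + l) := by simp only [σ]; linarith
  rw [lt_div_iff₀ (by linarith)] at hσ1
  obtain ⟨τ, hτ0, hτv, hτσ⟩ : ∃ τ : ℝ, 0 ≤ τ ∧ (n * τ < convExponent S ∨ τ = 0) ∧
      σ * (1 + l) < n * (1 + τ) := by
    rcases hv0.eq_or_lt with h0 | h0
    · exact ⟨0, le_rfl, Or.inr rfl, by rw [← h0] at hσ1; linarith⟩
    · obtain ⟨y, hy1, hy2⟩ := exists_between (max_lt h0 (by linarith :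
        σ * (1 + l) - n < convExponent S))
      refine ⟨y / n, div_nonneg ((le_max_left _ _).trans hy1.le) hn0.le, Or.inl ?_, ?_⟩
      · rwa [mul_div_cancel₀ _ hn0.ne']
      · have := (le_max_right _ _).trans_lt hy1
        have hy : n * (1 + y / n) = n + y := by field_simp
        rw [hy]
        linarith
  have hτl : τ ≤ l := by
    rcases hτv with h | h
    · exact le_of_mul_le_mul_left (h.le.trans hvl) hn0
    · rw [h]
      exact hl0
  obtain ⟨b, hb1, hb2⟩ := exists_between (show l < n * (1 + τ) / σ - 1 by
    rw [lt_sub_iff_add_lt, lt_div_iff₀ hσ0]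
    linarith)
  refine ⟨τ, b, hτ0, hτv, hτl.trans hb1.le, hb1, ?_⟩
  rw [lt_sub_iff_add_lt, lt_div_iff₀ hσ0] at hb2
  change (1 + b) * σ < _
  linarith

theorem le_dimH_approxSet (hm : 0 < m) (hn : 0 < n) {S : Set (Fin m → F[X])} (hS : S.Infinite)
    {ψ : (Fin m → F[X]) → ℝ} (hψ : ∀ q, ∃ r : ℤ, ψ q = (Nat.card F : ℝ) ^ r) {l : ℝ}
    (hl : HasOrderAtInfinity S ψ l) (hl0 : 0 ≤ l) (hvl : convExponent S ≤ n * l) :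
    ENNReal.ofReal (n * ((m : ℝ) - 1) + (n + convExponent S) / (1 + l)) ≤
      dimH (approxSet n S ψ) := by
  have hψ0 (q : Fin m → F[X]) : 0 < ψ q := by
    obtain ⟨r, hr⟩ := hψ q
    rw [hr]
    exact zpow_pos (card_pos_real F) r
  have hv0 := convExponent_nonneg hS
  have hn0 : (0 : ℝ) < n := by exact_mod_cast hn
  have hm0 : (1 : ℝ) ≤ m := by exact_mod_cast hm
  have hd0 : 0 ≤ n * ((m : ℝ) - 1) := mul_nonneg hn0.le (by linarith)
  let T := n * ((m : ℝ) - 1) + (n + convExponent S) / (1 + l)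
  have hT1 : n * ((m : ℝ) - 1) < T := by
    have : 0 < (n + convExponent S) / (1 + l) := by positivity
    simp only [T]
    linarith
  have hT2 : T ≤ m * n := by
    have : (n + convExponent S) / (1 + l) ≤ n := by
      rw [div_le_iff₀ (by linarith)]
      linarith
    simp only [T]
    linarith
  have key (s : ℝ) (hs1 : n * ((m : ℝ) - 1) < s) (hs2 : s < T) :
      ENNReal.ofReal s ≤ dimH (approxSet n S ψ) := by
    have hs0 : 0 < s := by linarith
    obtain ⟨τ, b, hτ0, hτv, hτb, hlb, hs3⟩ := exists_ubiquity_exponents hn hl0 hv0 hvl hs1 hs2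
    let _ : MeasurableSpace (LaurentMatrix F m n) := borel _
    have : BorelSpace (LaurentMatrix F m n) := ⟨rfl⟩
    refine le_dimH_of_hausdorffMeasure_ne_zero (d := s.toNNReal) ?_
    rw [Real.coe_toNNReal s hs0.le]
    refine hausdorffMeasure_ne_zero_of_forall_exists hs0
      (exists_mem_approxSet_forall_notMem hS hτ0 hτv hτb (by linarith) (by linarith) hs3 ?_)
    filter_upwards [eventually_rpow_le hψ0 hl hlb] with N hN q hq
    refine zpow_neg_natCast_le_of_rpow_le (hψ q) (hN q hq) fun r hr => ?_
    exact_mod_cast hr.trans (Nat.le_ceil _)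
  by_contra! hlt
  obtain ⟨s₀, h1, h2⟩ := ENNReal.lt_iff_exists_nnreal_btwn.1 hlt
  have hT0 : 0 < T := by linarith
  rw [← ENNReal.ofReal_coe_nnreal, ENNReal.ofReal_lt_ofReal_iff hT0] at h2
  obtain ⟨s, hs1, hs2⟩ := exists_between (max_lt hT1 h2)
  refine absurd h1 (not_lt.2 (le_trans ?_ (key s ((le_max_left _ _).trans_lt hs1) hs2)))
  rw [← ENNReal.ofReal_coe_nnreal]
  exact ENNReal.ofReal_le_ofReal ((le_max_right _ _).trans hs1.le)

end LowerBound

end LaurentInf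

theorem theorem1 {F : Type*} [Field F] [Finite F] (m n : ℕ) (hm : 0 < m) (hn : 0 < n)
    (S : Set (Fin m → F[X])) (hS : S.Infinite)
    (ψ : (Fin m → F[X]) → ℝ)
    -- the values of `ψ` are integral powers of `k = #F`
    (hψ : ∀ q, ∃ r : ℤ, ψ q = (Nat.card F : ℝ) ^ r)
    -- `ψ q` depends only on `|q|_∞`
    (hdep : ∀ q q', LaurentInf.infAbs q = LaurentInf.infAbs q' → ψ q = ψ q')
    -- and is decreasing as a function of `|q|_∞`
    (hdec : ∀ q q', LaurentInf.infAbs q ≤ LaurentInf.infAbs q' → ψ q' ≤ ψ q)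
    (l : ℝ) (hl : LaurentInf.HasOrderAtInfinity S ψ l) :
    ((n : ℝ) * l < LaurentInf.convExponent S →
      ∀ [MeasurableSpace (Matrix (Fin m) (Fin n) (LaurentInf F))]
        [BorelSpace (Matrix (Fin m) (Fin n) (LaurentInf F))]
        (μ : Measure (Matrix (Fin m) (Fin n) (LaurentInf F))) [μ.IsAddHaarMeasure],
        μ (LaurentInf.approxSet n S ψ)ᶜ = 0) ∧
    (LaurentInf.convExponent S ≤ (n : ℝ) * l →
      dimH (LaurentInf.approxSet n S ψ) =
        ENNReal.ofReal ((n : ℝ) * ((m : ℝ) - 1) +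
          ((n : ℝ) + LaurentInf.convExponent S) / (1 + l))) := by
  have hψ0 (q : Fin m → F[X]) : 0 < ψ q := by
    obtain ⟨r, hr⟩ := hψ q
    rw [hr]
    exact zpow_pos (LaurentInf.card_pos_real F) r
  have hl0 : 0 ≤ l := LaurentInf.order_nonneg hS hψ0 (B := ψ 0) (fun q => hdec 0 q (by
    rw [LaurentInf.infAbs_zero]
    exact LaurentInf.infAbs_nonneg q)) hl
  refine ⟨fun hv _ _ μ _ => LaurentInf.measure_compl_approxSet μ hS hψ hl hl0 hn hv,
    fun hv => le_antisymm (LaurentInf.dimH_approxSet_le hS hψ hl hl0)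
      (LaurentInf.le_dimH_approxSet hm hn hS hψ hl hl0 hv)⟩
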